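/- Let $n\ge 1$, let $m_1,\dots,m_{n-1}$ be natural numbers, and let $m=m_1+\dots+m_{n-1}$. Let $C_1,\dots,C_{n-1}\subset\mathbb{R}^m$ be nonempty compact convex sets; they may be of any dimensions and in any position (in particular $\dim C_i=m_i$ is allowed, and $C_i$ may lie in the $i$-th coordinate block $\mathbb{R}^{m_i}$ of $\mathbb{R}^m=\mathbb{R}^{m_1}\times\dots\times\mathbb{R}^{m_{n-1}}$). Let $f_{ij}$ ($1\le i\le n-1$, $1\le j\le m_i$) be probability densities on $\mathbb{R}^n$. Let $\mathbf{X}=[\mathbf{X}_1\cdots\mathbf{X}_{n-1}]$ be the random $n\times m$ matrix with blocks $\mathbf{X}_i=[X_{i1}\cdots X_{im_i}]$, whose columns $X_{ij}$ are independent random vectors in $\mathbb{R}^n$ with densities $f_{ij}$. Let $\mathbf{X}^{\#}$ be the random $n\times m$ matrix formed in the same way from independent columns $X^*_{ij}$ with densities $f_{ij}^*$. Here $f^*(x)=\int_0^\infty \mathbf{1}_{\{f>t\}^*}(x)\,dt$ is the symmetric decreasing rearrangement of $f$, where $A^*$ is the open Euclidean ball centered at the origin with the same volume as $A$. For an $n\times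 m$ matrix $T$ with columns $x_1,\dots,x_m$ write $TC=\{\sum_k c_kx_k:\ c\in C\}$. For compact convex sets $K_1,\dots,K_{n-1}\subset\mathbb{R}^n$, let $\Pi^\circ(K_1,\dots,K_{n-1})$ be the polar of the mixed projection body $\Pi(K_1,\dots,K_{n-1})$, whose support function is $\theta\mapsto nV(K_1,\dots,K_{n-1},[0,\theta])$, with $V$ the mixed volume in $\mathbb{R}^n$; that is, $$\Pi^\circ(K_1,\dots,K_{n-1})=\{\theta\in\mathbb{R}^n:\ nV(K_1,\dots,K_{n-1},[0,\theta])\le 1\}.$$ Let $\nu$ be a radial measure with decreasing density, i.e. $d\nu(x)=\rho(\|x\|)\,dx$ with $\rho:[0,\infty)\to[0,\infty]$ non-increasing. Then $$\mathbb{E}\,\nu\big(\Pi^{\circ}(\mathbf{X}C_1,\dots,\mathbf{X}C_{n-1})\big)\ \le\ \mathbb{E}\,\nu\big(\Pi^{\circ}(\mathbf{X}^{\#}C_1,\dots,\mathbf{X}^{\#}C_{n-1})\big),$$ where both sides may be $+\infty$. -/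

import Mathlib

open MeasureTheory ProbabilityTheory
open scoped ENNReal NNReal Pointwise

noncomputable section

namespace Petty

/-- The mixed volume `V(K₁, …, Kₙ)` of `n` compact convex sets in `ℝⁿ`, by polarization of the volume:
`n! V(K₁, …, Kₙ) = ∑_{S ⊆ {1, …, n}} (-1)^(n - |S|) vol(∑_{i ∈ S} Kᵢ)` (Minkowski sums).
That this is the coefficient in Minkowski's volume polynomial is `mixedVolume_eq_coeff`. -/
def mixedVolume {n : ℕ} (K : Fin n → Set (EuclideanSpace ℝ (Fin n))) : ℝ :=
  (n.factorial : ℝ)⁻¹ *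
    ∑ S : Finset (Fin n), (-1 : ℝ) ^ (n - S.card) * volume.real (∑ i ∈ S, K i)

/-- Whenever the volume of `λ₁K₁ + ⋯ + λₙKₙ` is the polynomial
`∑_{i₁, …, iₙ} λ_{i₁} ⋯ λ_{iₙ} a(i₁, …, iₙ)` with symmetric coefficients `a`, the coefficient
`a(1, …, n)` is the mixed volume of `K₁, …, Kₙ`. -/
theorem mixedVolume_eq_coeff {n : ℕ} (K : Fin n → Set (EuclideanSpace ℝ (Fin n)))
    (hne : ∀ i, (K i).Nonempty)
    (a : (Fin n → Fin n) → ℝ)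
    (hsymm : ∀ (i : Fin n → Fin n) (σ : Equiv.Perm (Fin n)), a (i ∘ σ) = a i)
    (hpoly : ∀ l : Fin n → ℝ, (∀ i, 0 ≤ l i) →
      volume.real (∑ i, l i • K i) = ∑ i : Fin n → Fin n, (∏ k, l (i k)) * a i) :
    mixedVolume K = a id := by
  classical
  have h1 : ∀ S : Finset (Fin n), volume.real (∑ i ∈ S, K i)
      = ∑ i : Fin n → Fin n, (if ∀ k, i k ∈ S then a i else 0) := by
    intro S
    have h := hpoly (fun i => if i ∈ S then 1 else 0) (fun i => by split_ifs <;> norm_num)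
    have h2 : (∑ i, (if i ∈ S then (1 : ℝ) else 0) • K i) = ∑ i ∈ S, K i := by
      rw [← Finset.sum_filter_add_sum_filter_not Finset.univ (fun i => i ∈ S)]
      rw [Finset.sum_congr rfl (g := fun i => K i), Finset.sum_congr (s₁ := Finset.univ.filter
        (fun i => ¬ i ∈ S)) rfl (g := fun _ => (0 : Set (EuclideanSpace ℝ (Fin n))))]
      · simp
      · intro i hi
        rw [if_neg (Finset.mem_filter.1 hi).2, Set.zero_smul_set (hne i)]
      · intro i hi
        rw [if_pos (Finset.mem_filter.1 hi).2, one_smul]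
    rw [h2] at h
    rw [h]
    refine Finset.sum_congr rfl fun i _ => ?_
    by_cases hi : ∀ k, i k ∈ S
    · simp [hi]
    · rw [if_neg hi]
      push Not at hi
      obtain ⟨k, hk⟩ := hi
      rw [Finset.prod_eq_zero (Finset.mem_univ k) (by simp [hk]), zero_mul]
  have h3 : ∀ i : Fin n → Fin n,
      (∑ S : Finset (Fin n), if ∀ k, i k ∈ S then (-1 : ℝ) ^ (n - S.card) else 0)
        = if Function.Surjective i then 1 else 0 := by
    intro i
    have hc : (∑ S : Finset (Fin n), if ∀ k, i k ∈ S then (-1 : ℝ) ^ (n - S.card) else 0)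
        = ∑ T ∈ (Finset.univ \ Finset.univ.image i).powerset, (-1 : ℝ) ^ T.card := by
      rw [← Finset.sum_filter]
      refine Finset.sum_bij' (fun S _ => Sᶜ) (fun T _ => Tᶜ) ?_ ?_ ?_ ?_ ?_
      · intro S hS
        simp only [Finset.mem_filter, Finset.mem_univ, true_and] at hS
        rw [Finset.mem_powerset]
        intro x hx
        simp only [Finset.mem_sdiff, Finset.mem_univ, true_and, Finset.mem_image, not_exists]
        intro k hk
        exact (Finset.mem_compl.1 hx) (hk ▸ hS k)
      · intro T hT
        rw [Finset.mem_powerset] at hT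
        simp only [Finset.mem_filter, Finset.mem_univ, true_and, Finset.mem_compl]
        intro k hk
        have := hT hk
        simp at this
      · intro S _; simp
      · intro T _; simp
      · intro S _
        rw [Finset.card_compl, Fintype.card_fin]
    rw [hc]
    have := Finset.sum_powerset_neg_one_pow_card (x := Finset.univ \ Finset.univ.image i)
    have h4 : (∑ T ∈ (Finset.univ \ Finset.univ.image i).powerset, (-1 : ℝ) ^ T.card)
        = if (Finset.univ \ Finset.univ.image i) = ∅ then 1 else 0 := by
      exact_mod_cast this
    rw [h4]
    refine if_congr ?_ rfl rfl
    simp [Finset.ext_iff, Function.Surjective]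
  have h5 : (∑ S : Finset (Fin n), (-1 : ℝ) ^ (n - S.card) * volume.real (∑ i ∈ S, K i))
      = ∑ i : Fin n → Fin n, if Function.Surjective i then a i else 0 := by
    simp_rw [h1, Finset.mul_sum]
    rw [Finset.sum_comm]
    refine Finset.sum_congr rfl fun i _ => ?_
    have := congrArg (fun x => x * a i) (h3 i)
    simp only [Finset.sum_mul, ite_mul, one_mul, zero_mul] at this
    rw [← this]
    refine Finset.sum_congr rfl fun S _ => ?_
    split_ifs <;> simp
  have h6 : (∑ i : Fin n → Fin n, if Function.Surjective i then a i else 0)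
      = ∑ _σ : Equiv.Perm (Fin n), a id := by
    rw [← Finset.sum_filter]
    symm
    refine Finset.sum_bij (fun σ _ => (σ : Fin n → Fin n)) ?_ ?_ ?_ ?_
    · intro σ _; simp [σ.surjective]
    · intro σ _ τ _ h; exact DFunLike.coe_injective h
    · intro i hi
      have hs := (Finset.mem_filter.1 hi).2
      exact ⟨Equiv.ofBijective i (Finite.injective_iff_bijective.1
        (Finite.injective_iff_surjective.2 hs)), Finset.mem_univ _, rfl⟩
    · intro σ _; exact (hsymm id σ).symm
  rw [mixedVolume, h5, h6]
  have : (n.factorial : ℝ) ≠ 0 := by positivity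
  simp [Fintype.card_perm, this]

/-- With `n = d + 1`: the support function `θ ↦ n V(K₁, …, K_{n-1}, [0, θ])` of the mixed
projection body `Π(K₁, …, K_{n-1})` of `n - 1` compact convex sets in `ℝⁿ`. -/
def mixedProjSupport {d : ℕ} (K : Fin d → Set (EuclideanSpace ℝ (Fin (d + 1))))
    (θ : EuclideanSpace ℝ (Fin (d + 1))) : ℝ :=
  ((d + 1 : ℕ) : ℝ) *
    mixedVolume (Fin.snoc (α := fun _ => Set (EuclideanSpace ℝ (Fin (d + 1)))) K (segment ℝ 0 θ))

/-- The polar `Π°(K₁, …, K_{n-1}) = {θ : h_Π(θ) ≤ 1}` of the mixed projection body. -/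
def polarMixedProj {d : ℕ} (K : Fin d → Set (EuclideanSpace ℝ (Fin (d + 1)))) :
    Set (EuclideanSpace ℝ (Fin (d + 1))) :=
  {θ | mixedProjSupport K θ ≤ 1}

/-- The image `[x₁ … x_m] C = {∑ₖ cₖ xₖ : c ∈ C}` of `C ⊆ ℝᵐ` under the matrix with columns `xₖ`. -/
def matImage {n : ℕ} {κ : Type*} [Fintype κ] (x : κ → EuclideanSpace ℝ (Fin n))
    (C : Set (κ → ℝ)) : Set (EuclideanSpace ℝ (Fin n)) :=
  (fun c : κ → ℝ => ∑ k, c k • x k) '' C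

/-- The symmetric rearrangement `A*` of a set `A` of finite volume: the open Euclidean ball centred
at the origin with the volume of `A`. -/
def setRearrangement {n : ℕ} (A : Set (EuclideanSpace ℝ (Fin n))) :
    Set (EuclideanSpace ℝ (Fin n)) :=
  Metric.ball 0 ((volume.real A /
    volume.real (Metric.ball (0 : EuclideanSpace ℝ (Fin n)) 1)) ^ (1 / (n : ℝ)))

theorem volume_setRearrangement {n : ℕ} (hn : n ≠ 0) (A : Set (EuclideanSpace ℝ (Fin n)))
    (hA : volume A ≠ ∞) : volume (setRearrangement A) = volume A := by
  have : Nonempty (Fin n) := ⟨⟨0, Nat.pos_of_ne_zero hn⟩⟩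
  have hb : volume (Metric.ball (0 : EuclideanSpace ℝ (Fin n)) 1) ≠ ∞ :=
    measure_ball_lt_top.ne
  have hb0 : volume.real (Metric.ball (0 : EuclideanSpace ℝ (Fin n)) 1) ≠ 0 :=
    (ENNReal.toReal_pos (Metric.measure_ball_pos _ _ one_pos).ne' hb).ne'
  have hq : 0 ≤ volume.real A / volume.real (Metric.ball (0 : EuclideanSpace ℝ (Fin n)) 1) := by
    positivity
  rw [setRearrangement, Measure.addHaar_ball _ _ (by positivity), finrank_euclideanSpace_fin,
    ← Real.rpow_natCast, ← Real.rpow_mul hq, one_div, inv_mul_cancel₀ (by exact_mod_cast hn),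
    Real.rpow_one, ← ENNReal.ofReal_toReal hb, ← ENNReal.ofReal_mul hq]
  change ENNReal.ofReal (_ * volume.real _) = _
  rw [div_mul_cancel₀ _ hb0, Measure.real, ENNReal.ofReal_toReal hA]

/-- The symmetric decreasing rearrangement `f*(x) = ∫₀^∞ 1[x ∈ {f > t}*] dt` of a density. -/
def symmDecrRearrangement {n : ℕ} (f : EuclideanSpace ℝ (Fin n) → ℝ≥0∞)
    (x : EuclideanSpace ℝ (Fin n)) : ℝ≥0∞ :=
  ∫⁻ t in Set.Ioi (0 : ℝ),
    (setRearrangement {y | ENNReal.ofReal t < f y}).indicator (fun _ => (1 : ℝ≥0∞)) x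

/-- The radial measure on `ℝⁿ` with density `x ↦ ρ(‖x‖)` with respect to Lebesgue measure. -/
def radialMeasure (n : ℕ) (ρ : ℝ≥0 → ℝ≥0∞) : Measure (EuclideanSpace ℝ (Fin n)) :=
  volume.withDensity fun x => ρ ‖x‖₊

end Petty

end

/-!
The polar body contains `θ` iff `(X, θ)` lies in
`G = {(X, θ) : n V(X C₁, …, X C_{n-1}, [0, θ]) ≤ 1}`, so both expectations are integrals over `G` of
a product of densities, one per column and `ρ(‖θ‖)` for `θ`. The proof combines a property of `G`
with a rearrangement inequality for sets that have this property.

*Convexity on lines.* When the columns and `θ` move with constant velocities along a common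
direction `e`, the bodies `X Cᵢ` and `[0, θ]` are the shadows of fixed convex bodies in `ℝⁿ⁺¹` under
projections that vary linearly. The mixed volume of the shadows along `z` is a mixed volume in
`ℝⁿ⁺¹` with the segment `[0, z]`, so convexity amounts to
`V(K, …, [0, u + v]) ≤ V(K, …, [0, u]) + V(K, …, [0, v])`. The right-hand side is the mixed volume
with the parallelogram spanned by `u` and `v`, whose softmax potentials tend to potentials of the
diagonal `[0, u + v]` as the weights of the vertices `u` and `v` tend to `0`. Since mixed volumes
are integrals of mixed discriminants of Hessians of potentials, and these are nonnegative, the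
inequality is Fatou's lemma. Thus the sections of `G` by families of parallel lines are convex, and
`G` is invariant under isometries.

*Rearrangement.* By Prékopa–Leindler, moving a box to the origin along with its mirror image does
not decrease its intersection with a symmetric convex set. Sliding and merging intervals in this way
gives the Rogers–Brascamp–Lieb–Luttinger inequality on the line with the indicator of a symmetric
convex set as kernel; reflection makes the sections of `G` symmetric. Applied on lines, it shows
that simultaneous Steiner symmetrization of the sets `E k` does not decrease the measure of
`G ∩ ∏ E k`, and repeated symmetrization brings all the `E k` arbitrarily close to balls. The
layer-cake formula passes from sets to densities.
-/

namespace Petty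

open Set Filter Topology

noncomputable section

/-! ### Layer-cake formulas -/

theorem volume_Ioi_inter_ofReal_lt (a : ℝ≥0∞) :
    volume ({t : ℝ | ENNReal.ofReal t < a} ∩ Ioi 0) = a := by
  induction a with
  | top =>
    have h : {t : ℝ | ENNReal.ofReal t < ∞} ∩ Ioi 0 = Ioi 0 := by ext t; simp
    rw [h, Real.volume_Ioi]
  | coe a =>
    have h : {t : ℝ | ENNReal.ofReal t < a} ∩ Ioi 0 = Ioo 0 (a : ℝ) := by
      ext t
      simp only [mem_inter_iff, mem_ofPred_eq, mem_Ioi, mem_Ioo, and_comm (b := 0 < t),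
        ← ENNReal.ofReal_coe_nnreal]
      exact and_congr_right fun ht => ENNReal.ofReal_lt_ofReal_iff_of_nonneg ht.le
    rw [h, Real.volume_Ioo, sub_zero, ENNReal.ofReal_coe_nnreal]

theorem eq_volume_superlevel {α : Type*} (f : α → ℝ≥0∞) (x : α) :
    f x = volume.restrict (Ioi (0 : ℝ)) {t | x ∈ {y | ENNReal.ofReal t < f y}} := by
  have hm : MeasurableSet {t : ℝ | ENNReal.ofReal t < f x} :=
    measurableSet_lt (by fun_prop) measurable_const
  exact ((Measure.restrict_apply hm).trans (volume_Ioi_inter_ofReal_lt (f x))).symm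

theorem lintegral_eq_lintegral_superlevel {α : Type*} [MeasurableSpace α] (μ : Measure α)
    [SFinite μ] {f : α → ℝ≥0∞} (hf : Measurable f) :
    ∫⁻ x, f x ∂μ = ∫⁻ t in Ioi (0 : ℝ), μ {x | ENNReal.ofReal t < f x} := by
  have hm : MeasurableSet {p : α × ℝ | ENNReal.ofReal p.2 < f p.1} :=
    measurableSet_lt (by fun_prop) (by fun_prop)
  calc ∫⁻ x, f x ∂μ
      = ∫⁻ x, volume.restrict (Ioi (0 : ℝ)) {t | ENNReal.ofReal t < f x} ∂μ :=
        lintegral_congr (eq_volume_superlevel f)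
    _ = (μ.prod (volume.restrict (Ioi 0))) {p : α × ℝ | ENNReal.ofReal p.2 < f p.1} :=
        (Measure.prod_apply hm).symm
    _ = ∫⁻ t in Ioi (0 : ℝ), μ {x | ENNReal.ofReal t < f x} := Measure.prod_apply_symm hm

/-! ### The Brunn–Minkowski inequality on the line -/

theorem volume_add_volume_le_volume_add_of_isCompact {A B : Set ℝ} (hA : IsCompact A)
    (hB : IsCompact B) (hAn : A.Nonempty) (hBn : B.Nonempty) :
    volume A + volume B ≤ volume (A + B) := by
  obtain ⟨a, haA, ha⟩ := hA.exists_isGreatest hAn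
  obtain ⟨b, hbB, hb⟩ := hB.exists_isLeast hBn
  -- The translates `A + b` and `a + B` meet only in `a + b`.
  have hAb : volume ((· + b) '' A) = volume A := by
    rw [image_add_right, measure_preimage_add_right]
  have haB : volume (((a + ·) '' B) \ {a + b}) = volume B := by
    rw [measure_sdiff_null (by simp), image_add_left, measure_preimage_add]
  have hdisj : Disjoint ((· + b) '' A) (((a + ·) '' B) \ {a + b}) := by
    rw [Set.disjoint_left]
    rintro _ ⟨x, hx, rfl⟩ ⟨⟨y, hy, hxy : a + y = x + b⟩, hne : x + b ≠ a + b⟩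
    exact hne (by linarith [ha hx, hb hy])
  rw [← hAb, ← haB, ← measure_union hdisj
    ((hB.image (continuous_const_add a)).measurableSet.diff (measurableSet_singleton _))]
  refine measure_mono ?_
  rintro _ (⟨x, hx, rfl⟩ | ⟨⟨y, hy, rfl⟩, -⟩)
  exacts [add_mem_add hx hbB, add_mem_add haA hy]

theorem volume_add_volume_le_volume_add {A B : Set ℝ} (hA : MeasurableSet A)
    (hB : MeasurableSet B) (hAn : A.Nonempty) (hBn : B.Nonempty) :
    volume A + volume B ≤ volume (A + B) := by
  rcases eq_or_ne (volume A) 0 with hA0 | hA0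
  · obtain ⟨a, ha⟩ := hAn
    calc volume A + volume B = volume ((a + ·) '' B) := by
          rw [hA0, zero_add, image_add_left, measure_preimage_add]
      _ ≤ volume (A + B) := measure_mono (image_subset_iff.2 fun _ hb => add_mem_add ha hb)
  rcases eq_or_ne (volume B) 0 with hB0 | hB0
  · obtain ⟨b, hb⟩ := hBn
    calc volume A + volume B = volume ((· + b) '' A) := by
          rw [hB0, add_zero, image_add_right, measure_preimage_add_right]
      _ ≤ volume (A + B) := measure_mono (image_subset_iff.2 fun _ ha => add_mem_add ha hb)
  refine le_of_forall_lt fun u hu => ?_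
  obtain ⟨v, hv, w, hw, huvw⟩ := ENNReal.exists_lt_add_of_lt_add hu hA0 hB0
  obtain ⟨K, hKA, hK, hvK⟩ := hA.exists_lt_isCompact hv
  obtain ⟨L, hLB, hL, hwL⟩ := hB.exists_lt_isCompact hw
  calc u < volume K + volume L := huvw.trans (ENNReal.add_lt_add hvK hwL)
    _ ≤ volume (K + L) := volume_add_volume_le_volume_add_of_isCompact hK hL
        (nonempty_of_measure_ne_zero hvK.ne_bot) (nonempty_of_measure_ne_zero hwL.ne_bot)
    _ ≤ volume (A + B) := measure_mono (add_subset_add hKA hLB)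

theorem ofReal_mul_volume_add_le {A B : Set ℝ} (hA : MeasurableSet A) (hB : MeasurableSet B)
    (hAn : A.Nonempty) (hBn : B.Nonempty) {r s : ℝ} (hr : 0 < r) (hs : 0 < s) :
    ENNReal.ofReal r * volume A + ENNReal.ofReal s * volume B ≤ volume (r • A + s • B) := by
  have hsmul : ∀ {r : ℝ}, 0 < r → ∀ A : Set ℝ, ENNReal.ofReal r * volume A = volume (r • A) := by
    intro r hr A
    rw [Measure.addHaar_smul, Module.finrank_self, pow_one, abs_of_pos hr]
  rw [hsmul hr, hsmul hs]
  exact volume_add_volume_le_volume_add (hA.const_smul_of_ne_zero hr.ne')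
    (hB.const_smul_of_ne_zero hs.ne') hAn.smul_set hBn.smul_set

/-! ### The Prékopa–Leindler inequality -/

/-- The Prékopa–Leindler inequality for the measure `μ`, as a property of `μ` that passes to
products. -/
def PrekopaLeindler {E : Type*} [MeasurableSpace E] [AddCommGroup E] [Module ℝ E]
    (μ : Measure E) : Prop :=
  ∀ r s : ℝ, 0 < r → 0 < s → r + s = 1 → ∀ f g h : E → ℝ≥0∞,
    Measurable f → Measurable g → Measurable h →
    (∀ x y, f x ^ r * g y ^ s ≤ h (r • x + s • y)) →
    (∫⁻ x, f x ∂μ) ^ r * (∫⁻ x, g x ∂μ) ^ s ≤ ∫⁻ x, h x ∂μ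

theorem ennreal_rpow_mul_rpow_le {r s : ℝ} (hr : 0 < r) (hs : 0 < s) (hrs : r + s = 1)
    (a b : ℝ≥0∞) : a ^ r * b ^ s ≤ ENNReal.ofReal r * a + ENNReal.ofReal s * b := by
  rcases eq_or_ne a ∞ with rfl | ha
  · rw [ENNReal.mul_top (by simpa using hr)]; simp
  rcases eq_or_ne b ∞ with rfl | hb
  · rw [ENNReal.mul_top (by simpa using hs)]; simp
  lift a to ℝ≥0 using ha
  lift b to ℝ≥0 using hb
  lift r to ℝ≥0 using hr.le
  lift s to ℝ≥0 using hs.le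
  have := NNReal.geom_mean_le_arith_mean2_weighted r s a b (by exact_mod_cast hrs)
  rw [ENNReal.ofReal_coe_nnreal, ENNReal.ofReal_coe_nnreal,
    ← ENNReal.coe_rpow_of_nonneg _ r.coe_nonneg, ← ENNReal.coe_rpow_of_nonneg _ s.coe_nonneg]
  exact_mod_cast this

theorem prekopaLeindler_real_of_iSup_eq_one {r s : ℝ} (hr : 0 < r) (hs : 0 < s) (hrs : r + s = 1)
    {f g h : ℝ → ℝ≥0∞} (hf : Measurable f) (hg : Measurable g) (hh : Measurable h)
    (hf1 : ⨆ x, f x = 1) (hg1 : ⨆ x, g x = 1)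
    (hfg : ∀ x y, f x ^ r * g y ^ s ≤ h (r • x + s • y)) :
    (∫⁻ x, f x) ^ r * (∫⁻ x, g x) ^ s ≤ ∫⁻ x, h x := by
  refine (ennreal_rpow_mul_rpow_le hr hs hrs _ _).trans ?_
  rw [lintegral_eq_lintegral_superlevel volume hf, lintegral_eq_lintegral_superlevel volume hg,
    lintegral_eq_lintegral_superlevel volume hh]
  have hmeas : ∀ f : ℝ → ℝ≥0∞, Measurable fun t : ℝ => volume {x | ENNReal.ofReal t < f x} := by
    intro f
    refine Antitone.measurable fun t t' htt' => measure_mono fun x hx => ?_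
    exact lt_of_le_of_lt (ENNReal.ofReal_le_ofReal htt') hx
  rw [← lintegral_const_mul _ (hmeas f), ← lintegral_const_mul _ (hmeas g),
    ← lintegral_add_left ((hmeas f).const_mul _)]
  refine lintegral_mono fun t => ?_
  by_cases ht : ENNReal.ofReal t < 1
  · obtain ⟨x, hx⟩ := lt_iSup_iff.1 (hf1 ▸ ht)
    obtain ⟨y, hy⟩ := lt_iSup_iff.1 (hg1 ▸ ht)
    refine (ofReal_mul_volume_add_le (measurableSet_lt measurable_const hf)
      (measurableSet_lt measurable_const hg) ⟨x, hx⟩ ⟨y, hy⟩ hr hs).trans (measure_mono ?_)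
    rintro _ ⟨_, ⟨a, ha, rfl⟩, _, ⟨b, hb, rfl⟩, rfl⟩
    calc ENNReal.ofReal t = ENNReal.ofReal t ^ r * ENNReal.ofReal t ^ s := by
          rw [← ENNReal.rpow_add_of_nonneg _ _ hr.le hs.le, hrs, ENNReal.rpow_one]
      _ < f a ^ r * g b ^ s :=
          ENNReal.mul_lt_mul (ENNReal.rpow_lt_rpow ha hr) (ENNReal.rpow_lt_rpow hb hs)
      _ ≤ h (r • a + s • b) := hfg a b
  · have hempty : ∀ f : ℝ → ℝ≥0∞, ⨆ x, f x = 1 → {x | ENNReal.ofReal t < f x} = ∅ := by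
      intro f hf
      ext x
      simp only [mem_ofPred_eq, mem_empty_iff_false, iff_false, not_lt]
      exact (le_iSup f x).trans (hf.le.trans (not_lt.1 ht))
    simp [hempty f hf1, hempty g hg1]

theorem prekopaLeindler_real_of_bounded {r s : ℝ} (hr : 0 < r) (hs : 0 < s) (hrs : r + s = 1)
    {f g h : ℝ → ℝ≥0∞} (hf : Measurable f) (hg : Measurable g) (hh : Measurable h)
    (hf1 : ⨆ x, f x ≠ ∞) (hg1 : ⨆ x, g x ≠ ∞)
    (hfg : ∀ x y, f x ^ r * g y ^ s ≤ h (r • x + s • y)) :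
    (∫⁻ x, f x) ^ r * (∫⁻ x, g x) ^ s ≤ ∫⁻ x, h x := by
  set a := ⨆ x, f x
  set b := ⨆ x, g x
  rcases eq_or_ne a 0 with ha0 | ha0
  · have : f = 0 := by
      ext x; exact le_antisymm ((le_iSup f x).trans ha0.le) bot_le
    simp [this, hr]
  rcases eq_or_ne b 0 with hb0 | hb0
  · have : g = 0 := by
      ext x; exact le_antisymm ((le_iSup g x).trans hb0.le) bot_le
    simp [this, hs]
  have hc0 : a⁻¹ ^ r * b⁻¹ ^ s ≠ 0 := by simp [hr.le, hs.le, hf1, hg1]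
  have hcI : a⁻¹ ^ r * b⁻¹ ^ s ≠ ∞ := by
    refine ENNReal.mul_ne_top ?_ ?_ <;> refine ENNReal.rpow_ne_top_of_nonneg ?_ ?_ <;>
      simp [hr.le, hs.le, ha0, hb0]
  have hscaled := prekopaLeindler_real_of_iSup_eq_one hr hs hrs (hf.const_mul a⁻¹)
    (hg.const_mul b⁻¹) (hh.const_mul (a⁻¹ ^ r * b⁻¹ ^ s))
    (by rw [← ENNReal.mul_iSup, ENNReal.inv_mul_cancel ha0 hf1])
    (by rw [← ENNReal.mul_iSup, ENNReal.inv_mul_cancel hb0 hg1]) (fun x y => by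
      rw [ENNReal.mul_rpow_of_nonneg _ _ hr.le, ENNReal.mul_rpow_of_nonneg _ _ hs.le,
        mul_mul_mul_comm]
      gcongr
      exact hfg x y)
  rw [lintegral_const_mul _ hf, lintegral_const_mul _ hg, lintegral_const_mul _ hh,
    ENNReal.mul_rpow_of_nonneg _ _ hr.le, ENNReal.mul_rpow_of_nonneg _ _ hs.le,
    mul_mul_mul_comm] at hscaled
  exact (ENNReal.mul_le_mul_iff_right hc0 hcI).1 hscaled

theorem tendsto_lintegral_min_natCast {α : Type*} [MeasurableSpace α] (μ : Measure α)
    {f : α → ℝ≥0∞} (hf : Measurable f) :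
    Tendsto (fun n : ℕ => ∫⁻ x, min (f x) n ∂μ) atTop (𝓝 (∫⁻ x, f x ∂μ)) := by
  refine lintegral_tendsto_of_tendsto_of_monotone (fun n => (hf.min measurable_const).aemeasurable)
    (.of_forall fun x => ?_) (.of_forall fun x => ?_)
  · intro n m hnm
    exact min_le_min le_rfl (by exact_mod_cast hnm)
  · have := (tendsto_const_nhds (x := f x)).min ENNReal.tendsto_nat_nhds_top
    simpa using this

theorem prekopaLeindler_real : PrekopaLeindler (volume : Measure ℝ) := by
  intro r s hr hs hrs f g h hf hg hh hfg
  rcases eq_or_ne (∫⁻ x, f x) 0 with hf0 | hf0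
  · simp [hf0, hr]
  rcases eq_or_ne (∫⁻ x, g x) 0 with hg0 | hg0
  · simp [hg0, hs]
  have hftrunc := ((ENNReal.continuous_rpow_const (y := r)).tendsto _).comp
    (tendsto_lintegral_min_natCast volume hf)
  have hgtrunc := ((ENNReal.continuous_rpow_const (y := s)).tendsto _).comp
    (tendsto_lintegral_min_natCast volume hg)
  have hfpos : (∫⁻ x, f x) ^ r ≠ 0 := by simp [hf0, hr.le]
  have hgpos : (∫⁻ x, g x) ^ s ≠ 0 := by simp [hg0, hs.le]
  refine le_of_tendsto (ENNReal.Tendsto.mul hftrunc (Or.inl hfpos) hgtrunc (Or.inl hgpos))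
    (.of_forall fun n => ?_)
  have hb : ∀ f : ℝ → ℝ≥0∞, ⨆ x, min (f x) n ≠ ∞ := fun f =>
    ((iSup_le fun x => min_le_right _ _).trans_lt (ENNReal.natCast_lt_top n)).ne
  refine prekopaLeindler_real_of_bounded hr hs hrs (hf.min measurable_const)
    (hg.min measurable_const) hh (hb f) (hb g) fun x y => ?_
  refine le_trans ?_ (hfg x y)
  gcongr <;> exact min_le_left _ _

theorem PrekopaLeindler.prod {E F : Type*} [MeasurableSpace E] [AddCommGroup E] [Module ℝ E]
    [MeasurableSpace F] [AddCommGroup F] [Module ℝ F] {μ : Measure E} {ν : Measure F}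
    [SFinite μ] [SFinite ν] (hμ : PrekopaLeindler μ) (hν : PrekopaLeindler ν) :
    PrekopaLeindler (μ.prod ν) := by
  intro r s hr hs hrs f g h hf hg hh hfg
  rw [lintegral_prod _ hf.aemeasurable, lintegral_prod _ hg.aemeasurable,
    lintegral_prod _ hh.aemeasurable]
  refine hμ r s hr hs hrs _ _ _ hf.lintegral_prod_right' hg.lintegral_prod_right'
    hh.lintegral_prod_right' fun x y => ?_
  exact hν r s hr hs hrs _ _ _ (hf.comp measurable_prodMk_left) (hg.comp measurable_prodMk_left)
    (hh.comp measurable_prodMk_left) fun x' y' => hfg (x, x') (y, y')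

theorem PrekopaLeindler.of_measurePreserving {E F : Type*} [MeasurableSpace E] [AddCommGroup E]
    [Module ℝ E] [MeasurableSpace F] [AddCommGroup F] [Module ℝ F] {μ : Measure E}
    {ν : Measure F} (hμ : PrekopaLeindler μ) (e : E ≃ᵐ F) (he : MeasurePreserving e μ ν)
    (hlin : ∀ (r s : ℝ) x y, e (r • x + s • y) = r • e x + s • e y) :
    PrekopaLeindler ν := by
  intro r s hr hs hrs f g h hf hg hh hfg
  rw [← he.lintegral_comp hf, ← he.lintegral_comp hg, ← he.lintegral_comp hh]
  refine hμ r s hr hs hrs _ _ _ (hf.comp e.measurable) (hg.comp e.measurable)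
    (hh.comp e.measurable) fun x y => ?_
  simpa [hlin] using hfg (e x) (e y)

theorem prekopaLeindler_fin (n : ℕ) : PrekopaLeindler (volume : Measure (Fin n → ℝ)) := by
  induction n with
  | zero =>
    intro r s _ _ _ f g h _ _ _ hfg
    rw [volume_pi, Measure.pi_of_empty (x := 0), lintegral_dirac, lintegral_dirac, lintegral_dirac]
    simpa using hfg 0 0
  | succ n ih =>
    have := (prekopaLeindler_real.prod ih)
    exact this.of_measurePreserving (MeasurableEquiv.piFinSuccAbove (fun _ => ℝ) 0).symm
      (volume_preserving_piFinSuccAbove (fun _ => ℝ) 0).symm (fun r s x y => by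
        apply (MeasurableEquiv.piFinSuccAbove (fun _ => ℝ) 0).injective
        rw [MeasurableEquiv.apply_symm_apply]
        ext i
        · simp [MeasurableEquiv.piFinSuccAbove]
        · simp [MeasurableEquiv.piFinSuccAbove, Fin.tail])

theorem prekopaLeindler_pi (κ : Type*) [Fintype κ] :
    PrekopaLeindler (volume : Measure (κ → ℝ)) :=
  (prekopaLeindler_fin (Fintype.card κ)).of_measurePreserving
    (MeasurableEquiv.piCongrLeft (fun _ => ℝ) (Fintype.equivFin κ).symm)
    (volume_measurePreserving_piCongrLeft _ _) (fun r s x y => by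
      ext i
      obtain ⟨j, rfl⟩ := (Fintype.equivFin κ).symm.surjective i
      simp [MeasurableEquiv.piCongrLeft, Equiv.piCongrLeft_apply_apply])

theorem volume_rpow_mul_volume_rpow_le {κ : Type*} [Fintype κ] {A B C : Set (κ → ℝ)}
    (hA : MeasurableSet A) (hB : MeasurableSet B) (hC : MeasurableSet C) {r s : ℝ} (hr : 0 < r)
    (hs : 0 < s) (hrs : r + s = 1) (h : r • A + s • B ⊆ C) :
    volume A ^ r * volume B ^ s ≤ volume C := by
  have := prekopaLeindler_pi κ r s hr hs hrs (A.indicator 1) (B.indicator 1) (C.indicator 1)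
    (measurable_one.indicator hA) (measurable_one.indicator hB) (measurable_one.indicator hC)
    fun x y => by
      by_cases hx : x ∈ A
      · by_cases hy : y ∈ B
        · simp [hx, hy, h (add_mem_add (smul_mem_smul_set hx) (smul_mem_smul_set hy))]
        · simp [hy, hs]
      · simp [hx, hr]
  simpa [lintegral_indicator_one, hA, hB, hC] using this

/-! ### Boxes -/

/-- The open box with centre `c` and half side lengths `r`; it is empty once some `r k ≤ 0`. -/
def box {κ : Type*} (c r : κ → ℝ) : Set (κ → ℝ) :=
  univ.pi fun k => Ioo (c k - r k) (c k + r k)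

theorem measurableSet_box {κ : Type*} [Countable κ] (c r : κ → ℝ) : MeasurableSet (box c r) :=
  .univ_pi fun _ => measurableSet_Ioo

theorem smul_add_smul_neg_inter_box_subset {κ : Type*} {K : Set (κ → ℝ)} (hconv : Convex ℝ K)
    (hsymm : ∀ x ∈ K, -x ∈ K) (c r : κ → ℝ) {s t : ℝ} (hs : 0 < s) (ht : 0 < t)
    (hst : s + t = 1) :
    s • (K ∩ box c r) + t • -(K ∩ box c r) ⊆ K ∩ box ((s - t) • c) r := by
  rintro _ ⟨_, ⟨a, ⟨haK, ha⟩, rfl⟩, _, ⟨b, ⟨hbK, hb⟩, rfl⟩, rfl⟩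
  refine ⟨hconv haK (neg_neg b ▸ hsymm _ hbK) hs.le ht.le hst, fun k _ => ?_⟩
  have hak := ha k trivial
  have hbk := hb k trivial
  simp only [Pi.neg_apply, mem_Ioo, Pi.add_apply, Pi.smul_apply, smul_eq_mul] at hak hbk ⊢
  have hr : r k = s * r k + t * r k := by rw [← add_mul, hst, one_mul]
  constructor <;> nlinarith

theorem volume_inter_box_le_volume_inter_box_smul {κ : Type*} [Fintype κ] {K : Set (κ → ℝ)}
    (hK : MeasurableSet K) (hconv : Convex ℝ K) (hsymm : ∀ x ∈ K, -x ∈ K) (c r : κ → ℝ) {q : ℝ}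
    (hq0 : 0 ≤ q) (hq1 : q ≤ 1) : volume (K ∩ box c r) ≤ volume (K ∩ box (q • c) r) := by
  rcases hq1.eq_or_lt with rfl | hq1
  · rw [one_smul]
  have hA : MeasurableSet (K ∩ box c r) := hK.inter (measurableSet_box c r)
  have hs : 0 < (1 + q) / 2 := by linarith
  have ht : 0 < (1 - q) / 2 := by linarith
  have hst : (1 + q) / 2 + (1 - q) / 2 = 1 := by ring
  have hsub := smul_add_smul_neg_inter_box_subset hconv hsymm c r hs ht hst
  rw [show (1 + q) / 2 - (1 - q) / 2 = q by ring] at hsub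
  have hBM := volume_rpow_mul_volume_rpow_le hA hA.neg (hK.inter (measurableSet_box _ r)) hs ht hst
    hsub
  rwa [Measure.measure_neg, ← ENNReal.rpow_add_of_nonneg _ _ hs.le ht.le, hst,
    ENNReal.rpow_one] at hBM

/-! ### Rearrangement inequalities on the line -/

section

theorem measure_pi_sdiff_le {κ : Type*} [Fintype κ] [DecidableEq κ] {α : κ → Type*}
    [∀ k, MeasurableSpace (α k)] (μ : ∀ k, Measure (α k)) [∀ k, SigmaFinite (μ k)]
    (A B : ∀ k, Set (α k)) :
    Measure.pi μ (univ.pi A \ univ.pi B)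
      ≤ ∑ k, μ k (A k \ B k) * ∏ j ∈ Finset.univ.erase k, μ j (A j) := by
  have hsub : univ.pi A \ univ.pi B
      ⊆ ⋃ k, univ.pi (Function.update A k (A k \ B k)) := by
    rintro x ⟨hA, hB⟩
    simp only [Set.mem_pi, mem_univ, true_imp_iff, not_forall] at hA hB
    obtain ⟨k, hk⟩ := hB
    refine mem_iUnion.2 ⟨k, fun j _ => ?_⟩
    rcases eq_or_ne j k with rfl | hj
    · simpa using ⟨hA j, hk⟩
    · simpa [hj] using hA j
  refine (measure_mono hsub).trans ((measure_iUnion_fintype_le _ _).trans ?_)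
  refine Finset.sum_le_sum fun k _ => ?_
  rw [Measure.pi_pi, ← Finset.mul_prod_erase _ _ (Finset.mem_univ k),
    Function.update_self]
  gcongr with j hj
  rw [Function.update_of_ne (Finset.ne_of_mem_erase hj)]

theorem measure_pi_sdiff_le_of_le {κ : Type*} [Fintype κ] [DecidableEq κ] {α : κ → Type*}
    [∀ k, MeasurableSpace (α k)] (μ : ∀ k, Measure (α k)) [∀ k, SigmaFinite (μ k)]
    {A B : ∀ k, Set (α k)} {M : κ → ℝ≥0∞} {ε : ℝ≥0∞} (hA : ∀ k, μ k (A k) ≤ M k)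
    (hAB : ∀ k, μ k (A k \ B k) ≤ ε) :
    Measure.pi μ (univ.pi A \ univ.pi B) ≤ (∑ k, ∏ j ∈ Finset.univ.erase k, M j) * ε := by
  refine (measure_pi_sdiff_le μ A B).trans ?_
  rw [Finset.sum_mul]
  refine Finset.sum_le_sum fun k _ => ?_
  rw [mul_comm]
  exact mul_le_mul' (Finset.prod_le_prod' fun j _ => hA j) (hAB k)

theorem measure_inter_le_add_sdiff {α : Type*} [MeasurableSpace α] (μ : Measure α) (K A B : Set α) :
    μ (K ∩ A) ≤ μ (K ∩ B) + μ (A \ B) := by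
  refine (measure_mono fun x hx => ?_).trans (measure_union_le _ _)
  by_cases hxB : x ∈ B
  exacts [Or.inl ⟨hx.1, hxB⟩, Or.inr ⟨hx.2, hxB⟩]

theorem ennreal_le_of_forall_le_add_mul {a b c : ℝ≥0∞} (hc : c ≠ ∞)
    (h : ∀ ε : ℝ≥0∞, ε ≠ 0 → ε ≤ 1 → a ≤ b + c * ε) : a ≤ b := by
  have hlim : Tendsto (fun ε : ℝ≥0∞ => b + c * ε) (𝓝[≠] 0) (𝓝 (b + c * 0)) :=
    (tendsto_const_nhds.add
      (ENNReal.Tendsto.const_mul tendsto_id (Or.inr hc))).mono_left nhdsWithin_le_nhds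
  rw [mul_zero, add_zero] at hlim
  refine ge_of_tendsto hlim ?_
  filter_upwards [self_mem_nhdsWithin, nhdsWithin_le_nhds (Iic_mem_nhds zero_lt_one)]
    with ε hε0 hε1 using h ε hε0 hε1

/-- The union of the intervals with centres `q * p.1` and radii `p.2`, for `p ∈ J`. -/
def intervals (q : ℝ) (J : Finset (ℝ × ℝ)) : Set ℝ :=
  ⋃ p ∈ J, Ioo (q * p.1 - p.2) (q * p.1 + p.2)

/-- The intervals with centres `q * p.1` and radii `p.2`, for `p ∈ J`, are nonempty and pairwise
disjoint. -/
def Separated (q : ℝ) (J : Finset (ℝ × ℝ)) : Prop :=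
  (∀ p ∈ J, 0 < p.2) ∧ ∀ p ∈ J, ∀ p' ∈ J, p ≠ p' → p.2 + p'.2 ≤ q * |p.1 - p'.1|

theorem Separated.disjoint {q : ℝ} (hq : 0 ≤ q) {J : Finset (ℝ × ℝ)} (h : Separated q J)
    {p p' : ℝ × ℝ} (hp : p ∈ J) (hp' : p' ∈ J) (hne : p ≠ p') :
    Disjoint (Ioo (q * p.1 - p.2) (q * p.1 + p.2))
      (Ioo (q * p'.1 - p'.2) (q * p'.1 + p'.2)) := by
  rw [disjoint_left]
  rintro x ⟨hlt, hgt⟩ ⟨hlt', hgt'⟩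
  have := h.2 p hp p' hp' hne
  rw [show q * |p.1 - p'.1| = |q * p.1 - q * p'.1| by
    rw [← mul_sub, abs_mul, abs_of_nonneg hq]] at this
  have : |q * p.1 - q * p'.1| < p.2 + p'.2 := by
    rw [abs_lt]; constructor <;> linarith
  linarith

theorem Separated.mono {q q' : ℝ} (hqq : q ≤ q') {J : Finset (ℝ × ℝ)} (h : Separated q J) :
    Separated q' J :=
  ⟨h.1, fun p hp p' hp' hne => (h.2 p hp p' hp' hne).trans
    (mul_le_mul_of_nonneg_right hqq (abs_nonneg _))⟩

theorem volume_intervals {J : Finset (ℝ × ℝ)} (h : Separated 1 J) :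
    volume (intervals 1 J) = ENNReal.ofReal (2 * ∑ p ∈ J, p.2) := by
  rw [intervals, measure_biUnion_finset (fun p hp p' hp' hne => h.disjoint zero_le_one hp hp' hne)
    (fun _ _ => measurableSet_Ioo), Finset.mul_sum, ENNReal.ofReal_sum_of_nonneg
    (fun p hp => by linarith [h.1 p hp])]
  refine Finset.sum_congr rfl fun p _ => ?_
  rw [Real.volume_Ioo]; congr 1; ring

/-- The intervals of `J` with their centres multiplied by `q` and their radii unchanged. -/
def scaleCenters (q : ℝ) (J : Finset (ℝ × ℝ)) : Finset (ℝ × ℝ) :=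
  J.image fun p => (q * p.1, p.2)

theorem injective_scaleCenter {q : ℝ} (hq : q ≠ 0) :
    Function.Injective fun p : ℝ × ℝ => (q * p.1, p.2) := fun a b hab => by
  rw [Prod.mk.injEq] at hab
  exact Prod.ext (mul_left_cancel₀ hq hab.1) hab.2

theorem sum_snd_scaleCenters {q : ℝ} (hq : q ≠ 0) (J : Finset (ℝ × ℝ)) :
    ∑ p ∈ scaleCenters q J, p.2 = ∑ p ∈ J, p.2 :=
  Finset.sum_image (injective_scaleCenter hq).injOn

theorem intervals_scaleCenters (q : ℝ) (J : Finset (ℝ × ℝ)) :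
    intervals 1 (scaleCenters q J) = intervals q J := by
  simp only [intervals, scaleCenters, Finset.set_biUnion_finset_image, one_mul]

theorem Separated.scaleCenters {q : ℝ} (hq : 0 ≤ q) {J : Finset (ℝ × ℝ)} (h : Separated q J) :
    Separated 1 (scaleCenters q J) := by
  simp only [Separated, Petty.scaleCenters, Finset.forall_mem_image]
  refine ⟨h.1, fun p hp p' hp' hne => ?_⟩
  have := h.2 p hp p' hp' fun hpp => hne (by rw [hpp])
  rwa [← mul_sub, abs_mul, abs_of_nonneg hq, one_mul]

/-- The intervals of `J` with `p` and `p'` replaced by the interval obtained by gluing `p'` to the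
right of `p`, when the two touch. -/
def mergeIntervals (J : Finset (ℝ × ℝ)) (p p' : ℝ × ℝ) : Finset (ℝ × ℝ) :=
  insert (p.1 + p'.2, p.2 + p'.2) ((J.erase p).erase p')

section Merge

variable {J : Finset (ℝ × ℝ)} {p p' : ℝ × ℝ}

theorem Separated.le_abs_merge (h : Separated 1 J) (hp : p ∈ J) (hp' : p' ∈ J)
    (htouch : p.2 + p'.2 = p'.1 - p.1) {x : ℝ × ℝ} (hx : x ∈ (J.erase p).erase p') :
    p.2 + p'.2 + x.2 ≤ |p.1 + p'.2 - x.1| := by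
  simp only [Finset.mem_erase] at hx
  obtain ⟨hxp', hxp, hx⟩ := hx
  have hdist := h.2 x hx p hp hxp
  have hdist' := h.2 x hx p' hp' hxp'
  have := h.1 x hx
  have := h.1 p hp
  have := h.1 p' hp'
  rw [one_mul, le_abs] at hdist hdist'
  rw [le_abs]
  rcases hdist with hdist | hdist
  · rcases hdist' with hdist' | hdist'
    · right; linarith
    · linarith
  · left; linarith

theorem Separated.notMem_erase_erase (h : Separated 1 J) (hp : p ∈ J) (hp' : p' ∈ J)
    (htouch : p.2 + p'.2 = p'.1 - p.1) :
    (p.1 + p'.2, p.2 + p'.2) ∉ (J.erase p).erase p' := fun hmem => by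
  have := h.le_abs_merge hp hp' htouch hmem
  rw [sub_self, abs_zero] at this
  linarith [h.1 p hp, h.1 p' hp']

theorem Separated.merge (h : Separated 1 J) (hp : p ∈ J) (hp' : p' ∈ J)
    (htouch : p.2 + p'.2 = p'.1 - p.1) : Separated 1 (mergeIntervals J p p') := by
  have hmem : ∀ x ∈ (J.erase p).erase p', x ∈ J := fun x hx =>
    Finset.mem_of_mem_erase (Finset.mem_of_mem_erase hx)
  simp only [Separated, mergeIntervals, Finset.forall_mem_insert, one_mul]
  refine ⟨⟨add_pos (h.1 p hp) (h.1 p' hp'), fun x hx => h.1 x (hmem x hx)⟩,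
    ⟨fun hne => absurd rfl hne, fun x hx _ => h.le_abs_merge hp hp' htouch hx⟩,
    fun x hx => ⟨fun _ => ?_, fun y hy hxy => ?_⟩⟩
  · rw [add_comm, abs_sub_comm]
    exact h.le_abs_merge hp hp' htouch hx
  · simpa only [one_mul] using h.2 x (hmem x hx) y (hmem y hy) hxy

theorem card_mergeIntervals_lt (hp : p ∈ J) (hp' : p' ∈ J) (hne : p ≠ p') :
    (mergeIntervals J p p').card < J.card := by
  have hcard := Finset.card_insert_le (p.1 + p'.2, p.2 + p'.2) ((J.erase p).erase p')
  rw [Finset.card_erase_of_mem (Finset.mem_erase.2 ⟨hne.symm, hp'⟩),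
    Finset.card_erase_of_mem hp] at hcard
  have : 1 < J.card := Finset.one_lt_card.2 ⟨p, hp, p', hp', hne⟩
  rw [mergeIntervals]
  omega

theorem Separated.sum_snd_mergeIntervals (h : Separated 1 J) (hp : p ∈ J) (hp' : p' ∈ J)
    (hne : p ≠ p') (htouch : p.2 + p'.2 = p'.1 - p.1) :
    ∑ x ∈ mergeIntervals J p p', x.2 = ∑ x ∈ J, x.2 := by
  rw [mergeIntervals, Finset.sum_insert (h.notMem_erase_erase hp hp' htouch), add_assoc,
    Finset.add_sum_erase _ _ (Finset.mem_erase.2 ⟨hne.symm, hp'⟩), Finset.add_sum_erase _ _ hp]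

theorem Separated.intervals_subset_mergeIntervals (h : Separated 1 J) (hp : p ∈ J) (hp' : p' ∈ J)
    (htouch : p.2 + p'.2 = p'.1 - p.1) : intervals 1 J ⊆ intervals 1 (mergeIntervals J p p') := by
  intro y hy
  simp only [intervals, mergeIntervals, mem_iUnion, one_mul, exists_prop, mem_Ioo,
    Finset.exists_mem_insert] at hy ⊢
  obtain ⟨x, hx, hxy⟩ := hy
  have := h.1 p hp
  have := h.1 p' hp'
  by_cases hxp : x = p
  · subst hxp
    left; constructor <;> linarith [hxy.1, hxy.2]
  by_cases hxp' : x = p'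
  · subst hxp'
    left; constructor <;> linarith [hxy.1, hxy.2]
  exact Or.inr ⟨x, by simp [hxp, hxp', hx], hxy⟩

theorem Separated.exists_merge {q : ℝ} (hq : 0 < q) (h : Separated q J) (hp : p ∈ J)
    (hp' : p' ∈ J) (hne : p ≠ p') (htouch : p.2 + p'.2 = q * |p.1 - p'.1|) :
    ∃ J', Separated 1 J' ∧ J'.card < J.card ∧ intervals q J ⊆ intervals 1 J' ∧
      ∑ x ∈ J', x.2 = ∑ x ∈ J, x.2 := by
  wlog hlt : p.1 ≤ p'.1 generalizing p p'
  · exact this hp' hp hne.symm (by rw [add_comm, abs_sub_comm, htouch]) (le_of_not_ge hlt)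
  have hs := h.scaleCenters hq.le
  have hinj := injective_scaleCenter hq.ne'
  have hm := Finset.mem_image_of_mem (fun p : ℝ × ℝ => (q * p.1, p.2)) hp
  have hm' := Finset.mem_image_of_mem (fun p : ℝ × ℝ => (q * p.1, p.2)) hp'
  have ht : p.2 + p'.2 = q * p'.1 - q * p.1 := by
    rw [htouch, abs_of_nonpos (by linarith)]; ring
  refine ⟨_, hs.merge hm hm' ht, ?_, ?_, ?_⟩
  · exact (card_mergeIntervals_lt hm hm' (hinj.ne hne)).trans_le Finset.card_image_le
  · exact (intervals_scaleCenters q J).symm.subset.trans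
      (hs.intervals_subset_mergeIntervals hm hm' ht)
  · rw [hs.sum_snd_mergeIntervals hm hm' (hinj.ne hne) ht, sum_snd_scaleCenters hq.ne']

end Merge

theorem exists_separated_touching {κ : Type*} [Finite κ] {J : κ → Finset (ℝ × ℝ)}
    (hJ : ∀ k, Separated 1 (J k)) (hne : ∃ k, (J k : Set (ℝ × ℝ)).Nontrivial) :
    ∃ q, 0 < q ∧ q ≤ 1 ∧ (∀ k, Separated q (J k)) ∧
      ∃ k, ∃ p ∈ J k, ∃ p' ∈ J k, p ≠ p' ∧ p.2 + p'.2 = q * |p.1 - p'.1| := by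
  cases nonempty_fintype κ
  classical
  have hdist : ∀ k, ∀ p ∈ J k, ∀ p' ∈ J k, p ≠ p' → 0 < |p.1 - p'.1| := by
    intro k p hp p' hp' hpp
    linarith [(hJ k).2 p hp p' hp' hpp, (hJ k).1 p hp, (hJ k).1 p' hp']
  obtain ⟨k₀, a, ha, b, hb, hab⟩ := hne
  obtain ⟨⟨k, p, p'⟩, hmem, hmax⟩ :=
    (Finset.univ.sigma fun k => (J k).offDiag).exists_max_image
      (fun s => (s.2.1.2 + s.2.2.2) / |s.2.1.1 - s.2.2.1|)
      ⟨⟨k₀, a, b⟩, by simpa using ⟨ha, hb, hab⟩⟩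
  simp only [Finset.mem_sigma, Finset.mem_univ, true_and, Finset.mem_offDiag] at hmem hmax
  obtain ⟨hp, hp', hpp⟩ := hmem
  have hd := hdist k p hp p' hp' hpp
  refine ⟨(p.2 + p'.2) / |p.1 - p'.1|, div_pos (add_pos ((hJ k).1 p hp) ((hJ k).1 p' hp')) hd, ?_,
    fun j => ⟨(hJ j).1, fun x hx y hy hxy => ?_⟩, k, p, hp, p', hp', hpp,
    (div_mul_cancel₀ _ hd.ne').symm⟩
  · rw [div_le_one hd, ← one_mul |_|]
    exact (hJ k).2 p hp p' hp' hpp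
  · exact (div_le_iff₀ (hdist j x hx y hy hxy)).1 (hmax ⟨j, x, y⟩ ⟨hx, hy, hxy⟩)

variable {κ : Type*} [Fintype κ]

theorem volume_inter_pi_intervals [DecidableEq κ] {K : Set (κ → ℝ)} (hK : MeasurableSet K) {q : ℝ}
    (hq : 0 ≤ q) (J : κ → Finset (ℝ × ℝ)) (hJ : ∀ k, Separated q (J k)) :
    volume (K ∩ univ.pi fun k => intervals q (J k))
      = ∑ p ∈ Fintype.piFinset J,
        volume (K ∩ box (q • fun k => (p k).1) (fun k => (p k).2)) := by
  rw [← measure_biUnion_finset]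
  · congr 1
    ext x
    simp only [mem_inter_iff, Set.mem_pi, mem_univ, true_imp_iff, intervals, mem_iUnion,
      Fintype.mem_piFinset, box, exists_prop, Pi.smul_apply, smul_eq_mul]
    constructor
    · rintro ⟨hx, h⟩
      choose p hp using h
      exact ⟨p, fun k => (hp k).1, hx, fun k => (hp k).2⟩
    · rintro ⟨p, hp, hx, h⟩
      exact ⟨hx, fun k => ⟨p k, hp k, h k⟩⟩
  · intro p hp p' hp' hne
    obtain ⟨k, hk⟩ := Function.ne_iff.1 hne
    rw [Finset.mem_coe, Fintype.mem_piFinset] at hp hp'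
    refine disjoint_left.2 fun x hx hx' => ?_
    exact disjoint_left.1 ((hJ k).disjoint hq (hp k) (hp' k) hk) (hx.2 k trivial)
      (hx'.2 k trivial)
  · intro p _
    exact hK.inter (measurableSet_box _ _)

theorem volume_inter_pi_intervals_one_le {K : Set (κ → ℝ)} (hK : MeasurableSet K)
    (hconv : Convex ℝ K) (hsymm : ∀ x ∈ K, -x ∈ K) {q : ℝ} (hq0 : 0 ≤ q) (hq1 : q ≤ 1)
    (J : κ → Finset (ℝ × ℝ)) (hJ : ∀ k, Separated q (J k)) :
    volume (K ∩ univ.pi fun k => intervals 1 (J k))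
      ≤ volume (K ∩ univ.pi fun k => intervals q (J k)) := by
  classical
  rw [volume_inter_pi_intervals hK zero_le_one J fun k => (hJ k).mono hq1,
    volume_inter_pi_intervals hK hq0 J hJ]
  refine Finset.sum_le_sum fun p _ => ?_
  rw [one_smul]
  exact volume_inter_box_le_volume_inter_box_smul hK hconv hsymm _ _ hq0 hq1

theorem exists_separated_sum_card_lt {J : κ → Finset (ℝ × ℝ)} (hJ : ∀ k, Separated 1 (J k))
    (hne : ∃ k, (J k : Set (ℝ × ℝ)).Nontrivial) :
    ∃ q, 0 ≤ q ∧ q ≤ 1 ∧ (∀ k, Separated q (J k)) ∧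
      ∃ J' : κ → Finset (ℝ × ℝ), (∀ k, Separated 1 (J' k)) ∧
        ∑ k, (J' k).card < ∑ k, (J k).card ∧ (∀ k, intervals q (J k) ⊆ intervals 1 (J' k)) ∧
        ∀ k, ∑ p ∈ J' k, p.2 = ∑ p ∈ J k, p.2 := by
  classical
  obtain ⟨q, hq0, hq1, hsep, k, p, hp, p', hp', hpp, htouch⟩ := exists_separated_touching hJ hne
  obtain ⟨M, hM, hcard, hsub, hsum⟩ := (hsep k).exists_merge hq0 hp hp' hpp htouch
  refine ⟨q, hq0.le, hq1, hsep, Function.update (fun j => scaleCenters q (J j)) k M, ?_, ?_, ?_, ?_⟩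
  · rw [Function.forall_update_iff _ fun _ S => Separated 1 S]
    exact ⟨hM, fun j _ => (hsep j).scaleCenters hq0.le⟩
  · refine Finset.sum_lt_sum (fun j _ => ?_) ⟨k, Finset.mem_univ k, by simpa using hcard⟩
    rcases eq_or_ne j k with rfl | hj
    · simpa using hcard.le
    · rw [Function.update_of_ne hj]
      exact Finset.card_image_le
  · rw [Function.forall_update_iff _ fun j S => intervals q (J j) ⊆ intervals 1 S]
    exact ⟨hsub, fun j _ => (intervals_scaleCenters q (J j)).ge⟩
  · rw [Function.forall_update_iff _ fun j (S : Finset (ℝ × ℝ)) => ∑ p ∈ S, p.2 = ∑ p ∈ J j, p.2]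
    exact ⟨hsum, fun j _ => sum_snd_scaleCenters hq0.ne' (J j)⟩

theorem volume_inter_pi_intervals_le_of_subsingleton {K : Set (κ → ℝ)} (hK : MeasurableSet K)
    (hconv : Convex ℝ K) (hsymm : ∀ x ∈ K, -x ∈ K) (J : κ → Finset (ℝ × ℝ))
    (hJ : ∀ k, (J k : Set (ℝ × ℝ)).Subsingleton) :
    volume (K ∩ univ.pi fun k => intervals 1 (J k))
      ≤ volume (K ∩ univ.pi fun k => Ioo (-∑ p ∈ J k, p.2) (∑ p ∈ J k, p.2)) := by
  by_cases hempty : ∃ k, J k = ∅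
  · obtain ⟨k, hk⟩ := hempty
    rw [univ_pi_eq_empty (i := k) (by simp [intervals, hk]), inter_empty, measure_empty]
    exact zero_le
  · push Not at hempty
    have hsing : ∀ k, ∃ p, J k = {p} := fun k =>
      (hempty k).imp fun p hp => Finset.eq_singleton_iff_unique_mem.2 ⟨hp, fun _ h => hJ k h hp⟩
    choose p hp using hsing
    simpa [hp, intervals, box] using volume_inter_box_le_volume_inter_box_smul hK hconv hsymm
      (fun k => (p k).1) (fun k => (p k).2) le_rfl zero_le_one

/-- Slide all the intervals towards the origin until two of them touch, merge these two, and repeat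
until every `J k` consists of a single interval, which is then moved to the origin. -/
theorem volume_inter_pi_intervals_le_symmetric {K : Set (κ → ℝ)} (hK : MeasurableSet K)
    (hconv : Convex ℝ K) (hsymm : ∀ x ∈ K, -x ∈ K) (J : κ → Finset (ℝ × ℝ))
    (hJ : ∀ k, Separated 1 (J k)) :
    volume (K ∩ univ.pi fun k => intervals 1 (J k))
      ≤ volume (K ∩ univ.pi fun k => Ioo (-∑ p ∈ J k, p.2) (∑ p ∈ J k, p.2)) := by
  induction hN : ∑ k, (J k).card using Nat.strong_induction_on generalizing J with
  | _ N ih =>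
  subst hN
  by_cases hne : ∃ k, (J k : Set (ℝ × ℝ)).Nontrivial
  · obtain ⟨q, hq0, hq1, hsep, J', hJ', hcard, hsub, hsum⟩ := exists_separated_sum_card_lt hJ hne
    calc volume (K ∩ univ.pi fun k => intervals 1 (J k))
        ≤ volume (K ∩ univ.pi fun k => intervals q (J k)) :=
          volume_inter_pi_intervals_one_le hK hconv hsymm hq0 hq1 J hsep
      _ ≤ volume (K ∩ univ.pi fun k => intervals 1 (J' k)) :=
          measure_mono (inter_subset_inter_right _ (pi_mono fun k _ => hsub k))
      _ ≤ _ := by simpa only [hsum] using ih _ hcard J' hJ' rfl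
  · push Not at hne
    exact volume_inter_pi_intervals_le_of_subsingleton hK hconv hsymm J hne

/-- The interval with left endpoint `j * δ` and length `δ`, as a pair of centre and radius. -/
def gridInterval (δ : ℝ) (j : ℤ) : ℝ × ℝ :=
  ((j + 1 / 2) * δ, δ / 2)

theorem intervals_image_gridInterval (δ : ℝ) (S : Finset ℤ) :
    intervals 1 (S.image (gridInterval δ)) = ⋃ j ∈ S, Ioo (j * δ) ((j + 1) * δ) := by
  rw [intervals, Finset.set_biUnion_finset_image]
  refine iUnion₂_congr fun j _ => ?_
  rw [gridInterval]
  congr 1 <;> ring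

theorem separated_image_gridInterval {δ : ℝ} (hδ : 0 < δ) (S : Finset ℤ) :
    Separated 1 (S.image (gridInterval δ)) := by
  simp only [Separated, Finset.forall_mem_image, gridInterval]
  refine ⟨fun _ _ => half_pos hδ, fun i _ j _ hne => ?_⟩
  have hij : (1 : ℝ) ≤ |(i : ℝ) - j| := by
    exact_mod_cast Int.one_le_abs (sub_ne_zero.2 fun h => hne (by rw [h]))
  rw [← sub_mul, abs_mul, abs_of_pos hδ, add_sub_add_right_eq_sub]
  nlinarith

theorem finite_image_floor_div {K : Set ℝ} (hK : Bornology.IsBounded K) {δ : ℝ} (hδ : 0 ≤ δ) :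
    ((fun x => ⌊x / δ⌋) '' K).Finite := by
  obtain ⟨R, hR⟩ := hK.subset_closedBall 0
  refine (finite_Icc ⌊-R / δ⌋ ⌊R / δ⌋).subset (image_subset_iff.2 fun x hx => ?_)
  have hx := hR hx
  rw [mem_closedBall_zero_iff, Real.norm_eq_abs, abs_le] at hx
  exact ⟨Int.floor_mono (by gcongr; exact hx.1), Int.floor_mono (by gcongr; exact hx.2)⟩

theorem floor_div_mul_le {δ : ℝ} (hδ : 0 < δ) (x : ℝ) : ⌊x / δ⌋ * δ ≤ x :=
  (le_div_iff₀ hδ).1 (Int.floor_le _)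

theorem lt_floor_div_add_one_mul {δ : ℝ} (hδ : 0 < δ) (x : ℝ) : x < (⌊x / δ⌋ + 1) * δ :=
  (div_lt_iff₀ hδ).1 (Int.lt_floor_add_one _)

/-- The intervals are the cells of a fine grid which meet a large compact subset of `E`. -/
theorem exists_intervals_approx {E : Set ℝ} (hE : MeasurableSet E) (hfin : volume E ≠ ∞)
    {ε : ℝ≥0∞} (hε : ε ≠ 0) :
    ∃ J, Separated 1 J ∧ volume (E \ intervals 1 J) ≤ ε ∧
      volume (intervals 1 J) ≤ volume E + ε := by
  classical
  obtain ⟨K, hKE, hK, hEK⟩ := hE.exists_isCompact_sdiff_lt hfin hε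
  obtain ⟨O, hKO, hO, hOv⟩ := K.exists_isOpen_lt_add (μ := volume) hK.measure_ne_top hε
  obtain ⟨δ, hδ, hδO⟩ := hK.exists_thickening_subset_open hO hKO
  have hS := finite_image_floor_div hK.isBounded hδ.le
  have hcells : E \ intervals 1 (hS.toFinset.image (gridInterval δ))
      ⊆ (E \ K) ∪ range fun j : ℤ => (j * δ : ℝ) := by
    rintro x ⟨hxE, hx⟩
    rw [intervals_image_gridInterval] at hx
    refine or_iff_not_imp_left.2 fun hxK => ⟨⌊x / δ⌋, ?_⟩
    have hxK : x ∈ K := not_not.1 fun h => hxK ⟨hxE, h⟩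
    by_contra hne
    exact hx (mem_iUnion₂.2 ⟨⌊x / δ⌋, hS.mem_toFinset.2 (mem_image_of_mem _ hxK),
      (floor_div_mul_le hδ x).lt_of_ne hne, lt_floor_div_add_one_mul hδ x⟩)
  have hthick : intervals 1 (hS.toFinset.image (gridInterval δ)) ⊆ O := by
    rw [intervals_image_gridInterval]
    refine iUnion₂_subset fun j hj y hy => hδO ?_
    obtain ⟨x, hxK, rfl⟩ := hS.mem_toFinset.1 hj
    refine Metric.mem_thickening_iff.2 ⟨x, hxK, ?_⟩
    have := floor_div_mul_le hδ x
    have := lt_floor_div_add_one_mul hδ x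
    rw [Real.dist_eq, abs_lt]
    constructor <;> linarith [hy.1, hy.2]
  refine ⟨_, separated_image_gridInterval hδ hS.toFinset, ?_, ?_⟩
  · refine (measure_mono hcells).trans ((measure_union_le _ _).trans ?_)
    rw [(countable_range _).measure_zero, add_zero]
    exact hEK.le
  · calc volume (intervals 1 (hS.toFinset.image (gridInterval δ))) ≤ volume O := measure_mono hthick
      _ ≤ volume K + ε := hOv.le
      _ ≤ volume E + ε := by gcongr

theorem volume_Ioo_neg_self (r : ℝ) : volume (Ioo (-r) r) = ENNReal.ofReal (2 * r) := by
  rw [Real.volume_Ioo, sub_neg_eq_add, two_mul]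

theorem volume_Ioo_neg_self_sdiff_le (r s : ℝ) :
    volume (Ioo (-r) r \ Ioo (-s) s) ≤ ENNReal.ofReal (2 * r) - ENNReal.ofReal (2 * s) := by
  rcases le_total r s with h | h
  · rw [sdiff_eq_empty.2 (Set.Ioo_subset_Ioo (neg_le_neg h) h), measure_empty]
    exact zero_le
  · rw [measure_sdiff (Set.Ioo_subset_Ioo (neg_le_neg h) h) measurableSet_Ioo.nullMeasurableSet
      (by simp), volume_Ioo_neg_self, volume_Ioo_neg_self]

theorem volume_inter_pi_le_symmetric_add {K : Set (κ → ℝ)} (hK : MeasurableSet K)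
    (hconv : Convex ℝ K) (hsymm : ∀ x ∈ K, -x ∈ K) {E : κ → Set ℝ}
    (hE : ∀ k, MeasurableSet (E k)) (hfin : ∀ k, volume (E k) ≠ ∞) {ε : ℝ≥0∞} (hε : ε ≠ 0)
    {M : ℝ≥0∞} (hM : ∀ k, volume (E k) + ε ≤ M) [DecidableEq κ] :
    volume (K ∩ univ.pi E)
      ≤ volume (K ∩ univ.pi fun k => Ioo (-(volume.real (E k) / 2)) (volume.real (E k) / 2))
        + 2 * (∑ k : κ, ∏ _j ∈ Finset.univ.erase k, M) * ε := by
  choose J hsep hdiff hle using fun k => exists_intervals_approx (hE k) (hfin k) hε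
  have hvol : ∀ k, ENNReal.ofReal (2 * ∑ p ∈ J k, p.2) ≤ volume (E k) + ε := fun k =>
    (volume_intervals (hsep k)).symm.trans_le (hle k)
  rw [two_mul, add_mul, ← add_assoc]
  calc volume (K ∩ univ.pi E)
      ≤ volume (K ∩ univ.pi fun k => intervals 1 (J k))
          + (∑ k : κ, ∏ _j ∈ Finset.univ.erase k, M) * ε :=
        (measure_inter_le_add_sdiff _ _ _ _).trans
          (by gcongr; exact measure_pi_sdiff_le_of_le _ (fun k => le_self_add.trans (hM k)) hdiff)
    _ ≤ volume (K ∩ univ.pi fun k => Ioo (-∑ p ∈ J k, p.2) (∑ p ∈ J k, p.2))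
          + (∑ k : κ, ∏ _j ∈ Finset.univ.erase k, M) * ε := by
        gcongr ?_ + _
        exact volume_inter_pi_intervals_le_symmetric hK hconv hsymm J hsep
    _ ≤ _ := by
        gcongr ?_ + _
        refine (measure_inter_le_add_sdiff _ _ _
          (univ.pi fun k => Ioo (-(volume.real (E k) / 2)) (volume.real (E k) / 2))).trans ?_
        gcongr
        refine measure_pi_sdiff_le_of_le _ (fun k => ?_) fun k => ?_
        · rw [volume_Ioo_neg_self]
          exact (hvol k).trans (hM k)
        · refine (volume_Ioo_neg_self_sdiff_le _ _).trans (tsub_le_iff_left.2 ?_)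
          rw [mul_div_cancel₀ _ two_ne_zero, measureReal_def, ENNReal.ofReal_toReal (hfin k)]
          exact hvol k

/-- The Rogers–Brascamp–Lieb–Luttinger inequality on the line, for a symmetric convex set. -/
theorem volume_inter_pi_le_symmetric {K : Set (κ → ℝ)} (hK : MeasurableSet K)
    (hconv : Convex ℝ K) (hsymm : ∀ x ∈ K, -x ∈ K) (E : κ → Set ℝ)
    (hE : ∀ k, MeasurableSet (E k)) (hfin : ∀ k, volume (E k) ≠ ∞) :
    volume (K ∩ univ.pi E)
      ≤ volume (K ∩ univ.pi fun k =>
          Ioo (-(volume.real (E k) / 2)) (volume.real (E k) / 2)) := by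
  classical
  set M : ℝ≥0∞ := ∑ k, volume (E k) + 1
  have hM : ∀ k, volume (E k) + 1 ≤ M := fun k =>
    add_le_add_left (Finset.single_le_sum (f := fun k => volume (E k)) (fun _ _ => zero_le)
      (Finset.mem_univ k)) 1
  have hMfin : M ≠ ∞ := by simp [M, ENNReal.sum_eq_top, hfin]
  have hc : 2 * ∑ k : κ, ∏ _j ∈ Finset.univ.erase k, M ≠ ∞ :=
    ENNReal.mul_ne_top ENNReal.ofNat_ne_top
      (ENNReal.sum_ne_top.2 fun _ _ => ENNReal.prod_ne_top fun _ _ => hMfin)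
  exact ennreal_le_of_forall_le_add_mul hc fun ε hε0 hε1 =>
    volume_inter_pi_le_symmetric_add hK hconv hsymm hE hfin hε0
      fun k => (by gcongr : volume (E k) + ε ≤ volume (E k) + 1).trans (hM k)

end

/-! ### Steiner symmetrization -/

section

/-- Splitting off the first coordinate of `ℝ^{d+1}`. -/
def splitFirst (d : ℕ) : EuclideanSpace ℝ (Fin (d + 1)) ≃ᵐ ℝ × (Fin d → ℝ) :=
  (MeasurableEquiv.toLp 2 (Fin (d + 1) → ℝ)).symm.trans
    (MeasurableEquiv.piFinSuccAbove (fun _ => ℝ) 0)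

variable {d : ℕ}

theorem splitFirst_apply (x : EuclideanSpace ℝ (Fin (d + 1))) :
    splitFirst d x = (x 0, fun i => x i.succ) := by
  ext i
  · simp [splitFirst, MeasurableEquiv.piFinSuccAbove]
  · simp [splitFirst, MeasurableEquiv.piFinSuccAbove, Fin.tail]

theorem splitFirst_symm_zero (t : ℝ) (y : Fin d → ℝ) : (splitFirst d).symm (t, y) 0 = t := by
  have := splitFirst_apply ((splitFirst d).symm (t, y))
  rw [MeasurableEquiv.apply_symm_apply] at this
  exact (congrArg Prod.fst this).symm

theorem splitFirst_symm_succ (t : ℝ) (y : Fin d → ℝ) (i : Fin d) :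
    (splitFirst d).symm (t, y) i.succ = y i := by
  have := splitFirst_apply ((splitFirst d).symm (t, y))
  rw [MeasurableEquiv.apply_symm_apply] at this
  exact (congrFun (congrArg Prod.snd this) i).symm

theorem measurePreserving_splitFirst (d : ℕ) : MeasurePreserving (splitFirst d) :=
  (volume_preserving_piFinSuccAbove (fun _ => ℝ) 0).comp
    (EuclideanSpace.volume_preserving_symm_measurableEquiv_toLp _)

theorem splitFirst_symm_add (s t : ℝ) (y : Fin d → ℝ) :
    (splitFirst d).symm (s + t, y)
      = (splitFirst d).symm (s, y) + t • EuclideanSpace.single 0 1 := by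
  ext i
  refine Fin.cases ?_ (fun i => ?_) i
  · simp [splitFirst_symm_zero]
  · simp [splitFirst_symm_succ]

theorem norm_splitFirst_symm_sq (s : ℝ) (y : Fin d → ℝ) :
    ‖(splitFirst d).symm (s, y)‖ ^ 2 = s ^ 2 + ∑ i, y i ^ 2 := by
  rw [EuclideanSpace.norm_sq_eq, Fin.sum_univ_succ]
  simp [splitFirst_symm_zero, splitFirst_symm_succ]

/-- The section of `A` by the line in the direction of the first axis over `y`. -/
def lineSection (A : Set (EuclideanSpace ℝ (Fin (d + 1)))) (y : Fin d → ℝ) : Set ℝ :=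
  {s | (splitFirst d).symm (s, y) ∈ A}

theorem measurableSet_lineSection {A : Set (EuclideanSpace ℝ (Fin (d + 1)))}
    (hA : MeasurableSet A) (y : Fin d → ℝ) : MeasurableSet (lineSection A y) :=
  ((splitFirst d).symm.measurable.comp measurable_prodMk_right) hA

theorem measurable_volume_lineSection {A : Set (EuclideanSpace ℝ (Fin (d + 1)))}
    (hA : MeasurableSet A) : Measurable fun y => volume (lineSection A y) :=
  measurable_measure_prodMk_right ((splitFirst d).symm.measurable hA)

theorem volume_eq_lintegral_lineSection {A : Set (EuclideanSpace ℝ (Fin (d + 1)))}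
    (hA : MeasurableSet A) : volume A = ∫⁻ y, volume (lineSection A y) := by
  rw [← (measurePreserving_splitFirst d).symm.measure_preimage_equiv, Measure.volume_eq_prod,
    Measure.prod_apply_symm ((splitFirst d).symm.measurable hA)]
  rfl

theorem lineSection_ball {r : ℝ} (hr : 0 ≤ r) (y : Fin d → ℝ) :
    lineSection (Metric.ball (0 : EuclideanSpace ℝ (Fin (d + 1))) r) y
      = Ioo (-√(r ^ 2 - ∑ i, y i ^ 2)) (√(r ^ 2 - ∑ i, y i ^ 2)) := by
  ext s
  rw [lineSection, mem_ofPred_eq, mem_ball_zero_iff, ← abs_of_nonneg (norm_nonneg _),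
    ← abs_of_nonneg hr, ← sq_lt_sq, norm_splitFirst_symm_sq, abs_of_nonneg hr, mem_Ioo, ← abs_lt,
    Real.lt_sqrt (abs_nonneg s), sq_abs, lt_sub_iff_add_lt]

/-- The Steiner symmetral of `A` in the direction of the first axis. -/
def steiner (A : Set (EuclideanSpace ℝ (Fin (d + 1)))) : Set (EuclideanSpace ℝ (Fin (d + 1))) :=
  splitFirst d ⁻¹' {p | p.1 ∈ Ioo (-(volume.real (lineSection A p.2) / 2))
    (volume.real (lineSection A p.2) / 2)}

theorem lineSection_steiner (A : Set (EuclideanSpace ℝ (Fin (d + 1)))) (y : Fin d → ℝ) :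
    lineSection (steiner A) y = Ioo (-(volume.real (lineSection A y) / 2))
      (volume.real (lineSection A y) / 2) := by
  ext s
  simp [lineSection, steiner]

theorem measurableSet_steiner {A : Set (EuclideanSpace ℝ (Fin (d + 1)))} (hA : MeasurableSet A) :
    MeasurableSet (steiner A) := by
  have hlen : Measurable fun y => volume.real (lineSection A y) :=
    (measurable_volume_lineSection hA).ennreal_toReal
  refine (splitFirst d).measurable ?_
  have hlen' : Measurable fun p : ℝ × (Fin d → ℝ) => volume.real (lineSection A p.2) :=
    hlen.comp measurable_snd
  exact (measurableSet_lt ((hlen'.div_const 2).neg) measurable_fst).inter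
    (measurableSet_lt measurable_fst (hlen'.div_const 2))

theorem volume_lineSection_ne_top {A : Set (EuclideanSpace ℝ (Fin (d + 1)))} {R : ℝ} (hR : 0 ≤ R)
    (hA : A ⊆ Metric.ball 0 R) (y : Fin d → ℝ) : volume (lineSection A y) ≠ ∞ := by
  have : lineSection A y ⊆ lineSection (Metric.ball 0 R) y := fun s hs => hA hs
  refine ((measure_mono this).trans_lt ?_).ne
  rw [lineSection_ball hR]
  simp

theorem volume_lineSection_steiner {A : Set (EuclideanSpace ℝ (Fin (d + 1)))} {y : Fin d → ℝ}
    (h : volume (lineSection A y) ≠ ∞) :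
    volume (lineSection (steiner A) y) = volume (lineSection A y) := by
  rw [lineSection_steiner, Real.volume_Ioo, sub_neg_eq_add, add_halves, Measure.real,
    ENNReal.ofReal_toReal h]

theorem volume_steiner {A : Set (EuclideanSpace ℝ (Fin (d + 1)))} (hA : MeasurableSet A)
    {R : ℝ} (hR : 0 ≤ R) (hAR : A ⊆ Metric.ball 0 R) : volume (steiner A) = volume A := by
  rw [volume_eq_lintegral_lineSection hA,
    volume_eq_lintegral_lineSection (measurableSet_steiner hA)]
  exact lintegral_congr fun y => volume_lineSection_steiner (volume_lineSection_ne_top hR hAR y)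

theorem steiner_subset_ball {A : Set (EuclideanSpace ℝ (Fin (d + 1)))} {R : ℝ} (hR : 0 ≤ R)
    (hAR : A ⊆ Metric.ball 0 R) : steiner A ⊆ Metric.ball 0 R := by
  intro x hx
  rw [← (splitFirst d).symm_apply_apply x] at hx ⊢
  generalize splitFirst d x = p at hx ⊢
  obtain ⟨s, y⟩ := p
  change s ∈ lineSection (steiner A) y at hx
  change s ∈ lineSection (Metric.ball 0 R) y
  rw [lineSection_steiner] at hx
  rw [lineSection_ball hR]
  set b := √(R ^ 2 - ∑ i, y i ^ 2)
  have h : volume.real (lineSection A y) ≤ 2 * b := by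
    have hsub : lineSection A y ⊆ lineSection (Metric.ball 0 R) y := fun s hs => hAR hs
    have hle := measureReal_mono hsub (volume_lineSection_ne_top hR subset_rfl y)
    rw [lineSection_ball hR, Real.volume_real_Ioo, max_eq_left (by simp)] at hle
    linarith
  exact Set.Ioo_subset_Ioo (by linarith) (by linarith) hx

theorem volume_Ioo_sdiff_add_le {P : Set ℝ} (hP : MeasurableSet P) (hfin : volume P ≠ ∞) (b a : ℝ) :
    volume (Ioo (-(volume.real P / 2)) (volume.real P / 2) \ Ioo (-b) b)
      + volume ((P \ Ioo (-b) b) ∩ {s | s + a ∈ Ioo (-b) b \ P})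
      ≤ volume (P \ Ioo (-b) b) := by
  set Q := Ioo (-b) b with hQ
  have hQm : MeasurableSet Q := measurableSet_Ioo
  rcases le_total (volume.real P / 2) b with h | h
  · rw [sdiff_eq_empty.2 (Set.Ioo_subset_Ioo (by linarith) h), measure_empty, zero_add]
    exact measure_mono inter_subset_left
  · have hshift : volume ((P \ Q) ∩ {s | s + a ∈ Q \ P}) ≤ volume (Q \ P) := by
      refine (measure_mono inter_subset_right).trans ?_
      exact (measure_preimage_add_right volume a (Q \ P)).le
    have hIoo : volume (Ioo (-(volume.real P / 2)) (volume.real P / 2)) = volume P := by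
      rw [Real.volume_Ioo, sub_neg_eq_add, add_halves, Measure.real, ENNReal.ofReal_toReal hfin]
    have hQfin : volume Q ≠ ∞ := by simp [hQ]
    have hQIoo : Q ⊆ Ioo (-(volume.real P / 2)) (volume.real P / 2) :=
      Set.Ioo_subset_Ioo (by linarith) h
    have hIooQ : volume (Ioo (-(volume.real P / 2)) (volume.real P / 2) \ Q) + volume Q
        = volume P := by
      have := measure_sdiff_add_inter (μ := volume)
        (Ioo (-(volume.real P / 2)) (volume.real P / 2)) hQm
      rwa [inter_eq_right.2 hQIoo, hIoo] at this
    have hexchange : volume P + volume (Q \ P) = volume (P \ Q) + volume Q := by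
      rw [← measure_sdiff_add_inter P hQm, ← measure_sdiff_add_inter Q hP, inter_comm Q P]
      ring
    rw [← ENNReal.add_le_add_iff_right hQfin]
    calc _ = volume P + volume ((P \ Q) ∩ {s | s + a ∈ Q \ P}) := by rw [← hIooQ]; ring
      _ ≤ volume P + volume (Q \ P) := by gcongr
      _ = _ := hexchange

theorem volume_steiner_sdiff_ball_add_le {A : Set (EuclideanSpace ℝ (Fin (d + 1)))}
    (hA : MeasurableSet A) {R : ℝ} (hR : 0 ≤ R) (hAR : A ⊆ Metric.ball 0 R) {r : ℝ} (hr : 0 ≤ r)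
    (a : ℝ) :
    volume (steiner A \ Metric.ball 0 r) + volume ((A \ Metric.ball 0 r) ∩
      {x | x + a • EuclideanSpace.single 0 1 ∈ Metric.ball 0 r \ A})
      ≤ volume (A \ Metric.ball 0 r) := by
  have hB : MeasurableSet (Metric.ball (0 : EuclideanSpace ℝ (Fin (d + 1))) r) :=
    measurableSet_ball
  have hout := (measurableSet_steiner hA).diff hB
  have hmoved : MeasurableSet ((A \ Metric.ball 0 r) ∩
      {x | x + a • EuclideanSpace.single 0 1 ∈ Metric.ball 0 r \ A}) :=
    (hA.diff hB).inter ((measurable_add_const _) (hB.diff hA))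
  rw [volume_eq_lintegral_lineSection hout, volume_eq_lintegral_lineSection hmoved,
    volume_eq_lintegral_lineSection (hA.diff hB),
    ← lintegral_add_left (measurable_volume_lineSection hout)]
  refine lintegral_mono fun y => ?_
  have := volume_Ioo_sdiff_add_le (measurableSet_lineSection hA y)
    (volume_lineSection_ne_top hR hAR y) (√(r ^ 2 - ∑ i, y i ^ 2)) a
  rw [← lineSection_steiner, ← lineSection_ball hr] at this
  have hsection : lineSection ((A \ Metric.ball 0 r) ∩
      {x | x + a • EuclideanSpace.single 0 1 ∈ Metric.ball 0 r \ A}) y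
      = (lineSection A y \ lineSection (Metric.ball 0 r) y) ∩
        {s | s + a ∈ lineSection (Metric.ball 0 r) y \ lineSection A y} := by
    ext s
    simp only [lineSection, mem_inter_iff, Set.mem_sdiff, mem_ofPred_eq, splitFirst_symm_add]
  rw [hsection]
  exact this

/-! ### Sets of families of points -/

variable {κ : Type*} [Fintype κ]

theorem volume_eq_lintegral_lines {S : Set (κ → EuclideanSpace ℝ (Fin (d + 1)))}
    (hS : MeasurableSet S) :
    volume S = ∫⁻ y : κ → Fin d → ℝ,
      volume {t : κ → ℝ | (fun k => (splitFirst d).symm (t k, y k)) ∈ S} := by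
  set e := (MeasurableEquiv.piCongrRight (fun _ : κ => splitFirst d)).trans
    (MeasurableEquiv.arrowProdEquivProdArrow ℝ (Fin d → ℝ) κ)
  have hp : MeasurePreserving e :=
    (volume_measurePreserving_arrowProdEquivProdArrow ℝ (Fin d → ℝ) κ).comp
      (measurePreserving_pi (fun _ => volume) (fun _ => volume)
        fun _ : κ => measurePreserving_splitFirst d)
  rw [← hp.symm.measure_preimage_equiv, Measure.volume_eq_prod,
    Measure.prod_apply_symm (e.symm.measurable hS)]
  rfl

/-- A measurable set of families of points that is invariant under linear isometries and whose
sections by families of lines in the direction of the first axis are convex. -/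
structure IsSteinerConvex (G : Set (κ → EuclideanSpace ℝ (Fin (d + 1)))) : Prop where
  measurableSet : MeasurableSet G
  isometry_mem : ∀ g : EuclideanSpace ℝ (Fin (d + 1)) ≃ₗᵢ[ℝ] EuclideanSpace ℝ (Fin (d + 1)),
    ∀ X ∈ G, (fun k => g (X k)) ∈ G
  convex : ∀ Y : κ → EuclideanSpace ℝ (Fin (d + 1)),
    Convex ℝ {t : κ → ℝ | (fun k => Y k + t k • EuclideanSpace.single 0 1) ∈ G}

/-- The reflection changing the sign of the first coordinate. -/
def reflectFirst (d : ℕ) :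
    EuclideanSpace ℝ (Fin (d + 1)) ≃ₗᵢ[ℝ] EuclideanSpace ℝ (Fin (d + 1)) :=
  LinearIsometryEquiv.piLpCongrRight 2
    fun i => if i = 0 then LinearIsometryEquiv.neg ℝ else LinearIsometryEquiv.refl ℝ ℝ

theorem reflectFirst_splitFirst_symm (s : ℝ) (y : Fin d → ℝ) :
    reflectFirst d ((splitFirst d).symm (s, y)) = (splitFirst d).symm (-s, y) := by
  ext i
  refine Fin.cases ?_ (fun i => ?_) i
  · simp [reflectFirst, splitFirst_symm_zero]
  · simp [reflectFirst, splitFirst_symm_succ]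

variable {G : Set (κ → EuclideanSpace ℝ (Fin (d + 1)))}

theorem IsSteinerConvex.volume_inter_pi_le_steiner (hG : IsSteinerConvex G)
    {A : κ → Set (EuclideanSpace ℝ (Fin (d + 1)))} (hA : ∀ k, MeasurableSet (A k))
    {R : ℝ} (hR : 0 ≤ R) (hAR : ∀ k, A k ⊆ Metric.ball 0 R) :
    volume (G ∩ univ.pi A) ≤ volume (G ∩ univ.pi fun k => steiner (A k)) := by
  rw [volume_eq_lintegral_lines (hG.measurableSet.inter (MeasurableSet.univ_pi hA)),
    volume_eq_lintegral_lines (hG.measurableSet.inter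
      (MeasurableSet.univ_pi fun k => measurableSet_steiner (hA k)))]
  refine lintegral_mono fun y => ?_
  set K : Set (κ → ℝ) := {t | (fun k => (splitFirst d).symm (t k, y k)) ∈ G} with hK
  have hKm : MeasurableSet K := by
    have : Measurable fun t : κ → ℝ => fun k => (splitFirst d).symm (t k, y k) :=
      measurable_pi_lambda _ fun k => (splitFirst d).symm.measurable.comp
        ((measurable_pi_apply k).prodMk measurable_const)
    exact this hG.measurableSet
  have hKc : Convex ℝ K := by
    have := hG.convex fun k => (splitFirst d).symm (0, y k)
    simp_rw [← splitFirst_symm_add, zero_add] at this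
    exact this
  have hKs : ∀ t ∈ K, -t ∈ K := by
    intro t ht
    have := hG.isometry_mem (reflectFirst d) _ ht
    simp only [reflectFirst_splitFirst_symm] at this
    exact this
  have := volume_inter_pi_le_symmetric hKm hKc hKs (fun k => lineSection (A k) (y k))
    (fun k => measurableSet_lineSection (hA k) (y k))
    (fun k => volume_lineSection_ne_top hR (hAR k) (y k))
  simp_rw [← lineSection_steiner] at this
  have hsections : ∀ B : κ → Set (EuclideanSpace ℝ (Fin (d + 1))),
      {t : κ → ℝ | (fun k => (splitFirst d).symm (t k, y k)) ∈ G ∩ univ.pi B}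
        = K ∩ univ.pi fun k => lineSection (B k) (y k) := by
    intro B; ext t; simp [hK, lineSection, Set.mem_pi]
  simp only [hsections]
  exact this

theorem exists_isometry_eq_smul_single (z : EuclideanSpace ℝ (Fin (d + 1))) :
    ∃ (g : EuclideanSpace ℝ (Fin (d + 1)) ≃ₗᵢ[ℝ] EuclideanSpace ℝ (Fin (d + 1))) (a : ℝ),
      g z = a • EuclideanSpace.single 0 1 := by
  have h : ‖z‖ = ‖‖z‖ • (EuclideanSpace.single 0 1 : EuclideanSpace ℝ (Fin (d + 1)))‖ := by
    simp [norm_smul]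
  exact ⟨_, _, Submodule.reflection_sub h⟩

theorem IsSteinerConvex.volume_inter_pi_preimage (hG : IsSteinerConvex G)
    (A : κ → Set (EuclideanSpace ℝ (Fin (d + 1))))
    (g : EuclideanSpace ℝ (Fin (d + 1)) ≃ₗᵢ[ℝ] EuclideanSpace ℝ (Fin (d + 1))) :
    volume (G ∩ univ.pi A) = volume (G ∩ univ.pi fun k => g ⁻¹' A k) := by
  have hp : MeasurePreserving (MeasurableEquiv.piCongrRight fun _ : κ => g.toMeasurableEquiv) :=
    measurePreserving_pi (fun _ => volume) (fun _ => volume) fun _ : κ => g.measurePreserving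
  rw [← hp.measure_preimage_equiv]
  congr 1
  ext X
  have : X ∈ G ↔ (fun k => g (X k)) ∈ G := by
    refine ⟨hG.isometry_mem g X, fun h => ?_⟩
    simpa using hG.isometry_mem g.symm _ h
  simp only [mem_inter_iff, this, mem_preimage, Set.mem_pi]
  rfl

theorem lintegral_volume_inter_translate {E : Type*} [AddGroup E] [MeasureSpace E]
    [MeasurableAdd₂ E] [SFinite (volume : Measure E)] [(volume : Measure E).IsAddLeftInvariant]
    {P Q : Set E} (hP : MeasurableSet P) (hQ : MeasurableSet Q) :
    ∫⁻ z, volume (P ∩ {x | x + z ∈ Q}) = volume P * volume Q := by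
  have hS : MeasurableSet {p : E × E | p.1 ∈ P ∧ p.1 + p.2 ∈ Q} :=
    (measurable_fst hP).inter (measurable_add hQ)
  have hswap := Measure.prod_apply_symm (μ := (volume : Measure E)) (ν := (volume : Measure E)) hS
  rw [Measure.prod_apply hS] at hswap
  refine Eq.trans ?_ (hswap.symm.trans ?_)
  · rfl
  · rw [mul_comm, ← lintegral_indicator_const hP]
    refine lintegral_congr fun x => ?_
    by_cases hx : x ∈ P
    · rw [indicator_of_mem hx, ← measure_preimage_add volume x Q]
      congr 1
      ext z; simp [hx]
    · rw [indicator_of_notMem hx]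
      convert measure_empty (μ := (volume : Measure E))
      ext z; simp [hx]

theorem measurable_volume_inter_translate {E : Type*} [Add E] [MeasureSpace E] [MeasurableAdd₂ E]
    [SFinite (volume : Measure E)] {P Q : Set E} (hP : MeasurableSet P) (hQ : MeasurableSet Q) :
    Measurable fun z => volume (P ∩ {x | x + z ∈ Q}) :=
  measurable_measure_prodMk_right ((measurable_fst hP).inter (measurable_add hQ) :
    MeasurableSet {p : E × E | p.1 ∈ P ∧ p.1 + p.2 ∈ Q})

theorem setLIntegral_volume_inter_translate {P Q : Set (EuclideanSpace ℝ (Fin (d + 1)))}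
    (hP : MeasurableSet P) (hQ : MeasurableSet Q) {R : ℝ} (hPR : P ⊆ Metric.ball 0 R)
    (hQR : Q ⊆ Metric.ball 0 R) :
    ∫⁻ z in Metric.ball 0 (2 * R), volume (P ∩ {x | x + z ∈ Q}) = volume P * volume Q := by
  rw [← lintegral_indicator measurableSet_ball, indicator_eq_self.2,
    lintegral_volume_inter_translate hP hQ]
  intro z hz
  obtain ⟨x, hx, hxz⟩ := nonempty_of_measure_ne_zero hz
  rw [mem_ball_zero_iff]
  calc ‖z‖ = ‖(x + z) - x‖ := by rw [add_sub_cancel_left]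
    _ ≤ ‖x + z‖ + ‖x‖ := norm_sub_le _ _
    _ < R + R := add_lt_add (mem_ball_zero_iff.1 (hQR hxz)) (mem_ball_zero_iff.1 (hPR hx))
    _ = 2 * R := (two_mul R).symm

theorem exists_sum_sq_div_le_sum_volume_inter_translate
    {A B : κ → Set (EuclideanSpace ℝ (Fin (d + 1)))} (hA : ∀ k, MeasurableSet (A k))
    (hB : ∀ k, MeasurableSet (B k)) {R : ℝ} (hR : 0 < R) (hAR : ∀ k, A k ⊆ Metric.ball 0 R)
    (hBR : ∀ k, B k ⊆ Metric.ball 0 R) (hvol : ∀ k, volume (A k) = volume (B k)) :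
    ∃ z, (∑ k, volume (A k \ B k) ^ 2) /
        volume (Metric.ball (0 : EuclideanSpace ℝ (Fin (d + 1))) (2 * R))
      ≤ ∑ k, volume ((A k \ B k) ∩ {x | x + z ∈ B k \ A k}) := by
  have hfin : ∀ k, volume (A k) ≠ ∞ := fun k =>
    measure_ne_top_of_subset (hAR k) measure_ball_lt_top.ne
  have hint : ∫⁻ z in Metric.ball 0 (2 * R), ∑ k, volume ((A k \ B k) ∩ {x | x + z ∈ B k \ A k})
      = ∑ k, volume (A k \ B k) ^ 2 := by
    rw [lintegral_finsetSum _ fun k _ =>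
      measurable_volume_inter_translate ((hA k).diff (hB k)) ((hB k).diff (hA k))]
    refine Finset.sum_congr rfl fun k _ => ?_
    rw [setLIntegral_volume_inter_translate ((hA k).diff (hB k)) ((hB k).diff (hA k))
      (sdiff_subset.trans (hAR k)) (sdiff_subset.trans (hBR k)),
      measure_sdiff_symm (hB k).nullMeasurableSet (hA k).nullMeasurableSet (hvol k).symm
        (measure_ne_top_of_subset inter_subset_right (hfin k)), sq]
  obtain ⟨z, -, hz⟩ := exists_setLAverage_le (μ := volume)
    (f := fun z => ∑ k, volume ((A k \ B k) ∩ {x | x + z ∈ B k \ A k}))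
    (Metric.measure_ball_pos _ _ (mul_pos two_pos hR)).ne' measurableSet_ball.nullMeasurableSet (by
      rw [hint]
      exact ENNReal.sum_ne_top.2 fun k _ => ENNReal.pow_ne_top
        (measure_ne_top_of_subset sdiff_subset (hfin k)))
  rw [setLAverage_eq, hint] at hz
  exact ⟨z, hz⟩

theorem volume_steiner_preimage_sdiff_ball_add_le {A : Set (EuclideanSpace ℝ (Fin (d + 1)))}
    (hA : MeasurableSet A) {R : ℝ} (hR : 0 ≤ R) (hAR : A ⊆ Metric.ball 0 R) {r : ℝ} (hr : 0 ≤ r)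
    {g : EuclideanSpace ℝ (Fin (d + 1)) ≃ₗᵢ[ℝ] EuclideanSpace ℝ (Fin (d + 1))}
    {z : EuclideanSpace ℝ (Fin (d + 1))} {a : ℝ} (hg : g z = a • EuclideanSpace.single 0 1) :
    volume (steiner (g.symm ⁻¹' A) \ Metric.ball 0 r)
        + volume ((A \ Metric.ball 0 r) ∩ {x | x + z ∈ Metric.ball 0 r \ A})
      ≤ volume (A \ Metric.ball 0 r) := by
  have hvol : ∀ S : Set (EuclideanSpace ℝ (Fin (d + 1))), volume (g.symm ⁻¹' S) = volume S :=
    fun S => g.symm.measurePreserving.measure_preimage_equiv (f := g.symm.toMeasurableEquiv) S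
  have hball : ∀ x, g.symm x ∈ Metric.ball (0 : EuclideanSpace ℝ (Fin (d + 1))) r
      ↔ x ∈ Metric.ball 0 r := fun x => by simp
  have htrans : ∀ x, g.symm (x + a • EuclideanSpace.single 0 1) = g.symm x + z := fun x => by
    rw [← hg, map_add, LinearIsometryEquiv.symm_apply_apply]
  have hsdiff : g.symm ⁻¹' A \ Metric.ball 0 r = g.symm ⁻¹' (A \ Metric.ball 0 r) := by
    ext x
    simp only [Set.mem_sdiff, mem_preimage, hball]
  have hinter : (g.symm ⁻¹' A \ Metric.ball 0 r) ∩
      {x | x + a • EuclideanSpace.single 0 1 ∈ Metric.ball 0 r \ g.symm ⁻¹' A}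
      = g.symm ⁻¹' ((A \ Metric.ball 0 r) ∩ {x | x + z ∈ Metric.ball 0 r \ A}) := by
    ext x
    simp only [mem_inter_iff, mem_preimage, Set.mem_sdiff, mem_ofPred_eq, ← htrans, hball]
  have hgR : g.symm ⁻¹' A ⊆ Metric.ball 0 R := fun x hx => by simpa using hAR hx
  have := volume_steiner_sdiff_ball_add_le (g.symm.continuous.measurable hA) hR hgR hr a
  rwa [hinter, hsdiff, hvol, hvol] at this

theorem ennreal_sq_sum_le (f : κ → ℝ≥0∞) : (∑ k, f k) ^ 2 ≤ Fintype.card κ * ∑ k, f k ^ 2 := by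
  have := ENNReal.rpow_sum_le_const_mul_sum_rpow Finset.univ f one_le_two
  norm_num at this
  exact this

/-- Rotating a suitable direction to the first axis and symmetrizing in it decreases the volume
outside the balls by an amount that only depends on that volume: the direction is chosen by
averaging over the translations that carry points outside the balls to points missing inside. -/
theorem IsSteinerConvex.exists_sum_volume_sdiff_ball_add_le (hG : IsSteinerConvex G) {R : ℝ}
    (hR : 0 < R) {r : κ → ℝ} (hr : ∀ k, 0 ≤ r k)
    (hrR : ∀ k, Metric.ball (0 : EuclideanSpace ℝ (Fin (d + 1))) (r k) ⊆ Metric.ball 0 R)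
    {A : κ → Set (EuclideanSpace ℝ (Fin (d + 1)))} (hA : ∀ k, MeasurableSet (A k))
    (hAR : ∀ k, A k ⊆ Metric.ball 0 R) (hvol : ∀ k, volume (A k) = volume (Metric.ball
      (0 : EuclideanSpace ℝ (Fin (d + 1))) (r k))) :
    ∃ A' : κ → Set (EuclideanSpace ℝ (Fin (d + 1))), (∀ k, MeasurableSet (A' k)) ∧
      (∀ k, A' k ⊆ Metric.ball 0 R) ∧ (∀ k, volume (A' k) = volume (A k)) ∧
      volume (G ∩ univ.pi A) ≤ volume (G ∩ univ.pi A') ∧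
      ∑ k, volume (A' k \ Metric.ball 0 (r k)) + (Fintype.card κ *
          volume (Metric.ball (0 : EuclideanSpace ℝ (Fin (d + 1))) (2 * R)))⁻¹ *
          (∑ k, volume (A k \ Metric.ball 0 (r k))) ^ 2
        ≤ ∑ k, volume (A k \ Metric.ball 0 (r k)) := by
  obtain ⟨z, hz⟩ := exists_sum_sq_div_le_sum_volume_inter_translate hA
    (fun k => measurableSet_ball (ε := r k)) hR hAR hrR hvol
  obtain ⟨g, a, hg⟩ := exists_isometry_eq_smul_single z
  have hgA : ∀ k, MeasurableSet (g.symm ⁻¹' A k) := fun k => g.symm.continuous.measurable (hA k)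
  have hgR : ∀ k, g.symm ⁻¹' A k ⊆ Metric.ball 0 R := fun k x hx => by simpa using hAR k hx
  refine ⟨fun k => steiner (g.symm ⁻¹' A k), fun k => measurableSet_steiner (hgA k),
    fun k => steiner_subset_ball hR.le (hgR k), fun k => ?_, ?_, ?_⟩
  · rw [volume_steiner (hgA k) hR.le (hgR k)]
    exact g.symm.measurePreserving.measure_preimage_equiv (f := g.symm.toMeasurableEquiv) (A k)
  · rw [hG.volume_inter_pi_preimage A g.symm]
    exact hG.volume_inter_pi_le_steiner hgA hR.le hgR
  · calc _ ≤ ∑ k, volume (steiner (g.symm ⁻¹' A k) \ Metric.ball 0 (r k)) +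
          ∑ k, volume ((A k \ Metric.ball 0 (r k)) ∩ {x | x + z ∈ Metric.ball 0 (r k) \ A k}) := by
          gcongr
          refine le_trans ?_ hz
          have hV : volume (Metric.ball (0 : EuclideanSpace ℝ (Fin (d + 1))) (2 * R)) ≠ ∞ :=
            measure_ball_lt_top.ne
          rw [ENNReal.mul_inv (Or.inr hV) (Or.inl (ENNReal.natCast_ne_top _)),
            ENNReal.div_eq_inv_mul, mul_comm (_⁻¹ : ℝ≥0∞), mul_assoc]
          gcongr
          rw [← ENNReal.div_eq_inv_mul]
          exact ENNReal.div_le_of_le_mul' (ennreal_sq_sum_le _)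
      _ ≤ _ := by
          rw [← Finset.sum_add_distrib]
          exact Finset.sum_le_sum fun k _ =>
            volume_steiner_preimage_sdiff_ball_add_le (hA k) hR.le (hAR k) (hr k) hg

theorem exists_lt_of_forall_exists_add_mul_sq_le {α : Type*} {S : Set α} (hS : S.Nonempty)
    {D : α → ℝ≥0∞} (hD : ∀ a ∈ S, D a ≠ ∞) {c : ℝ≥0∞} (hc : c ≠ 0)
    (h : ∀ a ∈ S, ∃ b ∈ S, D b + c * D a ^ 2 ≤ D a) {ε : ℝ≥0∞} (hε : ε ≠ 0) :
    ∃ a ∈ S, D a < ε := by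
  by_contra! hlow
  obtain ⟨a₀, ha₀⟩ := hS
  set s := ⨅ a ∈ S, D a
  have hs : ∀ a ∈ S, s ≤ D a := fun a ha => iInf₂_le a ha
  have hs0 : s ≠ 0 := (hε.bot_lt.trans_le (le_iInf₂ hlow)).ne'
  have hlt : s < s + c * s ^ 2 := ENNReal.lt_add_right ((hs a₀ ha₀).trans_lt (hD a₀ ha₀).lt_top).ne
    (mul_ne_zero hc (pow_ne_zero 2 hs0))
  obtain ⟨a, ha, hlt⟩ := by simpa only [s, iInf_lt_iff, exists_prop] using hlt
  obtain ⟨b, hb, hle⟩ := h a ha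
  exact absurd hlt (not_lt.2 ((add_le_add (hs b hb)
    (mul_le_mul_right (pow_le_pow_left' (hs a ha) 2) c)).trans hle))

theorem IsSteinerConvex.exists_sum_volume_sdiff_ball_lt (hG : IsSteinerConvex G) {R : ℝ}
    (hR : 0 < R) {r : κ → ℝ} (hr : ∀ k, 0 ≤ r k)
    (hrR : ∀ k, Metric.ball (0 : EuclideanSpace ℝ (Fin (d + 1))) (r k) ⊆ Metric.ball 0 R)
    {A : κ → Set (EuclideanSpace ℝ (Fin (d + 1)))} (hA : ∀ k, MeasurableSet (A k))
    (hAR : ∀ k, A k ⊆ Metric.ball 0 R) (hvol : ∀ k, volume (A k) = volume (Metric.ball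
      (0 : EuclideanSpace ℝ (Fin (d + 1))) (r k))) {ε : ℝ≥0∞} (hε : ε ≠ 0) :
    ∃ A' : κ → Set (EuclideanSpace ℝ (Fin (d + 1))), (∀ k, volume (A' k) = volume (A k)) ∧
      volume (G ∩ univ.pi A) ≤ volume (G ∩ univ.pi A') ∧
      ∑ k, volume (A' k \ Metric.ball 0 (r k)) < ε := by
  obtain ⟨A', ⟨-, -, hA'vol, hle⟩, hlt⟩ := exists_lt_of_forall_exists_add_mul_sq_le
    (S := {A' | (∀ k, MeasurableSet (A' k)) ∧ (∀ k, A' k ⊆ Metric.ball 0 R) ∧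
      (∀ k, volume (A' k) = volume (A k)) ∧ volume (G ∩ univ.pi A) ≤ volume (G ∩ univ.pi A')})
    (D := fun A' => ∑ k, volume (A' k \ Metric.ball 0 (r k)))
    (c := (Fintype.card κ * volume (Metric.ball (0 : EuclideanSpace ℝ (Fin (d + 1))) (2 * R)))⁻¹)
    ⟨A, hA, hAR, fun _ => rfl, le_rfl⟩
    (fun A' hA' => ENNReal.sum_ne_top.2 fun k _ =>
      measure_ne_top_of_subset (sdiff_subset.trans (hA'.2.1 k)) measure_ball_lt_top.ne)
    (ENNReal.inv_ne_zero.2 (ENNReal.mul_ne_top (ENNReal.natCast_ne_top _) measure_ball_lt_top.ne))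
    (fun A' ⟨hA', hA'R, hA'vol, hle⟩ => by
      obtain ⟨A'', hA'', hA''R, hA''vol, hle', hdecr⟩ :=
        hG.exists_sum_volume_sdiff_ball_add_le hR hr hrR hA' hA'R fun k => (hA'vol k).trans (hvol k)
      exact ⟨A'', ⟨hA'', hA''R, fun k => (hA''vol k).trans (hA'vol k), hle.trans hle'⟩, hdecr⟩) hε
  exact ⟨A', hA'vol, hle, hlt⟩

theorem IsSteinerConvex.volume_inter_pi_le_ball (hG : IsSteinerConvex G) {R : ℝ} (hR : 0 < R)
    {r : κ → ℝ} (hr : ∀ k, 0 ≤ r k)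
    (hrR : ∀ k, Metric.ball (0 : EuclideanSpace ℝ (Fin (d + 1))) (r k) ⊆ Metric.ball 0 R)
    {A : κ → Set (EuclideanSpace ℝ (Fin (d + 1)))} (hA : ∀ k, MeasurableSet (A k))
    (hAR : ∀ k, A k ⊆ Metric.ball 0 R) (hvol : ∀ k, volume (A k) = volume (Metric.ball
      (0 : EuclideanSpace ℝ (Fin (d + 1))) (r k))) :
    volume (G ∩ univ.pi A) ≤ volume (G ∩ univ.pi fun k => Metric.ball 0 (r k)) := by
  classical
  have hfin : ∀ k, volume (A k) ≠ ∞ := fun k =>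
    measure_ne_top_of_subset (hAR k) measure_ball_lt_top.ne
  refine ennreal_le_of_forall_le_add_mul (c := ∑ k, ∏ j ∈ Finset.univ.erase k, volume (A j))
    (ENNReal.sum_ne_top.2 fun k _ => ENNReal.prod_ne_top fun j _ => hfin j) fun ε hε _ => ?_
  obtain ⟨A', hA'vol, hle, hlt⟩ := hG.exists_sum_volume_sdiff_ball_lt hR hr hrR hA hAR hvol hε
  calc volume (G ∩ univ.pi A) ≤ volume (G ∩ univ.pi A') := hle
    _ ≤ volume (G ∩ univ.pi fun k => Metric.ball 0 (r k))
          + volume (univ.pi A' \ univ.pi fun k => Metric.ball 0 (r k)) :=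
        measure_inter_le_add_sdiff _ _ _ _
    _ ≤ _ := by
        gcongr
        exact measure_pi_sdiff_le_of_le _ (fun j => (hA'vol j).le) fun k =>
          (Finset.single_le_sum (f := fun k => volume (A' k \ Metric.ball 0 (r k)))
            (fun _ _ => zero_le) (Finset.mem_univ k)).trans hlt.le

theorem IsSteinerConvex.volume_inter_pi_le_setRearrangement (hG : IsSteinerConvex G)
    {A : κ → Set (EuclideanSpace ℝ (Fin (d + 1)))} (hA : ∀ k, MeasurableSet (A k))
    (hAb : ∀ k, Bornology.IsBounded (A k)) :
    volume (G ∩ univ.pi A) ≤ volume (G ∩ univ.pi fun k => setRearrangement (A k)) := by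
  have hball : ∀ k, ∃ r : ℝ, 0 ≤ r ∧ setRearrangement (A k) = Metric.ball 0 r := fun k =>
    ⟨_, by positivity, rfl⟩
  choose r hr hball using hball
  have hbdd : Bornology.IsBounded (⋃ k, A k ∪ Metric.ball 0 (r k)) :=
    Bornology.isBounded_iUnion.2 fun k => (hAb k).union Metric.isBounded_ball
  obtain ⟨R, hR, hsub⟩ := hbdd.subset_ball_lt 0 0
  have hsub' := fun k => union_subset_iff.1 (iUnion_subset_iff.1 hsub k)
  simp_rw [hball]
  refine hG.volume_inter_pi_le_ball hR hr (fun k => (hsub' k).2) hA (fun k => (hsub' k).1)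
    fun k => ?_
  rw [← hball, volume_setRearrangement (Nat.succ_ne_zero d) _ (hAb k).measure_lt_top.ne]

end

/-! ### Rearrangement of densities -/

section

variable {κ : Type*} [Fintype κ]

theorem IsSteinerConvex.volume_inter_pi_le {d : ℕ}
    {G : Set (κ → EuclideanSpace ℝ (Fin (d + 1)))} (hG : IsSteinerConvex G)
    {E E' : κ → Set (EuclideanSpace ℝ (Fin (d + 1)))} (hE : ∀ k, MeasurableSet (E k))
    (h : ∀ k, ∀ A ⊆ E k, MeasurableSet A → Bornology.IsBounded A → setRearrangement A ⊆ E' k) :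
    volume (G ∩ univ.pi E) ≤ volume (G ∩ univ.pi E') := by
  set T : ℕ → Set (κ → EuclideanSpace ℝ (Fin (d + 1))) :=
    fun n => G ∩ univ.pi fun k => E k ∩ Metric.ball 0 n
  have hTmono : Monotone T := fun n m hnm =>
    inter_subset_inter_right _ (pi_mono fun k _ =>
      inter_subset_inter_right _ (Metric.ball_subset_ball (by exact_mod_cast hnm)))
  have hU : G ∩ univ.pi E = ⋃ n, T n := by
    refine Set.Subset.antisymm ?_ (iUnion_subset fun n =>
      inter_subset_inter_right _ (pi_mono fun k _ => inter_subset_left))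
    rintro X ⟨hX, hXE⟩
    obtain ⟨n, hn⟩ := exists_nat_gt (∑ k, ‖X k‖)
    refine mem_iUnion.2 ⟨n, hX, fun k _ => ⟨hXE k trivial, ?_⟩⟩
    rw [mem_ball_zero_iff]
    exact (Finset.single_le_sum (f := fun k => ‖X k‖) (fun _ _ => norm_nonneg _)
      (Finset.mem_univ k)).trans_lt hn
  rw [hU, hTmono.measure_iUnion]
  refine iSup_le fun n => ?_
  calc volume (T n)
      ≤ volume (G ∩ univ.pi fun k => setRearrangement (E k ∩ Metric.ball 0 n)) :=
        hG.volume_inter_pi_le_setRearrangement (fun k => (hE k).inter measurableSet_ball)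
          fun k => Metric.isBounded_ball.subset inter_subset_right
    _ ≤ volume (G ∩ univ.pi E') := measure_mono (inter_subset_inter_right _ (pi_mono fun k _ =>
        h k _ inter_subset_left ((hE k).inter measurableSet_ball)
          (Metric.isBounded_ball.subset inter_subset_right)))

theorem lintegral_prod_volume_layers {α : Type*} [MeasureSpace α] [SigmaFinite (volume : Measure α)]
    (G : Set (κ → α)) {E : κ → ℝ → Set α}
    (hE : ∀ k, MeasurableSet {p : ℝ × α | p.2 ∈ E k p.1}) :
    ∫⁻ X in G, ∏ k, volume.restrict (Ioi 0) {t | X k ∈ E k t}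
      = ∫⁻ T in univ.pi fun _ : κ => Ioi (0 : ℝ), volume (G ∩ univ.pi fun k => E k (T k)) := by
  set S : Set ((κ → α) × (κ → ℝ)) := ⋂ k, {p | p.1 k ∈ E k (p.2 k)}
  have hS : MeasurableSet S := MeasurableSet.iInter fun k =>
    (show Measurable fun p : (κ → α) × (κ → ℝ) => (p.2 k, p.1 k) by fun_prop) (hE k)
  calc ∫⁻ X in G, ∏ k, volume.restrict (Ioi 0) {t | X k ∈ E k t}
      = ∫⁻ X in G, Measure.pi (fun _ => (volume : Measure ℝ).restrict (Ioi 0))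
          (Prod.mk X ⁻¹' S) := lintegral_congr fun X => by
        rw [← Measure.pi_pi]
        congr 1
        ext T
        simp [S]
    _ = ∫⁻ T in univ.pi fun _ : κ => Ioi (0 : ℝ),
          (volume.restrict G) ((fun X => (X, T)) ⁻¹' S) := by
        rw [← Measure.prod_apply hS, Measure.prod_apply_symm hS, ← Measure.restrict_pi_pi]
        rfl
    _ = _ := lintegral_congr fun T => by
        rw [Measure.restrict_apply (measurable_prodMk_right hS), inter_comm]
        congr 2
        ext X
        simp [S]

theorem IsSteinerConvex.lintegral_prod_volume_layers_le {d : ℕ}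
    {G : Set (κ → EuclideanSpace ℝ (Fin (d + 1)))} (hG : IsSteinerConvex G)
    {E E' : κ → ℝ → Set (EuclideanSpace ℝ (Fin (d + 1)))}
    (hE : ∀ k, MeasurableSet {p : ℝ × EuclideanSpace ℝ (Fin (d + 1)) | p.2 ∈ E k p.1})
    (hE' : ∀ k, MeasurableSet {p : ℝ × EuclideanSpace ℝ (Fin (d + 1)) | p.2 ∈ E' k p.1})
    (h : ∀ k t, 0 < t → ∀ A ⊆ E k t, MeasurableSet A → Bornology.IsBounded A →
      setRearrangement A ⊆ E' k t) :
    ∫⁻ X in G, ∏ k, volume.restrict (Ioi 0) {t | X k ∈ E k t}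
      ≤ ∫⁻ X in G, ∏ k, volume.restrict (Ioi 0) {t | X k ∈ E' k t} := by
  rw [lintegral_prod_volume_layers G hE, lintegral_prod_volume_layers G hE']
  exact setLIntegral_mono' (MeasurableSet.univ_pi fun _ => measurableSet_Ioi) fun T hT =>
    hG.volume_inter_pi_le (fun k => measurable_prodMk_left (hE k)) fun k => h k (T k) (hT k trivial)

section Layers

variable {n : ℕ}

theorem measurableSet_setRearrangement_superlevel (f : EuclideanSpace ℝ (Fin n) → ℝ≥0∞) :
    MeasurableSet {p : ℝ × EuclideanSpace ℝ (Fin n) |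
      p.2 ∈ setRearrangement {y | ENNReal.ofReal p.1 < f y}} := by
  have hanti : Antitone fun t : ℝ => volume {x | ENNReal.ofReal t < f x} :=
    fun t t' htt' => measure_mono fun x hx => (ENNReal.ofReal_le_ofReal htt').trans_lt hx
  have hmeas : Measurable fun p : ℝ × EuclideanSpace ℝ (Fin n) =>
      volume.real {x | ENNReal.ofReal p.1 < f x} :=
    hanti.measurable.ennreal_toReal.comp measurable_fst
  simp only [setRearrangement, mem_ball_zero_iff]
  exact measurableSet_lt (by fun_prop) (by fun_prop)

theorem symmDecrRearrangement_eq_volume (f : EuclideanSpace ℝ (Fin n) → ℝ≥0∞)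
    (x : EuclideanSpace ℝ (Fin n)) :
    symmDecrRearrangement f x = volume.restrict (Ioi 0)
      {t : ℝ | x ∈ setRearrangement {y | ENNReal.ofReal t < f y}} := by
  have hm : MeasurableSet {t : ℝ | x ∈ setRearrangement {y | ENNReal.ofReal t < f y}} :=
    measurable_prodMk_right (y := x) (measurableSet_setRearrangement_superlevel f)
  rw [← lintegral_indicator_one hm, symmDecrRearrangement]
  rfl

theorem measurable_symmDecrRearrangement (f : EuclideanSpace ℝ (Fin n) → ℝ≥0∞) :
    Measurable (symmDecrRearrangement f) := by
  rw [funext (symmDecrRearrangement_eq_volume f)]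
  exact measurable_measure_prodMk_right (measurableSet_setRearrangement_superlevel f)

theorem setRearrangement_mono {A B : Set (EuclideanSpace ℝ (Fin n))} (h : A ⊆ B)
    (hB : volume B ≠ ∞) : setRearrangement A ⊆ setRearrangement B := by
  refine Metric.ball_subset_ball (Real.rpow_le_rpow (by positivity) ?_ (by positivity))
  gcongr

theorem volume_superlevel_ne_top {α : Type*} [MeasurableSpace α] {μ : Measure α} {f : α → ℝ≥0∞}
    (hf : Measurable f) (hfin : ∫⁻ x, f x ∂μ ≠ ∞) {t : ℝ} (ht : 0 < t) :
    μ {x | ENNReal.ofReal t < f x} ≠ ∞ := by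
  have ht' : ENNReal.ofReal t ≠ 0 := by simpa using ht
  refine ((measure_mono fun x (hx : ENNReal.ofReal t < f x) => hx.le).trans_lt
    ((meas_ge_le_lintegral_div hf.aemeasurable ht' ENNReal.ofReal_ne_top).trans_lt ?_)).ne
  exact ENNReal.div_lt_top hfin ht'

theorem setRearrangement_subset_of_radial (hn : n ≠ 0) {E : Set (EuclideanSpace ℝ (Fin n))}
    (hE : ∀ x ∈ E, ∀ y, ‖y‖ ≤ ‖x‖ → y ∈ E) {A : Set (EuclideanSpace ℝ (Fin n))} (hAE : A ⊆ E)
    (hA : Bornology.IsBounded A) : setRearrangement A ⊆ E := by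
  have : Nonempty (Fin n) := ⟨⟨0, Nat.pos_of_ne_zero hn⟩⟩
  have hvol := volume_setRearrangement hn A hA.measure_lt_top.ne
  obtain ⟨r, hr⟩ : ∃ r, setRearrangement A = Metric.ball 0 r := ⟨_, rfl⟩
  rw [hr] at hvol ⊢
  intro x hx
  rw [mem_ball_zero_iff] at hx
  by_contra hxE
  have hAx : A ⊆ Metric.ball 0 ‖x‖ := by
    intro y hy
    rw [mem_ball_zero_iff]
    by_contra hle
    exact hxE (hE y (hAE hy) x (not_lt.1 hle))
  have hle := measure_mono (μ := volume) hAx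
  rw [← hvol, Measure.addHaar_ball _ _ (norm_nonneg x),
    Measure.addHaar_ball _ _ ((norm_nonneg x).trans hx.le),
    ENNReal.mul_le_mul_iff_left (Metric.measure_ball_pos _ _ one_pos).ne' measure_ball_lt_top.ne,
    ENNReal.ofReal_le_ofReal_iff (by positivity), finrank_euclideanSpace_fin] at hle
  exact hle.not_gt (pow_lt_pow_left₀ hx (norm_nonneg x) hn)

end Layers

theorem IsSteinerConvex.lintegral_prod_mul_le {d : ℕ} {ι : Type*} [Fintype ι]
    {G : Set (Option ι → EuclideanSpace ℝ (Fin (d + 1)))} (hG : IsSteinerConvex G)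
    {f : ι → EuclideanSpace ℝ (Fin (d + 1)) → ℝ≥0∞} (hf : ∀ i, Measurable (f i))
    (hfin : ∀ i, ∫⁻ x, f i x ≠ ∞) {ρ : ℝ≥0 → ℝ≥0∞} (hρ : Antitone ρ) :
    ∫⁻ X in G, ρ ‖X none‖₊ * ∏ i, f i (X (some i))
      ≤ ∫⁻ X in G, ρ ‖X none‖₊ * ∏ i, symmDecrRearrangement (f i) (X (some i)) := by
  set F : Option ι → EuclideanSpace ℝ (Fin (d + 1)) → ℝ≥0∞ := fun k => k.elim (fun x => ρ ‖x‖₊) f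
  have hF : ∀ k, MeasurableSet {p : ℝ × EuclideanSpace ℝ (Fin (d + 1)) |
      p.2 ∈ {y | ENNReal.ofReal p.1 < F k y}} := by
    have hFm : ∀ k, Measurable (F k) := by
      rintro (_ | i)
      exacts [hρ.measurable.comp measurable_nnnorm, hf i]
    exact fun k => measurableSet_lt (by fun_prop) ((hFm k).comp measurable_snd)
  -- The superlevel sets of the weight are balls centred at the origin, so they stay in place.
  have hlayers := hG.lintegral_prod_volume_layers_le
    (E := fun k t => {y | ENNReal.ofReal t < F k y}) hF
    (E' := fun k => k.elim (fun t => {y | ENNReal.ofReal t < ρ ‖y‖₊})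
      fun i t => setRearrangement {y | ENNReal.ofReal t < f i y}) ?_ ?_
  · simpa only [← eq_volume_superlevel (F _), Fintype.prod_option, Option.elim_none,
      Option.elim_some, ← symmDecrRearrangement_eq_volume, F,
      ← eq_volume_superlevel fun y : EuclideanSpace ℝ (Fin (d + 1)) => ρ ‖y‖₊] using hlayers
  · rintro (_ | i)
    exacts [hF none, measurableSet_setRearrangement_superlevel (f i)]
  · rintro (_ | i) t ht A hA - hAb
    · exact setRearrangement_subset_of_radial (Nat.succ_ne_zero d)
        (fun x hx y hyx => hx.trans_le (hρ hyx)) hA hAb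
    · exact setRearrangement_mono hA (volume_superlevel_ne_top (hf i) (hfin i) ht)

end

/-! ### Potentials of convex bodies -/

section

variable {ι : Type*} [Fintype ι]

/-- The linear form `h ↦ ∑ gᵢ hᵢ`. -/
def dotCLM (g : ι → ℝ) : (ι → ℝ) →L[ℝ] ℝ :=
  ∑ i, g i • ContinuousLinearMap.proj i

@[simp]
theorem dotCLM_apply (g h : ι → ℝ) : dotCLM g h = g ⬝ᵥ h := by
  simp [dotCLM, dotProduct]

theorem exists_eq_dotProduct (f : (ι → ℝ) →L[ℝ] ℝ) : ∃ h : ι → ℝ, ∀ y, f y = y ⬝ᵥ h := by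
  classical
  exact ⟨_, (f : (ι → ℝ) →ₗ[ℝ] ℝ).pi_apply_eq_sum_univ⟩

theorem exists_norm_le_dotProduct (x : ι → ℝ) : ∃ e : ι → ℝ, ‖e‖ ≤ 1 ∧ ‖x‖ ≤ x ⬝ᵥ e := by
  refine ⟨fun i => SignType.sign (x i), (pi_norm_le_iff_of_nonneg zero_le_one).2 fun i => ?_, ?_⟩
  · obtain h | h | h := lt_trichotomy (x i) 0 <;> simp [h]
  · simp only [dotProduct, self_mul_sign]
    exact (pi_norm_le_iff_of_nonneg (Finset.sum_nonneg fun i _ => abs_nonneg _)).2 fun i =>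
      Finset.single_le_sum (f := fun i => |x i|) (fun i _ => abs_nonneg _) (Finset.mem_univ i)

variable [DecidableEq ι]

/-- A matrix as a continuous linear map. -/
def matCLM (A : Matrix ι ι ℝ) : (ι → ℝ) →L[ℝ] (ι → ℝ) :=
  (Matrix.toLin' A).toContinuousLinearMap

@[simp]
theorem matCLM_apply (A : Matrix ι ι ℝ) (h : ι → ℝ) : matCLM A h = A.mulVec h := rfl

@[simp]
theorem det_matCLM (A : Matrix ι ι ℝ) : (matCLM A).det = A.det := by
  rw [matCLM, ContinuousLinearMap.det]
  simp

/-- `φ` is a convex function with gradient `G` and Hessian `A` at bounded distance from the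
support function of the compact convex set `K`. -/
structure IsPotential (K : Set (ι → ℝ)) (φ : (ι → ℝ) → ℝ) (G : (ι → ℝ) → ι → ℝ)
    (A : (ι → ℝ) → Matrix ι ι ℝ) : Prop where
  hasFDerivAt : ∀ x, HasFDerivAt φ (dotCLM (G x)) x
  hasFDerivAt_grad : ∀ x, HasFDerivAt G (matCLM (A x)) x
  continuous_hess : Continuous A
  posSemidef : ∀ x, (A x).PosSemidef
  isCompact : IsCompact K
  convex : Convex ℝ K
  lower : ∃ C, ∀ x, ∀ y ∈ K, x ⬝ᵥ y ≤ φ x + C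
  upper : ∃ C, ∀ x, ∃ y ∈ K, φ x ≤ x ⬝ᵥ y + C

namespace IsPotential

variable {K : Set (ι → ℝ)} {φ : (ι → ℝ) → ℝ} {G : (ι → ℝ) → ι → ℝ}
  {A : (ι → ℝ) → Matrix ι ι ℝ}

theorem hasDerivAt_line (hP : IsPotential K φ G A) (x h : ι → ℝ) (t : ℝ) :
    HasDerivAt (fun s : ℝ => φ (x + s • h)) (G (x + t • h) ⬝ᵥ h) t := by
  have hline : HasDerivAt (fun s : ℝ => x + s • h) h t := by
    simpa using ((hasDerivAt_id t).smul_const h).const_add x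
  exact ((hP.hasFDerivAt (x + t • h)).comp_hasDerivAt t hline).congr_deriv (by simp)

theorem hasDerivAt_grad_line (hP : IsPotential K φ G A) (x h : ι → ℝ) (t : ℝ) :
    HasDerivAt (fun s : ℝ => G (x + s • h) ⬝ᵥ h) ((A (x + t • h)).mulVec h ⬝ᵥ h) t := by
  have hline : HasDerivAt (fun s : ℝ => x + s • h) h t := by
    simpa using ((hasDerivAt_id t).smul_const h).const_add x
  have hgrad := (hP.hasFDerivAt_grad (x + t • h)).comp_hasDerivAt t hline
  have hdot := (dotCLM h).hasFDerivAt.comp_hasDerivAt t hgrad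
  simpa [dotProduct_comm h, Function.comp_def] using hdot

theorem monotone_grad_line (hP : IsPotential K φ G A) (x h : ι → ℝ) :
    Monotone fun s : ℝ => G (x + s • h) ⬝ᵥ h := by
  refine monotone_of_deriv_nonneg (fun t => (hP.hasDerivAt_grad_line x h t).differentiableAt)
    fun t => ?_
  rw [(hP.hasDerivAt_grad_line x h t).deriv, dotProduct_comm]
  simpa using (hP.posSemidef (x + t • h)).dotProduct_mulVec_nonneg h

theorem add_mul_le (hP : IsPotential K φ G A) (x h : ι → ℝ) {t : ℝ} (ht : 0 < t) :
    φ x + t * (G x ⬝ᵥ h) ≤ φ (x + t • h) := by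
  obtain ⟨c, hc, hslope⟩ := exists_hasDerivAt_eq_slope (fun s : ℝ => φ (x + s • h)) _ ht
    (fun s _ => (hP.hasDerivAt_line x h s).continuousAt.continuousWithinAt)
    (fun s _ => hP.hasDerivAt_line x h s)
  have hm := hP.monotone_grad_line x h hc.1.le
  simp only [zero_smul, add_zero, sub_zero] at hm hslope
  rw [hslope, le_div_iff₀ ht] at hm
  linarith

theorem grad_mem (hP : IsPotential K φ G A) (x : ι → ℝ) : G x ∈ K := by
  by_contra hx
  obtain ⟨f, u, hu, hfx⟩ := geometric_hahn_banach_closed_point hP.convex hP.isCompact.isClosed hx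
  obtain ⟨h, hf⟩ := exists_eq_dotProduct f
  obtain ⟨C, hC⟩ := hP.upper
  obtain ⟨M, hM⟩ := (hP.isCompact.image (dotCLM x).continuous).bddAbove
  have hbound : ∀ t : ℝ, 0 < t → t * (G x ⬝ᵥ h - u) ≤ M + C - φ x := by
    intro t ht
    obtain ⟨y, hy, hle⟩ := hC (x + t • h)
    have hgrad := hP.add_mul_le x h ht
    have hM := hM ⟨y, hy, rfl⟩
    have hu := hu y hy
    rw [dotCLM_apply] at hM
    rw [hf, dotProduct_comm] at hu
    rw [add_dotProduct, smul_dotProduct, smul_eq_mul] at hle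
    nlinarith
  rw [hf] at hfx
  have hpos : 0 < G x ⬝ᵥ h - u := by linarith
  have := hbound ((|M + C - φ x| + 1) / (G x ⬝ᵥ h - u)) (by positivity)
  rw [div_mul_cancel₀ _ hpos.ne'] at this
  linarith [le_abs_self (M + C - φ x)]

theorem tendsto_sub_dotProduct_cocompact (hP : IsPotential K φ G A) {y : ι → ℝ}
    (hy : y ∈ interior K) : Tendsto (fun x => φ x - x ⬝ᵥ y) (cocompact (ι → ℝ)) atTop := by
  obtain ⟨ε, hε, hball⟩ := Metric.isOpen_iff.1 isOpen_interior y hy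
  obtain ⟨C, hC⟩ := hP.lower
  have hbound : ∀ x : ι → ℝ, ε / 2 * ‖x‖ + -C ≤ φ x - x ⬝ᵥ y := by
    intro x
    obtain ⟨e, he, hxe⟩ := exists_norm_le_dotProduct x
    have hmem : y + (ε / 2) • e ∈ K := by
      refine interior_subset (hball ?_)
      rw [mem_ball_iff_norm, add_sub_cancel_left, norm_smul, Real.norm_of_nonneg (by positivity)]
      nlinarith
    have := hC x _ hmem
    rw [dotProduct_add, dotProduct_smul, smul_eq_mul] at this
    nlinarith
  exact tendsto_atTop_mono hbound (tendsto_atTop_add_const_right _ _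
    ((tendsto_norm_cocompact_atTop (E := ι → ℝ)).const_mul_atTop (half_pos hε)))

theorem interior_subset_range (hP : IsPotential K φ G A) : interior K ⊆ range G := by
  intro y hy
  have hd : ∀ x, HasFDerivAt (fun x => φ x - x ⬝ᵥ y) (dotCLM (G x) - dotCLM y) x := by
    simp_rw [dotProduct_comm _ y, ← dotCLM_apply]
    exact fun x => (hP.hasFDerivAt x).sub (dotCLM y).hasFDerivAt
  have hcont : Continuous fun x => φ x - x ⬝ᵥ y :=
    continuous_iff_continuousAt.2 fun x => (hd x).continuousAt
  obtain ⟨x, hx⟩ := hcont.exists_forall_le (hP.tendsto_sub_dotProduct_cocompact hy)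
  have hzero := IsLocalMin.hasFDerivAt_eq_zero (.of_forall hx) (hd x)
  refine ⟨x, funext fun i => ?_⟩
  simpa [sub_eq_zero] using congrArg (fun f => f (Pi.single i 1)) hzero

theorem injOn_grad (hP : IsPotential K φ G A) : Set.InjOn G {x | (A x).det ≠ 0} := by
  intro x hx x' _ hxx
  set h := x' - x with hh
  have hmono := hP.monotone_grad_line x h
  have hends : G (x + (1 : ℝ) • h) ⬝ᵥ h = G x ⬝ᵥ h := by simp [hh, hxx]
  have hconst : ∀ s ∈ Icc (0 : ℝ) 1, G (x + s • h) ⬝ᵥ h = G x ⬝ᵥ h := fun s hs =>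
    le_antisymm ((hmono hs.2).trans hends.le) (by simpa using hmono hs.1)
  have hd := (hP.hasDerivAt_grad_line x h 0).hasDerivWithinAt (s := Icc (0 : ℝ) 1)
  have hd' : HasDerivWithinAt (fun s : ℝ => G (x + s • h) ⬝ᵥ h) 0 (Icc (0 : ℝ) 1) 0 :=
    (hasDerivWithinAt_const (0 : ℝ) _ (G x ⬝ᵥ h)).congr hconst (hconst 0 (by simp))
  have hquad := (uniqueDiffOn_Icc zero_lt_one 0 (by simp)).eq_deriv _ hd hd'
  rw [zero_smul, add_zero, dotProduct_comm] at hquad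
  have hker : (A x).mulVec h = 0 :=
    ((hP.posSemidef x).dotProduct_mulVec_zero_iff h).1 (by simpa using hquad)
  exact (sub_eq_zero.1 (Matrix.eq_zero_of_mulVec_eq_zero hx hker)).symm

theorem det_nonneg (hP : IsPotential K φ G A) (x : ι → ℝ) : 0 ≤ (A x).det :=
  (hP.posSemidef x).det_nonneg

theorem continuous_det (hP : IsPotential K φ G A) : Continuous fun x => (A x).det :=
  hP.continuous_hess.matrix_det

theorem lintegral_det_eq_volume_image (hP : IsPotential K φ G A) :
    ∫⁻ x, ENNReal.ofReal (A x).det = volume (G '' {x | (A x).det ≠ 0}) := by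
  have hU : MeasurableSet {x | (A x).det ≠ 0} :=
    (measurableSet_eq_fun hP.continuous_det.measurable measurable_const).compl
  rw [← lintegral_abs_det_fderiv_eq_addHaar_image volume hU
    (fun x _ => (hP.hasFDerivAt_grad x).hasFDerivWithinAt) hP.injOn_grad, ← lintegral_indicator hU]
  refine lintegral_congr fun x => ?_
  by_cases hx : (A x).det = 0 <;> simp [hx, abs_of_nonneg (hP.det_nonneg x)]

/-- The gradient maps onto the interior of `K` up to the null set of its critical values. -/
theorem volume_eq (hP : IsPotential K φ G A) :
    volume K = ∫⁻ x, ENNReal.ofReal (A x).det := by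
  rw [hP.lintegral_det_eq_volume_image]
  set U : Set (ι → ℝ) := {x | (A x).det ≠ 0}
  have hsard : volume (G '' Uᶜ) = 0 :=
    addHaar_image_eq_zero_of_det_fderivWithin_eq_zero volume
      (fun x _ => (hP.hasFDerivAt_grad x).hasFDerivWithinAt) fun x hx => by simpa [U] using hx
  refine le_antisymm ?_ (measure_mono (image_subset_iff.2 fun x _ => hP.grad_mem x))
  calc volume K ≤ volume (interior K ∪ frontier K) := by
        rw [← closure_eq_interior_union_frontier]
        exact measure_mono subset_closure
    _ ≤ volume (interior K) + volume (frontier K) := measure_union_le _ _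
    _ = volume (interior K) := by rw [hP.convex.addHaar_frontier volume, add_zero]
    _ ≤ volume (G '' U ∪ G '' Uᶜ) := by
        rw [← image_union, union_compl_self, image_univ]
        exact measure_mono hP.interior_subset_range
    _ ≤ volume (G '' U) + volume (G '' Uᶜ) := measure_union_le _ _
    _ = volume (G '' U) := by rw [hsard, add_zero]

theorem add (hP : IsPotential K φ G A) {K' : Set (ι → ℝ)} {φ' : (ι → ℝ) → ℝ}
    {G' : (ι → ℝ) → ι → ℝ} {A' : (ι → ℝ) → Matrix ι ι ℝ} (hP' : IsPotential K' φ' G' A') :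
    IsPotential (K + K') (φ + φ') (G + G') (A + A') where
  hasFDerivAt x := ((hP.hasFDerivAt x).add (hP'.hasFDerivAt x)).congr_fderiv (by ext h; simp)
  hasFDerivAt_grad x := ((hP.hasFDerivAt_grad x).add (hP'.hasFDerivAt_grad x)).congr_fderiv
    (by ext h; simp [Matrix.add_mulVec])
  continuous_hess := hP.continuous_hess.add hP'.continuous_hess
  posSemidef x := (hP.posSemidef x).add (hP'.posSemidef x)
  isCompact := hP.isCompact.add hP'.isCompact
  convex := hP.convex.add hP'.convex
  lower := by
    obtain ⟨C, hC⟩ := hP.lower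
    obtain ⟨C', hC'⟩ := hP'.lower
    refine ⟨C + C', ?_⟩
    rintro x _ ⟨y, hy, y', hy', rfl⟩
    have := hC x y hy
    have := hC' x y' hy'
    simp only [dotProduct_add, Pi.add_apply]
    linarith
  upper := by
    obtain ⟨C, hC⟩ := hP.upper
    obtain ⟨C', hC'⟩ := hP'.upper
    refine ⟨C + C', fun x => ?_⟩
    obtain ⟨y, hy, h⟩ := hC x
    obtain ⟨y', hy', h'⟩ := hC' x
    refine ⟨y + y', add_mem_add hy hy', ?_⟩
    simp only [dotProduct_add, Pi.add_apply]
    linarith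

theorem zero : IsPotential (0 : Set (ι → ℝ)) 0 0 0 where
  hasFDerivAt x := (hasFDerivAt_const (0 : ℝ) x).congr_fderiv (by ext h; simp)
  hasFDerivAt_grad x := (hasFDerivAt_const (0 : ι → ℝ) x).congr_fderiv (by ext h; simp)
  continuous_hess := continuous_const
  posSemidef _ := Matrix.PosSemidef.zero
  isCompact := isCompact_singleton
  convex := convex_singleton 0
  lower := ⟨0, by simp⟩
  upper := ⟨0, by simp⟩

theorem sum {α : Type*} (S : Finset α) {K : α → Set (ι → ℝ)} {φ : α → (ι → ℝ) → ℝ}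
    {G : α → (ι → ℝ) → ι → ℝ} {A : α → (ι → ℝ) → Matrix ι ι ℝ}
    (h : ∀ a, IsPotential (K a) (φ a) (G a) (A a)) :
    IsPotential (∑ a ∈ S, K a) (∑ a ∈ S, φ a) (∑ a ∈ S, G a) (∑ a ∈ S, A a) := by
  classical
  induction S using Finset.induction_on with
  | empty => simpa using zero
  | insert a S ha ih =>
    simp only [Finset.sum_insert ha]
    exact (h a).add ih

end IsPotential


/-- `K` is compact and convex and its support function is approximated by a smooth potential. -/
def HasPotential (K : Set (ι → ℝ)) : Prop :=
  ∃ φ G A, IsPotential K φ G A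

theorem HasPotential.isCompact {K : Set (ι → ℝ)} (hK : HasPotential K) : IsCompact K :=
  let ⟨_, _, _, hP⟩ := hK
  hP.isCompact

theorem HasPotential.convex {K : Set (ι → ℝ)} (hK : HasPotential K) : Convex ℝ K :=
  let ⟨_, _, _, hP⟩ := hK
  hP.convex

end

/-! ### Mixed discriminants and mixed volumes -/

section

variable {ι : Type*} [Fintype ι] [DecidableEq ι]

/-- The polarized determinant, `n!` times the mixed discriminant. -/
def polarDet (A : ι → Matrix ι ι ℝ) : ℝ :=
  ∑ σ : Equiv.Perm ι, (Matrix.of fun r => A (σ r) r).det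

theorem sum_neg_one_pow_card_compl_of_forall_mem (f : ι → ι) :
    (∑ S : Finset ι, if ∀ k, f k ∈ S then (-1 : ℝ) ^ (Fintype.card ι - S.card) else 0)
      = if Function.Surjective f then 1 else 0 := by
  let a : ι → ℝ := fun i => if i ∈ range f then 1 else 0
  have hprod : ∀ S : Finset ι, (∏ _i ∈ S, 1) * ∏ i ∈ Sᶜ, -(1 - a i)
      = if ∀ k, f k ∈ S then (-1 : ℝ) ^ (Fintype.card ι - S.card) else 0 := by
    intro S
    split_ifs with h
    · have ha : ∀ i ∈ Sᶜ, -(1 - a i) = -1 := fun i hi => by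
        have : i ∉ range f := by
          rintro ⟨k, rfl⟩
          exact Finset.mem_compl.1 hi (h k)
        rw [show a i = 0 from if_neg this, sub_zero]
      rw [Finset.prod_congr rfl ha, Finset.prod_const_one, one_mul, Finset.prod_const,
        Finset.card_compl]
    · push Not at h
      obtain ⟨k, hk⟩ := h
      rw [Finset.prod_eq_zero (Finset.mem_compl.2 hk) (by simp [a]), mul_zero]
  simp_rw [← hprod, ← Fintype.prod_add]
  split_ifs with h
  · exact Finset.prod_eq_one fun i _ => by simp [a, h.range_eq]
  · obtain ⟨i, hi⟩ := not_forall.1 h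
    exact Finset.prod_eq_zero (Finset.mem_univ i) (by simpa [a] using hi)

theorem det_sum_eq_sum_det_rows (A : ι → Matrix ι ι ℝ) (S : Finset ι) :
    (∑ i ∈ S, A i).det
      = ∑ f : ι → ι, if ∀ k, f k ∈ S then (Matrix.of fun r => A (f r) r).det else 0 := by
  have hrows : ∑ i ∈ S, A i = fun r => ∑ i ∈ S, A i r := by ext r c; simp [Matrix.sum_apply]
  rw [hrows, ← Finset.sum_filter]
  refine (Matrix.detRowAlternating.toMultilinearMap.map_sum_finset
    (fun r i => A i r) fun _ => S).trans (Finset.sum_congr ?_ fun _ _ => rfl)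
  ext f
  simp [Fintype.mem_piFinset]

theorem sum_ite_surjective_eq_sum_perm (F : (ι → ι) → ℝ) :
    (∑ f : ι → ι, if Function.Surjective f then F f else 0) = ∑ σ : Equiv.Perm ι, F ⇑σ := by
  rw [← Finset.sum_filter]
  refine (Finset.sum_bij (fun (σ : Equiv.Perm ι) _ => ⇑σ) (fun σ _ => by simp [σ.surjective])
    (fun _ _ _ _ h => DFunLike.coe_injective h) (fun f hf => ?_) fun _ _ => rfl).symm
  have hbij := Finite.surjective_iff_bijective.1 (Finset.mem_filter.1 hf).2
  exact ⟨Equiv.ofBijective f hbij, Finset.mem_univ _, rfl⟩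

theorem polarDet_eq_sum (A : ι → Matrix ι ι ℝ) :
    ∑ S : Finset ι, (-1 : ℝ) ^ (Fintype.card ι - S.card) * (∑ i ∈ S, A i).det = polarDet A := by
  simp_rw [det_sum_eq_sum_det_rows, Finset.mul_sum]
  rw [Finset.sum_comm, polarDet,
    ← sum_ite_surjective_eq_sum_perm fun f => (Matrix.of fun r => A (f r) r).det]
  refine Finset.sum_congr rfl fun f _ => ?_
  simpa only [Finset.sum_mul, ite_mul, one_mul, zero_mul, mul_ite, mul_zero] using
    congrArg (· * (Matrix.of fun r => A (f r) r).det) (sum_neg_one_pow_card_compl_of_forall_mem f)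

theorem rows_update_perm {m : Type*} [DecidableEq m] (A : m → Matrix m m ℝ) (i : m)
    (B : Matrix m m ℝ) (σ : Equiv.Perm m) :
    (Matrix.of fun r => Function.update A i B (σ r) r)
      = (Matrix.of fun r => A (σ r) r).updateRow (σ.symm i) (B (σ.symm i)) := by
  ext r c
  rcases eq_or_ne r (σ.symm i) with rfl | hr
  · simp
  · have : σ r ≠ i := fun h => hr (by simp [← h])
    simp [hr, this]

theorem polarDet_update_add (A : ι → Matrix ι ι ℝ) (i : ι) (B B' : Matrix ι ι ℝ) :
    polarDet (Function.update A i (B + B'))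
      = polarDet (Function.update A i B) + polarDet (Function.update A i B') := by
  simp only [polarDet, rows_update_perm, ← Finset.sum_add_distrib]
  exact Finset.sum_congr rfl fun σ _ => Matrix.det_updateRow_add _ _ _ _

theorem det_rows_transpose_mul_self (B : ι → Matrix ι ι ℝ) (σ : Equiv.Perm ι) :
    (Matrix.of fun r => ((B (σ r)).transpose * B (σ r)) r).det
      = ∑ g : ι → ι, (σ.sign * ∏ r, (Matrix.of fun i => B i (g i)) (σ r) r) *
          (Matrix.of fun i => B i (g i)).det := by
  have hrows : (Matrix.of fun r => ((B (σ r)).transpose * B (σ r)) r)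
      = fun r => ∑ k, B (σ r) k r • B (σ r) k := by
    ext r c
    simp [Matrix.mul_apply]
  rw [hrows]
  refine (Matrix.detRowAlternating.toMultilinearMap.map_sum
    fun r k => B (σ r) k r • B (σ r) k).trans ?_
  refine (Fintype.sum_equiv (Equiv.arrowCongr σ (Equiv.refl ι)).symm _ _ fun g => ?_).symm
  refine Eq.trans ?_ (Matrix.detRowAlternating.toMultilinearMap.map_smul_univ
    (fun r => B (σ r) (g (σ r)) r) fun r => B (σ r) (g (σ r))).symm
  rw [mul_right_comm, smul_eq_mul, mul_comm]
  exact congrArg _ (Matrix.det_permute σ (Matrix.of fun i => B i (g i))).symm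

theorem polarDet_transpose_mul_self (B : ι → Matrix ι ι ℝ) :
    polarDet (fun i => (B i).transpose * B i)
      = ∑ g : ι → ι, (Matrix.of fun i => B i (g i)).det * (Matrix.of fun i => B i (g i)).det := by
  simp_rw [polarDet, det_rows_transpose_mul_self]
  rw [Finset.sum_comm]
  exact Finset.sum_congr rfl fun g _ => by rw [← Finset.sum_mul, ← Matrix.det_apply']

open scoped MatrixOrder Matrix.Norms.L2Operator in
theorem exists_eq_transpose_mul_self {m : Type*} [Fintype m] {A : Matrix m m ℝ}
    (hA : A.PosSemidef) : ∃ B : Matrix m m ℝ, A = B.transpose * B := by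
  classical
  obtain ⟨B, hB⟩ := CStarAlgebra.nonneg_iff_eq_star_mul_self.mp hA.nonneg
  exact ⟨B, by rw [hB, Matrix.star_eq_conjTranspose, Matrix.conjTranspose_eq_transpose_of_trivial]⟩

theorem polarDet_nonneg {A : ι → Matrix ι ι ℝ} (hA : ∀ i, (A i).PosSemidef) : 0 ≤ polarDet A := by
  choose B hB using fun i => exists_eq_transpose_mul_self (hA i)
  rw [funext hB, polarDet_transpose_mul_self]
  exact Finset.sum_nonneg fun g _ => mul_self_nonneg _

theorem continuous_polarDet : Continuous (polarDet : (ι → Matrix ι ι ℝ) → ℝ) :=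
  continuous_finsetSum _ fun σ _ => Continuous.matrix_det
    (A := fun (A : ι → Matrix ι ι ℝ) r => A (σ r) r)
    (continuous_pi fun r => (continuous_apply r).comp (continuous_apply (σ r)))

/-- The polarized volume, `n!` times the mixed volume of `n` convex bodies. -/
def polarVol (K : ι → Set (ι → ℝ)) : ℝ :=
  ∑ S : Finset ι, (-1 : ℝ) ^ (Fintype.card ι - S.card) * volume.real (∑ i ∈ S, K i)

section Potentials

variable {K : ι → Set (ι → ℝ)} {φ : ι → (ι → ℝ) → ℝ} {G : ι → (ι → ℝ) → ι → ℝ}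
  {A : ι → (ι → ℝ) → Matrix ι ι ℝ}

theorem IsPotential.integrable_det {K : Set (ι → ℝ)} {φ : (ι → ℝ) → ℝ} {G : (ι → ℝ) → ι → ℝ}
    {A : (ι → ℝ) → Matrix ι ι ℝ} (hP : IsPotential K φ G A) : Integrable fun x => (A x).det := by
  refine ⟨hP.continuous_det.aestronglyMeasurable, ?_⟩
  rw [hasFiniteIntegral_iff_ofReal (.of_forall hP.det_nonneg), ← hP.volume_eq]
  exact hP.isCompact.measure_lt_top

theorem IsPotential.volume_real_eq {K : Set (ι → ℝ)} {φ : (ι → ℝ) → ℝ} {G : (ι → ℝ) → ι → ℝ}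
    {A : (ι → ℝ) → Matrix ι ι ℝ} (hP : IsPotential K φ G A) :
    volume.real K = ∫ x, (A x).det := by
  rw [integral_eq_lintegral_of_nonneg_ae (.of_forall hP.det_nonneg)
    hP.continuous_det.aestronglyMeasurable, ← hP.volume_eq, Measure.real]

theorem integrable_polarDet (hP : ∀ i, IsPotential (K i) (φ i) (G i) (A i)) :
    Integrable fun x => polarDet fun i => A i x := by
  simp_rw [← polarDet_eq_sum, ← Finset.sum_apply]
  exact integrable_finsetSum _ fun S _ => (IsPotential.sum S hP).integrable_det.const_mul _

theorem polarVol_eq_integral (hP : ∀ i, IsPotential (K i) (φ i) (G i) (A i)) :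
    polarVol K = ∫ x, polarDet fun i => A i x := by
  simp_rw [← polarDet_eq_sum, ← Finset.sum_apply]
  rw [integral_finsetSum _ fun S _ => (IsPotential.sum S hP).integrable_det.const_mul _, polarVol]
  exact Finset.sum_congr rfl fun S _ => by
    rw [integral_const_mul, (IsPotential.sum S hP).volume_real_eq]

theorem polarVol_nonneg (hP : ∀ i, IsPotential (K i) (φ i) (G i) (A i)) : 0 ≤ polarVol K := by
  rw [polarVol_eq_integral hP]
  exact integral_nonneg fun x => polarDet_nonneg fun i => (hP i).posSemidef x

theorem ofReal_polarVol_eq_lintegral (hP : ∀ i, IsPotential (K i) (φ i) (G i) (A i)) :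
    ENNReal.ofReal (polarVol K) = ∫⁻ x, ENNReal.ofReal (polarDet fun i => A i x) := by
  rw [polarVol_eq_integral hP, ofReal_integral_eq_lintegral_ofReal (integrable_polarDet hP)
    (.of_forall fun x => polarDet_nonneg fun i => (hP i).posSemidef x)]

theorem IsPotential.update (hP : ∀ i, IsPotential (K i) (φ i) (G i) (A i)) (i : ι)
    {L : Set (ι → ℝ)} {ψ : (ι → ℝ) → ℝ} {H : (ι → ℝ) → ι → ℝ} {B : (ι → ℝ) → Matrix ι ι ℝ}
    (hL : IsPotential L ψ H B) (j : ι) :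
    IsPotential (Function.update K i L j) (Function.update φ i ψ j) (Function.update G i H j)
      (Function.update A i B j) := by
  rcases eq_or_ne j i with rfl | h
  · simpa using hL
  · simpa [h] using hP j

theorem polarVol_update_add (hK : ∀ i, HasPotential (K i)) (i : ι) {L L' : Set (ι → ℝ)}
    (hL : HasPotential L) (hL' : HasPotential L') :
    polarVol (Function.update K i (L + L'))
      = polarVol (Function.update K i L) + polarVol (Function.update K i L') := by
  choose φ G A hP using hK
  obtain ⟨ψ, H, B, hL⟩ := hL
  obtain ⟨ψ', H', B', hL'⟩ := hL'
  have hU := IsPotential.update hP i hL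
  have hU' := IsPotential.update hP i hL'
  rw [polarVol_eq_integral hU, polarVol_eq_integral hU',
    polarVol_eq_integral (IsPotential.update hP i (hL.add hL')),
    ← integral_add (integrable_polarDet hU) (integrable_polarDet hU')]
  have hpoint : ∀ (C : (ι → ℝ) → Matrix ι ι ℝ) (x : ι → ℝ),
      (fun j => Function.update A i C j x) = Function.update (fun j => A j x) i (C x) :=
    fun C x => funext fun j => Function.apply_update (fun _ M => M x) A i C j
  simp only [hpoint, Pi.add_apply, polarDet_update_add]

theorem polarVol_le_of_tendsto_hess {L : ι → Set (ι → ℝ)}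
    (hP : ∀ i, IsPotential (K i) (φ i) (G i) (A i)) {ψ : ℕ → ι → (ι → ℝ) → ℝ}
    {H : ℕ → ι → (ι → ℝ) → ι → ℝ} {B : ℕ → ι → (ι → ℝ) → Matrix ι ι ℝ}
    (hL : ∀ n i, IsPotential (L i) (ψ n i) (H n i) (B n i))
    (hlim : ∀ i x, Tendsto (fun n => B n i x) atTop (𝓝 (A i x))) :
    polarVol K ≤ polarVol L := by
  rw [← ENNReal.ofReal_le_ofReal_iff (polarVol_nonneg (hL 0)), ofReal_polarVol_eq_lintegral hP]
  have hpt : ∀ x, Tendsto (fun n => ENNReal.ofReal (polarDet fun i => B n i x)) atTop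
      (𝓝 (ENNReal.ofReal (polarDet fun i => A i x))) := fun x =>
    ((ENNReal.continuous_ofReal.comp continuous_polarDet).tendsto _).comp
      (tendsto_pi_nhds.2 fun i => hlim i x)
  calc ∫⁻ x, ENNReal.ofReal (polarDet fun i => A i x)
      = ∫⁻ x, liminf (fun n => ENNReal.ofReal (polarDet fun i => B n i x)) atTop :=
        lintegral_congr fun x => (hpt x).liminf_eq.symm
    _ ≤ liminf (fun n => ∫⁻ x, ENNReal.ofReal (polarDet fun i => B n i x)) atTop :=
        lintegral_liminf_le fun n => (ENNReal.continuous_ofReal.comp (continuous_polarDet.comp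
          (continuous_pi fun i => (hL n i).continuous_hess))).measurable
    _ = ENNReal.ofReal (polarVol L) := by
        simp_rw [← fun n => ofReal_polarVol_eq_lintegral (hL n), liminf_const]

end Potentials

end

/-! ### Softmax potentials of polytopes -/

section

variable {ι τ : Type*} [Fintype ι] [Fintype τ]

/-- The partition function `∑ wₖ exp ⟨pₖ, x⟩` of weighted points. -/
def softSum (w : τ → ℝ) (p : τ → ι → ℝ) (x : ι → ℝ) : ℝ :=
  ∑ k, w k * Real.exp (p k ⬝ᵥ x)

/-- The softmax potential `log ∑ wₖ exp ⟨pₖ, x⟩` of the convex hull of the points of positive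
weight. -/
def softPot (w : τ → ℝ) (p : τ → ι → ℝ) (x : ι → ℝ) : ℝ :=
  Real.log (softSum w p x)

/-- The Gibbs weight of the point `pₖ`, its coefficient in the gradient of `softPot`. -/
def softWeight (w : τ → ℝ) (p : τ → ι → ℝ) (k : τ) (x : ι → ℝ) : ℝ :=
  w k * Real.exp (p k ⬝ᵥ x - softPot w p x)

/-- The gradient of `softPot`, the Gibbs mean of the points. -/
def softGrad (w : τ → ℝ) (p : τ → ι → ℝ) (x : ι → ℝ) : ι → ℝ :=
  ∑ k, softWeight w p k x • p k

/-- The Hessian of `softPot`, the Gibbs covariance of the points. -/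
def softHess (w : τ → ℝ) (p : τ → ι → ℝ) (x : ι → ℝ) : Matrix ι ι ℝ :=
  ∑ k, softWeight w p k x • Matrix.vecMulVec (p k - softGrad w p x) (p k - softGrad w p x)

theorem hasFDerivAt_dotProduct (a x : ι → ℝ) : HasFDerivAt (fun x => a ⬝ᵥ x) (dotCLM a) x := by
  simp_rw [← dotCLM_apply]
  exact (dotCLM a).hasFDerivAt

theorem continuous_dotProduct_right (a : ι → ℝ) : Continuous fun x => a ⬝ᵥ x := by
  simp_rw [← dotCLM_apply]
  exact (dotCLM a).continuous

section Softmax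

variable {w : τ → ℝ} (p : τ → ι → ℝ)

theorem softSum_pos (hw : 0 < w) (x : ι → ℝ) : 0 < softSum w p x := by
  obtain ⟨hnn, k, hk⟩ := Pi.lt_def.1 hw
  exact Finset.sum_pos' (fun k _ => mul_nonneg (hnn k) (Real.exp_pos _).le)
    ⟨k, Finset.mem_univ k, mul_pos hk (Real.exp_pos _)⟩

theorem softWeight_nonneg (hw : 0 ≤ w) (k : τ) (x : ι → ℝ) : 0 ≤ softWeight w p k x :=
  mul_nonneg (hw k) (Real.exp_pos _).le

theorem softWeight_eq (hw : 0 < w) (k : τ) (x : ι → ℝ) :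
    softWeight w p k x = (softSum w p x)⁻¹ * (w k * Real.exp (p k ⬝ᵥ x)) := by
  rw [softWeight, softPot, Real.exp_sub, Real.exp_log (softSum_pos p hw x)]
  field_simp

theorem sum_softWeight (hw : 0 < w) (x : ι → ℝ) : ∑ k, softWeight w p k x = 1 := by
  simp_rw [softWeight_eq p hw]
  rw [← Finset.mul_sum]
  exact inv_mul_cancel₀ (softSum_pos p hw x).ne'

theorem sum_softWeight_mul_sub_dotProduct (hw : 0 < w) (x h : ι → ℝ) :
    ∑ k, softWeight w p k x * ((p k - softGrad w p x) ⬝ᵥ h) = 0 := by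
  simp only [sub_dotProduct, mul_sub, Finset.sum_sub_distrib, ← Finset.sum_mul]
  rw [sum_softWeight p hw, one_mul, softGrad, sum_dotProduct]
  simp [smul_dotProduct]

theorem softHess_mulVec (x h : ι → ℝ) : (softHess w p x).mulVec h
    = ∑ k, (softWeight w p k x * ((p k - softGrad w p x) ⬝ᵥ h)) • (p k - softGrad w p x) := by
  rw [softHess, Matrix.sum_mulVec]
  refine Finset.sum_congr rfl fun k _ => ?_
  rw [Matrix.smul_mulVec, Matrix.vecMulVec_mulVec, op_smul_eq_smul, smul_smul]

theorem posSemidef_softHess (hw : 0 ≤ w) (x : ι → ℝ) : (softHess w p x).PosSemidef :=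
  Matrix.posSemidef_sum _ fun k _ => Matrix.PosSemidef.smul
    (by simpa using Matrix.posSemidef_vecMulVec_self_star (p k - softGrad w p x))
    (softWeight_nonneg p hw k x)

theorem hasFDerivAt_softPot (hw : 0 < w) (x : ι → ℝ) :
    HasFDerivAt (softPot w p) (dotCLM (softGrad w p x)) x := by
  have hsum : HasFDerivAt (softSum w p) (∑ k, w k • Real.exp (p k ⬝ᵥ x) • dotCLM (p k)) x :=
    HasFDerivAt.fun_sum fun k _ => (hasFDerivAt_dotProduct (p k) x).exp.const_mul _
  refine (hsum.log (softSum_pos p hw x).ne').congr_fderiv ?_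
  ext1 h
  simp only [softGrad, softWeight_eq p hw, dotCLM_apply, sum_dotProduct, smul_dotProduct,
    smul_apply, sum_apply, smul_eq_mul, Finset.mul_sum]
  exact Finset.sum_congr rfl fun k _ => by ring

theorem hasFDerivAt_softWeight (hw : 0 < w) (k : τ) (x : ι → ℝ) :
    HasFDerivAt (softWeight w p k) (softWeight w p k x • dotCLM (p k - softGrad w p x)) x := by
  refine (((hasFDerivAt_dotProduct (p k) x).sub
    (hasFDerivAt_softPot p hw x)).exp.const_mul (w k)).congr_fderiv ?_
  ext1 h
  simp [softWeight, sub_dotProduct, mul_assoc]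

theorem hasFDerivAt_softGrad [DecidableEq ι] (hw : 0 < w) (x : ι → ℝ) :
    HasFDerivAt (softGrad w p) (matCLM (softHess w p x)) x := by
  have hsum : HasFDerivAt (softGrad w p) (∑ k, (softWeight w p k x •
      dotCLM (p k - softGrad w p x)).smulRight (p k)) x :=
    HasFDerivAt.fun_sum fun k _ => (hasFDerivAt_softWeight p hw k x).smul_const (p k)
  refine hsum.congr_fderiv ?_
  ext1 h
  rw [matCLM_apply, softHess_mulVec]
  simp only [smul_sub, Finset.sum_sub_distrib, ← Finset.sum_smul,
    sum_softWeight_mul_sub_dotProduct p hw, zero_smul, sub_zero]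
  simp [sum_apply]

theorem continuousAt_softHess (hw : 0 < w) (x : ι → ℝ) :
    ContinuousAt (fun q : (τ → ℝ) × (ι → ℝ) => softHess q.1 p q.2) (w, x) := by
  have hdot : ∀ k, Continuous fun q : (τ → ℝ) × (ι → ℝ) => p k ⬝ᵥ q.2 := fun k =>
    (continuous_dotProduct_right (p k)).comp continuous_snd
  have hw_k : ∀ k, Continuous fun q : (τ → ℝ) × (ι → ℝ) => q.1 k := fun k =>
    (continuous_apply k).comp continuous_fst
  have hsum : Continuous fun q : (τ → ℝ) × (ι → ℝ) => softSum q.1 p q.2 :=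
    continuous_finsetSum _ fun k _ => (hw_k k).mul (Real.continuous_exp.comp (hdot k))
  have hpot : ContinuousAt (fun q : (τ → ℝ) × (ι → ℝ) => softPot q.1 p q.2) (w, x) :=
    hsum.continuousAt.log (softSum_pos p hw x).ne'
  have hweight : ∀ k,
      ContinuousAt (fun q : (τ → ℝ) × (ι → ℝ) => softWeight q.1 p k q.2) (w, x) := fun k =>
    (hw_k k).continuousAt.mul
      (Real.continuous_exp.continuousAt.comp ((hdot k).continuousAt.sub hpot))
  have hgrad : ContinuousAt (fun q : (τ → ℝ) × (ι → ℝ) => softGrad q.1 p q.2) (w, x) :=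
    tendsto_finsetSum _ fun k _ => (hweight k).smul continuousAt_const
  have hsq : Continuous fun v : ι → ℝ => Matrix.vecMulVec v v :=
    continuous_id.matrix_vecMulVec continuous_id
  exact tendsto_finsetSum _ fun k _ => (hweight k).smul
    (hsq.continuousAt.comp (f := fun q : (τ → ℝ) × (ι → ℝ) => p k - softGrad q.1 p q.2)
      (continuousAt_const.sub hgrad))

theorem log_add_dotProduct_le_softPot (hw : 0 ≤ w) {k : τ} (hk : 0 < w k) (x : ι → ℝ) :
    Real.log (w k) + p k ⬝ᵥ x ≤ softPot w p x := by
  rw [← Real.log_exp (p k ⬝ᵥ x), ← Real.log_mul hk.ne' (Real.exp_pos _).ne']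
  exact Real.log_le_log (mul_pos hk (Real.exp_pos _))
    (Finset.single_le_sum (f := fun k => w k * Real.exp (p k ⬝ᵥ x))
      (fun k _ => mul_nonneg (hw k) (Real.exp_pos _).le) (Finset.mem_univ k))

theorem dotProduct_le_softPot_add (hw : 0 ≤ w) (x : ι → ℝ) {y : ι → ℝ}
    (hy : y ∈ convexHull ℝ (p '' {k | 0 < w k})) :
    x ⬝ᵥ y ≤ softPot w p x + ∑ k, |Real.log (w k)| := by
  have hconv : Convex ℝ {y | dotCLM x y ≤ softPot w p x + ∑ k, |Real.log (w k)|} :=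
    convex_halfSpace_le (dotCLM x).toLinearMap.isLinear _
  refine (dotCLM_apply x y).symm.trans_le (convexHull_min ?_ hconv hy)
  rintro _ ⟨k, hk, rfl⟩
  have hle := log_add_dotProduct_le_softPot p hw hk x
  have hlog : |Real.log (w k)| ≤ ∑ k, |Real.log (w k)| :=
    Finset.single_le_sum (f := fun k => |Real.log (w k)|) (fun _ _ => abs_nonneg _)
      (Finset.mem_univ k)
  rw [mem_ofPred_eq, dotCLM_apply, dotProduct_comm]
  linarith [neg_abs_le (Real.log (w k))]

theorem exists_softPot_le_dotProduct_add (hw : 0 < w) (x : ι → ℝ) :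
    ∃ y ∈ convexHull ℝ (p '' {k | 0 < w k}), softPot w p x ≤ x ⬝ᵥ y + Real.log (∑ k, w k) := by
  obtain ⟨hnn, k₀, hk₀⟩ := Pi.lt_def.1 hw
  obtain ⟨k, hk, hmax⟩ := (Finset.univ.filter fun k => 0 < w k).exists_max_image
    (fun k => p k ⬝ᵥ x) ⟨k₀, by simpa using hk₀⟩
  simp only [Finset.mem_filter, Finset.mem_univ, true_and] at hk hmax
  refine ⟨p k, subset_convexHull _ _ ⟨k, hk, rfl⟩, ?_⟩
  have hsum : 0 < ∑ k, w k := Finset.sum_pos' (fun k _ => hnn k) ⟨k, Finset.mem_univ k, hk⟩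
  have hle : softSum w p x ≤ (∑ k, w k) * Real.exp (p k ⬝ᵥ x) := by
    rw [softSum, Finset.sum_mul]
    refine Finset.sum_le_sum fun j _ => ?_
    rcases (hnn j).eq_or_lt with hj | hj
    · simp [← hj]
    · exact mul_le_mul_of_nonneg_left (Real.exp_le_exp.2 (hmax j hj)) (hnn j)
  have hlog := Real.log_le_log (softSum_pos p hw x) hle
  rw [Real.log_mul hsum.ne' (Real.exp_pos _).ne', Real.log_exp] at hlog
  rw [softPot, dotProduct_comm]
  linarith

theorem isPotential_softPot [DecidableEq ι] (hw : 0 < w) :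
    IsPotential (convexHull ℝ (p '' {k | 0 < w k})) (softPot w p) (softGrad w p)
      (softHess w p) where
  hasFDerivAt := hasFDerivAt_softPot p hw
  hasFDerivAt_grad := hasFDerivAt_softGrad p hw
  continuous_hess := continuous_iff_continuousAt.2 fun x =>
    (continuousAt_softHess p hw x).comp (f := fun x : ι → ℝ => (w, x)) (by fun_prop)
  posSemidef := posSemidef_softHess p hw.le
  isCompact := (toFinite _).isCompact_convexHull ℝ
  convex := convex_convexHull ℝ _
  lower := ⟨_, fun x _ hy => dotProduct_le_softPot_add p hw.le x hy⟩
  upper := ⟨_, exists_softPot_le_dotProduct_add p hw⟩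

end Softmax

section Segments

/-- The vertices `0, u, v, u + v` of a parallelogram. -/
def parallelogramVertex {E : Type*} [AddZeroClass E] (u v : E) (k : Bool × Bool) : E :=
  (if k.1 then u else 0) + (if k.2 then v else 0)

/-- The weight `1` on the vertices `0, u + v` of a parallelogram and `r` on the other two, so that
`r → 0` collapses the parallelogram to its diagonal. -/
def diagonalWeight (r : ℝ) (k : Bool × Bool) : ℝ := if k.1 = k.2 then 1 else r

theorem range_parallelogramVertex {E : Type*} [AddZeroClass E] (u v : E) :
    range (parallelogramVertex u v) = {0, u} + {0, v} := by
  ext y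
  simp only [mem_range, Prod.exists, Bool.exists_bool, parallelogramVertex, Set.mem_add,
    mem_insert_iff, mem_singleton_iff]
  constructor
  · rintro ((rfl | rfl) | (rfl | rfl)) <;> simp
  · rintro ⟨a, rfl | rfl, b, rfl | rfl, rfl⟩ <;> simp

theorem image_parallelogramVertex_diagonal {E : Type*} [AddZeroClass E] (u v : E) :
    parallelogramVertex u v '' {k | 0 < diagonalWeight 0 k} = {0, u + v} := by
  ext y
  simp only [mem_image, Prod.exists, Bool.exists_bool, parallelogramVertex, diagonalWeight,
    mem_ofPred_eq, mem_insert_iff, mem_singleton_iff]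
  simp [eq_comm]

theorem diagonalWeight_pos {r : ℝ} (hr : 0 < r) (k : Bool × Bool) : 0 < diagonalWeight r k := by
  rw [diagonalWeight]
  split_ifs
  exacts [one_pos, hr]

theorem diagonalWeight_zero_pos : 0 < diagonalWeight 0 :=
  Pi.lt_def.2 ⟨fun k => by rw [diagonalWeight]; split_ifs <;> simp,
    (true, true), by simp [diagonalWeight]⟩

theorem continuous_diagonalWeight : Continuous diagonalWeight :=
  continuous_pi fun k => continuous_const.if_const (k.1 = k.2) continuous_id

theorem tendsto_softHess_diagonalWeight (u v x : ι → ℝ) :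
    Tendsto (fun n : ℕ => softHess (diagonalWeight (1 / ((n : ℝ) + 1)))
      (parallelogramVertex u v) x) atTop
      (𝓝 (softHess (diagonalWeight 0) (parallelogramVertex u v) x)) := by
  have hw : Tendsto (fun n : ℕ => diagonalWeight (1 / ((n : ℝ) + 1))) atTop
      (𝓝 (diagonalWeight 0)) :=
    (continuous_diagonalWeight.tendsto 0).comp tendsto_one_div_add_atTop_nhds_zero_nat
  exact Tendsto.comp (f := fun n : ℕ => (diagonalWeight (1 / ((n : ℝ) + 1)), x))
    (continuousAt_softHess (parallelogramVertex u v) diagonalWeight_zero_pos x).tendsto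
    (hw.prodMk_nhds tendsto_const_nhds)

variable [DecidableEq ι]

theorem hasPotential_convexHull {s : Set (ι → ℝ)} (hs : s.Finite) (hne : s.Nonempty) :
    HasPotential (convexHull ℝ s) := by
  have := hs.fintype
  have := hne.to_subtype
  have hP := isPotential_softPot (w := fun _ : s => (1 : ℝ)) (fun y => (y : ι → ℝ))
    (Pi.lt_def.2 ⟨fun _ => zero_le_one, Classical.arbitrary s, one_pos⟩)
  simp only [zero_lt_one, ofPred_true, image_univ, Subtype.range_coe] at hP
  exact ⟨_, _, _, hP⟩

theorem hasPotential_segment (u v : ι → ℝ) : HasPotential (segment ℝ u v) := by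
  rw [← convexHull_pair]
  exact hasPotential_convexHull (toFinite _) (insert_nonempty _ _)

theorem isPotential_segment_add (u v : ι → ℝ) {r : ℝ} (hr : 0 < r) :
    IsPotential (segment ℝ 0 u + segment ℝ 0 v)
      (softPot (diagonalWeight r) (parallelogramVertex u v))
      (softGrad (diagonalWeight r) (parallelogramVertex u v))
      (softHess (diagonalWeight r) (parallelogramVertex u v)) := by
  have hw := diagonalWeight_pos hr
  have h := isPotential_softPot (parallelogramVertex u v)
    (Pi.lt_def.2 ⟨fun k => (hw k).le, (true, true), hw _⟩)
  rwa [eq_univ_of_forall (s := {k | 0 < diagonalWeight r k}) hw, image_univ,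
    range_parallelogramVertex, convexHull_add, convexHull_pair, convexHull_pair] at h

theorem isPotential_segment_diagonal (u v : ι → ℝ) :
    IsPotential (segment ℝ 0 (u + v))
      (softPot (diagonalWeight 0) (parallelogramVertex u v))
      (softGrad (diagonalWeight 0) (parallelogramVertex u v))
      (softHess (diagonalWeight 0) (parallelogramVertex u v)) := by
  have h := isPotential_softPot (parallelogramVertex u v) diagonalWeight_zero_pos
  rwa [image_parallelogramVertex_diagonal, convexHull_pair] at h

/-- The mixed volume is additive in the segments, and the diagonal of a parallelogram carries a
limit of potentials of the parallelogram. -/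
theorem polarVol_update_segment_le {K : ι → Set (ι → ℝ)} (hK : ∀ i, HasPotential (K i)) (i : ι)
    (u v : ι → ℝ) :
    polarVol (Function.update K i (segment ℝ 0 (u + v)))
      ≤ polarVol (Function.update K i (segment ℝ 0 u))
        + polarVol (Function.update K i (segment ℝ 0 v)) := by
  rw [← polarVol_update_add hK i (hasPotential_segment 0 u) (hasPotential_segment 0 v)]
  choose φ G A hP using hK
  refine polarVol_le_of_tendsto_hess
    (IsPotential.update hP i (isPotential_segment_diagonal u v))
    (fun n => IsPotential.update hP i
      (isPotential_segment_add u v (Nat.one_div_pos_of_nat (n := n)))) fun j x => ?_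
  rcases eq_or_ne j i with rfl | h
  · simpa using tendsto_softHess_diagonalWeight u v x
  · simp [h]

end Segments

end

/-! ### Shadows -/

section

theorem isCompact_finsetSum {α E : Type*} [AddCommMonoid E] [TopologicalSpace E] [ContinuousAdd E]
    (S : Finset α) {K : α → Set E} (h : ∀ a ∈ S, IsCompact (K a)) : IsCompact (∑ a ∈ S, K a) :=
  Finset.sum_induction K IsCompact (fun _ _ => IsCompact.add) isCompact_singleton h

theorem isCompact_segment {E : Type*} [AddCommGroup E] [Module ℝ E] [TopologicalSpace E]
    [ContinuousAdd E] [ContinuousSMul ℝ E] (x y : E) : IsCompact (segment ℝ x y) := by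
  rw [segment_eq_image]
  exact isCompact_Icc.image (by fun_prop)

theorem segment_zero_smul_eq_image {E : Type*} [AddCommGroup E] [Module ℝ E] {a : ℝ} (ha : 0 ≤ a)
    (v : E) : segment ℝ 0 (a • v) = (fun t : ℝ => t • v) '' Icc 0 a := by
  have h := image_segment ℝ ((LinearMap.toSpanSingleton ℝ E v).toAffineMap) 0 a
  simpa [segment_eq_Icc ha] using h.symm

variable {n : ℕ}

/-- The direction `(1, -w)` of the lines that `shadow w` contracts to points. -/
def shadowDir (w : Fin n → ℝ) : Fin (n + 1) → ℝ :=
  Fin.cons 1 (-w)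

/-- The projection of `ℝⁿ⁺¹` onto the last `n` coordinates that sends `(1, 0)` to `w`. -/
def shadow (w : Fin n → ℝ) : (Fin (n + 1) → ℝ) →L[ℝ] (Fin n → ℝ) :=
  ContinuousLinearMap.pi fun i =>
    ContinuousLinearMap.proj i.succ + w i • ContinuousLinearMap.proj 0

theorem shadow_apply (w : Fin n → ℝ) (z : Fin (n + 1) → ℝ) (i : Fin n) :
    shadow w z i = z i.succ + w i * z 0 := by
  simp [shadow]

/-- The line over `x` in the kernel direction of `shadow w`. -/
def shadowLine (w x : Fin n → ℝ) (z : ℝ) : Fin (n + 1) → ℝ :=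
  Fin.cons 0 x + z • shadowDir w

theorem shadowLine_eq (w x : Fin n → ℝ) (z : ℝ) :
    shadowLine w x z = Fin.cons z (x - z • w) := by
  ext i
  cases i using Fin.cases <;> simp [shadowLine, shadowDir, sub_eq_add_neg]

theorem shadowLine_add (w x : Fin n → ℝ) (z t : ℝ) :
    shadowLine w x (z + t) = shadowLine w x z + t • shadowDir w := by
  simp only [shadowLine, add_smul, add_assoc]

theorem shadow_shadowLine (w x : Fin n → ℝ) (z : ℝ) : shadow w (shadowLine w x z) = x := by
  ext i
  simp [shadowLine_eq, shadow_apply]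
  ring

theorem shadowLine_shadow (w : Fin n → ℝ) (y : Fin (n + 1) → ℝ) :
    shadowLine w (shadow w y) (y 0) = y := by
  ext i
  cases i using Fin.cases <;> simp [shadowLine_eq, shadow_apply]
  ring

theorem measurePreserving_shadowLine (w : Fin n → ℝ) :
    MeasurePreserving (fun p : (Fin n → ℝ) × ℝ => shadowLine w p.1 p.2)
      (volume.prod volume) volume := by
  have hshear : MeasurePreserving (fun p : ℝ × (Fin n → ℝ) => (p.1, p.2 - p.1 • w))
      (volume.prod volume) (volume.prod volume) :=
    (MeasurePreserving.id volume).skew_product (g := fun z x => x - z • w) (by fun_prop)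
      (.of_forall fun z => (measurePreserving_sub_right volume (z • w)).map_eq)
  have hcons := (volume_preserving_piFinSuccAbove (fun _ : Fin (n + 1) => ℝ) 0).symm
  have hfactor : (fun p : (Fin n → ℝ) × ℝ => shadowLine w p.1 p.2)
      = ((MeasurableEquiv.piFinSuccAbove (fun _ : Fin (n + 1) => ℝ) 0).symm
        ∘ fun p => (p.1, p.2 - p.1 • w)) ∘ Prod.swap := by
    ext p : 1
    rw [shadowLine_eq]
    simp [MeasurableEquiv.piFinSuccAbove, Fin.insertNthEquiv]
  rw [hfactor]
  exact (hcons.comp hshear).comp (Measure.measurePreserving_swap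
    (μ := (volume : Measure (Fin n → ℝ))) (ν := (volume : Measure ℝ)))

theorem volume_eq_lintegral_shadowLine (w : Fin n → ℝ) {K : Set (Fin (n + 1) → ℝ)}
    (hK : MeasurableSet K) : volume K = ∫⁻ x, volume {z | shadowLine w x z ∈ K} := by
  rw [← (measurePreserving_shadowLine w).measure_preimage hK.nullMeasurableSet,
    Measure.prod_apply ((measurePreserving_shadowLine w).measurable hK)]
  rfl

theorem convex_shadowLine_preimage (w x : Fin n → ℝ) {K : Set (Fin (n + 1) → ℝ)}
    (hc : Convex ℝ K) : Convex ℝ {z | shadowLine w x z ∈ K} := by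
  have hline : shadowLine w x
      = AffineMap.lineMap (k := ℝ) (Fin.cons 0 x : Fin (n + 1) → ℝ)
          (Fin.cons 0 x + shadowDir w) := by
    ext1 z
    rw [AffineMap.lineMap_apply, shadowLine, vsub_eq_sub, vadd_eq_add, add_sub_cancel_left,
      add_comm (z • _)]
  rw [hline]
  exact hc.affine_preimage _

theorem exists_shadowLine_preimage_eq_Icc (w x : Fin n → ℝ) {K : Set (Fin (n + 1) → ℝ)}
    (hK : IsCompact K) (hc : Convex ℝ K) (hx : x ∈ shadow w '' K) :
    ∃ p q : ℝ, p ≤ q ∧ {z | shadowLine w x z ∈ K} = Icc p q := by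
  have hcont : Continuous (shadowLine w x) := by
    unfold shadowLine
    fun_prop
  have hsub : {z | shadowLine w x z ∈ K} ⊆ (fun y : Fin (n + 1) → ℝ => y 0) '' K :=
    fun z hz => ⟨_, hz, by simp [shadowLine_eq]⟩
  have hcomp : IsCompact {z | shadowLine w x z ∈ K} :=
    (hK.image (continuous_apply 0)).of_isClosed_subset (hK.isClosed.preimage hcont) hsub
  have hne : {z | shadowLine w x z ∈ K}.Nonempty := by
    obtain ⟨y, hy, rfl⟩ := hx
    exact ⟨y 0, by rwa [mem_ofPred_eq, shadowLine_shadow]⟩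
  have hIcc := eq_Icc_of_connected_compact
    ⟨hne, (convex_shadowLine_preimage w x hc).isPreconnected⟩ hcomp
  exact ⟨_, _, nonempty_Icc.1 (hIcc ▸ hne), hIcc⟩

theorem shadowLine_preimage_add_segment (w x : Fin n → ℝ) {a : ℝ} (ha : 0 ≤ a)
    (K : Set (Fin (n + 1) → ℝ)) :
    {z | shadowLine w x z ∈ K + segment ℝ 0 (a • shadowDir w)}
      = {z | shadowLine w x z ∈ K} + Icc 0 a := by
  ext z
  rw [segment_zero_smul_eq_image ha, mem_ofPred_eq, Set.mem_add, Set.mem_add]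
  constructor
  · rintro ⟨y, hy, _, ⟨t, ht, rfl⟩, h⟩
    refine ⟨z - t, ?_, t, ht, sub_add_cancel z t⟩
    rw [← sub_add_cancel z t, shadowLine_add] at h
    rwa [mem_ofPred_eq, ← add_right_cancel h]
  · rintro ⟨z', hz', t, ht, rfl⟩
    exact ⟨_, hz', _, ⟨t, ht, rfl⟩, (shadowLine_add w x z' t).symm⟩

theorem volume_shadowLine_preimage_add_Icc (w x : Fin n → ℝ) {a : ℝ} (ha : 0 ≤ a)
    {K : Set (Fin (n + 1) → ℝ)} (hK : IsCompact K) (hc : Convex ℝ K) :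
    volume ({z | shadowLine w x z ∈ K} + Icc 0 a)
      = volume {z | shadowLine w x z ∈ K}
        + (shadow w '' K).indicator (fun _ => ENNReal.ofReal a) x := by
  by_cases hx : x ∈ shadow w '' K
  · obtain ⟨p, q, hpq, h⟩ := exists_shadowLine_preimage_eq_Icc w x hK hc hx
    rw [h, Set.Icc_add_Icc hpq ha, Real.volume_Icc, Real.volume_Icc, indicator_of_mem hx,
      ← ENNReal.ofReal_add (by linarith) ha]
    congr 1
    ring
  · have hempty : {z | shadowLine w x z ∈ K} = ∅ :=
      eq_empty_of_forall_notMem fun z hz => hx ⟨_, hz, shadow_shadowLine w x z⟩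
    rw [hempty, empty_add, indicator_of_notMem hx]
    simp

theorem volume_real_add_segment (w : Fin n → ℝ) {a : ℝ} (ha : 0 ≤ a) {K : Set (Fin (n + 1) → ℝ)}
    (hK : IsCompact K) (hc : Convex ℝ K) :
    volume.real (K + segment ℝ 0 (a • shadowDir w))
      = volume.real K + a * volume.real (shadow w '' K) := by
  have hKa := hK.add (isCompact_segment 0 (a • shadowDir w))
  have hsh : IsCompact (shadow w '' K) := hK.image (shadow w).continuous
  have hvol : volume (K + segment ℝ 0 (a • shadowDir w))
      = volume K + ENNReal.ofReal a * volume (shadow w '' K) := by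
    rw [volume_eq_lintegral_shadowLine w hKa.measurableSet,
      volume_eq_lintegral_shadowLine w hK.measurableSet]
    simp_rw [shadowLine_preimage_add_segment w _ ha,
      volume_shadowLine_preimage_add_Icc w _ ha hK hc]
    rw [lintegral_add_right _ (measurable_const.indicator hsh.measurableSet),
      lintegral_indicator_const hsh.measurableSet]
  rw [Measure.real, hvol, ENNReal.toReal_add hK.measure_ne_top
    (ENNReal.mul_ne_top ENNReal.ofReal_ne_top hsh.measure_ne_top), ENNReal.toReal_mul,
    ENNReal.toReal_ofReal ha, Measure.real, Measure.real]

theorem sum_finset_fin_succ {M : Type*} [AddCommMonoid M] (F : Finset (Fin (n + 1)) → M) :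
    ∑ S, F S = ∑ S : Finset (Fin n),
      (F (S.map (Fin.succEmb n)) + F (insert 0 (S.map (Fin.succEmb n)))) := by
  classical
  have huniv : (Finset.univ : Finset (Finset (Fin (n + 1))))
      = (insert 0 (Finset.univ.map (Fin.succEmb n))).powerset := by
    rw [← Finset.powerset_univ, Fin.univ_succ, Finset.cons_eq_insert]
    rfl
  have hmap : (Finset.univ.map (Fin.succEmb n)).powerset
      = (Finset.univ : Finset (Finset (Fin n))).map
        ⟨fun S => S.map (Fin.succEmb n), Finset.map_injective _⟩ := by
    ext T
    simp [Finset.subset_map_iff, eq_comm]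
  rw [huniv, Finset.sum_powerset_insert (by simp), hmap, Finset.sum_map, Finset.sum_map,
    ← Finset.sum_add_distrib]
  rfl

theorem polarVol_cons (L : Set (Fin (n + 1) → ℝ)) (K : Fin n → Set (Fin (n + 1) → ℝ)) :
    polarVol (Fin.cons L K : Fin (n + 1) → Set (Fin (n + 1) → ℝ))
      = ∑ S : Finset (Fin n), (-1 : ℝ) ^ (n - S.card) *
          (volume.real (∑ i ∈ S, K i + L) - volume.real (∑ i ∈ S, K i)) := by
  rw [polarVol, sum_finset_fin_succ]
  refine Finset.sum_congr rfl fun S _ => ?_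
  have h0S : (0 : Fin (n + 1)) ∉ S.map (Fin.succEmb n) := by simp
  have hS : S.card ≤ n := by simpa using S.card_le_univ
  simp only [Finset.card_insert_of_notMem h0S, Finset.card_map, Finset.sum_insert h0S,
    Finset.sum_map, Fin.coe_succEmb, Fin.cons_succ, Fin.cons_zero, Fintype.card_fin,
    Nat.add_sub_add_right]
  rw [Nat.succ_sub hS, pow_succ, add_comm L]
  ring

theorem polarVol_cons_segment (w : Fin n → ℝ) {a : ℝ} (ha : 0 ≤ a)
    {K : Fin n → Set (Fin (n + 1) → ℝ)} (hK : ∀ i, IsCompact (K i)) (hc : ∀ i, Convex ℝ (K i)) :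
    polarVol (Fin.cons (segment ℝ 0 (a • shadowDir w)) K : Fin (n + 1) → Set (Fin (n + 1) → ℝ))
      = a * polarVol fun i => shadow w '' K i := by
  rw [polarVol_cons, polarVol, Finset.mul_sum]
  refine Finset.sum_congr rfl fun S _ => ?_
  rw [volume_real_add_segment w ha (isCompact_finsetSum S fun i _ => hK i)
    (convex_sum K fun i _ => hc i), image_finsetSum, Fintype.card_fin]
  ring

end

/-! ### Approximation by polytopes -/

section

/-- An increasing sequence of convex sets that exhausts a dense subset of the compact set `K`. -/
structure Exhausts {E : Type*} [AddCommGroup E] [Module ℝ E] [TopologicalSpace E]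
    (U : ℕ → Set E) (K : Set E) : Prop where
  monotone : Monotone U
  convex : ∀ j, Convex ℝ (U j)
  isCompact : IsCompact K
  subset : ∀ j, U j ⊆ K
  subset_closure : K ⊆ closure (⋃ j, U j)

namespace Exhausts

theorem image {E F : Type*} [AddCommGroup E] [Module ℝ E] [TopologicalSpace E]
    [AddCommGroup F] [Module ℝ F] [TopologicalSpace F] {U : ℕ → Set E} {K : Set E}
    (h : Exhausts U K) (T : E →L[ℝ] F) : Exhausts (fun j => T '' U j) (T '' K) where
  monotone _ _ hij := image_mono (h.monotone hij)
  convex j := (h.convex j).linear_image T.toLinearMap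
  isCompact := h.isCompact.image T.continuous
  subset j := image_mono (h.subset j)
  subset_closure := by
    rw [← image_iUnion]
    exact (image_mono h.subset_closure).trans (image_closure_subset_closure_image T.continuous)

variable {E : Type*} [AddCommGroup E] [Module ℝ E] [TopologicalSpace E]

theorem zero : Exhausts (0 : ℕ → Set E) 0 where
  monotone _ _ _ := le_rfl
  convex _ := convex_singleton (0 : E)
  isCompact := isCompact_singleton
  subset _ := subset_rfl
  subset_closure := (subset_iUnion (fun _ : ℕ => (0 : Set E)) 0).trans _root_.subset_closure

variable [ContinuousAdd E]

theorem add {U U' : ℕ → Set E} {K K' : Set E} (h : Exhausts U K) (h' : Exhausts U' K') :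
    Exhausts (U + U') (K + K') where
  monotone _ _ hij := add_subset_add (h.monotone hij) (h'.monotone hij)
  convex j := (h.convex j).add (h'.convex j)
  isCompact := h.isCompact.add h'.isCompact
  subset j := add_subset_add (h.subset j) (h'.subset j)
  subset_closure := by
    rintro _ ⟨x, hx, y, hy, rfl⟩
    refine map_mem_closure₂ continuous_add (h.subset_closure hx) (h'.subset_closure hy) ?_
    intro a ha b hb
    obtain ⟨i, hi⟩ := mem_iUnion.1 ha
    obtain ⟨j, hj⟩ := mem_iUnion.1 hb
    exact mem_iUnion.2 ⟨max i j, add_mem_add (h.monotone (le_max_left i j) hi)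
      (h'.monotone (le_max_right i j) hj)⟩

theorem sum {α : Type*} (S : Finset α) {U : α → ℕ → Set E} {K : α → Set E}
    (h : ∀ a, Exhausts (U a) (K a)) : Exhausts (fun j => ∑ a ∈ S, U a j) (∑ a ∈ S, K a) := by
  classical
  have h' : Exhausts (∑ a ∈ S, U a) (∑ a ∈ S, K a) := by
    induction S using Finset.induction_on with
    | empty => exact zero
    | insert a S ha ih =>
      rw [Finset.sum_insert ha, Finset.sum_insert ha]
      exact (h a).add ih
  convert h' using 1
  ext1 j
  rw [Finset.sum_apply]

theorem tendsto_volume_real {ι : Type*} [Fintype ι] {U : ℕ → Set (ι → ℝ)} {K : Set (ι → ℝ)}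
    (h : Exhausts U K) :
    Tendsto (fun j => volume.real (U j)) atTop (𝓝 (volume.real K)) := by
  have hconv : Convex ℝ (⋃ j, U j) :=
    Directed.convex_iUnion h.monotone.directed_le fun {j} => h.convex j
  have hcl : closure (⋃ j, U j) = K :=
    (closure_minimal (iUnion_subset h.subset) h.isCompact.isClosed).antisymm h.subset_closure
  have hvol : volume K = volume (⋃ j, U j) := by
    refine le_antisymm ?_ (measure_mono (iUnion_subset h.subset))
    calc volume K = volume ((⋃ j, U j) ∪ frontier (⋃ j, U j)) := by
          rw [← closure_eq_self_union_frontier, hcl]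
      _ ≤ volume (⋃ j, U j) + volume (frontier (⋃ j, U j)) := measure_union_le _ _
      _ = volume (⋃ j, U j) := by rw [hconv.addHaar_frontier volume, add_zero]
  have ht := tendsto_measure_iUnion_atTop (μ := volume) h.monotone
  rw [← hvol] at ht
  exact (ENNReal.tendsto_toReal h.isCompact.measure_ne_top).comp ht

end Exhausts

theorem exists_exhausts_polytope {ι : Type*} [Finite ι] {K : Set (ι → ℝ)} (hK : IsCompact K)
    (hc : Convex ℝ K) (hne : K.Nonempty) :
    ∃ U : ℕ → Set (ι → ℝ), Exhausts U K ∧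
      ∀ j, ∃ s : Set (ι → ℝ), s.Finite ∧ s.Nonempty ∧ U j = convexHull ℝ s := by
  have := hne.to_subtype
  obtain ⟨p, hp⟩ := TopologicalSpace.exists_dense_seq K
  let s : ℕ → Set (ι → ℝ) := fun j => (fun k => (p k : ι → ℝ)) '' Iic j
  have hmem : ∀ k, (p k : ι → ℝ) ∈ s k := fun k => ⟨k, self_mem_Iic, rfl⟩
  refine ⟨fun j => convexHull ℝ (s j), ⟨?_, fun j => convex_convexHull ℝ _, hK, ?_, ?_⟩,
    fun j => ⟨s j, (finite_Iic j).image _, ⟨_, hmem j⟩, rfl⟩⟩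
  · exact fun i j hij => convexHull_mono (image_mono (Set.Iic_subset_Iic.2 hij))
  · exact fun j => convexHull_min (by rintro _ ⟨k, _, rfl⟩; exact (p k).2) hc
  · intro x hx
    have hdense : x ∈ closure (Subtype.val '' range p) :=
      image_closure_subset_closure_image continuous_subtype_val ⟨⟨x, hx⟩, hp _, rfl⟩
    refine closure_mono ?_ hdense
    rintro _ ⟨_, ⟨k, rfl⟩, rfl⟩
    exact mem_iUnion.2 ⟨k, subset_convexHull _ _ (hmem k)⟩

variable {n : ℕ}

theorem smul_shadowDir_add {a b : ℝ} (hab : a + b = 1) (u v : Fin n → ℝ) :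
    a • shadowDir u + b • shadowDir v = shadowDir (a • u + b • v) := by
  ext i
  cases i using Fin.cases
  · simp [shadowDir, hab]
  · simp [shadowDir]
    ring

theorem polarVol_shadow_le_of_hasPotential {K : Fin n → Set (Fin (n + 1) → ℝ)}
    (hK : ∀ i, HasPotential (K i)) (u v : Fin n → ℝ) {a b : ℝ} (ha : 0 ≤ a) (hb : 0 ≤ b)
    (hab : a + b = 1) :
    polarVol (fun i => shadow (a • u + b • v) '' K i)
      ≤ a * polarVol (fun i => shadow u '' K i) + b * polarVol (fun i => shadow v '' K i) := by
  have hcons : ∀ (w : Fin n → ℝ) {c : ℝ}, 0 ≤ c →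
      polarVol (Function.update
        (Fin.cons (segment ℝ 0 0) K : Fin (n + 1) → Set (Fin (n + 1) → ℝ)) 0
        (segment ℝ 0 (c • shadowDir w))) = c * polarVol fun i => shadow w '' K i := by
    intro w c hc
    rw [Fin.update_cons_zero]
    exact polarVol_cons_segment w hc (fun i => (hK i).isCompact) fun i => (hK i).convex
  have hsub := polarVol_update_segment_le
    (K := (Fin.cons (segment ℝ 0 0) K : Fin (n + 1) → Set (Fin (n + 1) → ℝ)))
    (Fin.cases (hasPotential_segment 0 0) hK) 0 (a • shadowDir u) (b • shadowDir v)
  rwa [smul_shadowDir_add hab, ← one_smul ℝ (shadowDir (a • u + b • v)), hcons _ zero_le_one,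
    hcons _ ha, hcons _ hb, one_mul] at hsub

theorem polarVol_shadow_le {K : Fin n → Set (Fin (n + 1) → ℝ)}
    (hK : ∀ i, IsCompact (K i)) (hc : ∀ i, Convex ℝ (K i)) (hne : ∀ i, (K i).Nonempty)
    (u v : Fin n → ℝ) {a b : ℝ} (ha : 0 ≤ a) (hb : 0 ≤ b) (hab : a + b = 1) :
    polarVol (fun i => shadow (a • u + b • v) '' K i)
      ≤ a * polarVol (fun i => shadow u '' K i) + b * polarVol (fun i => shadow v '' K i) := by
  choose U hU hs using fun i => exists_exhausts_polytope (hK i) (hc i) (hne i)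
  have hlim : ∀ w : Fin n → ℝ, Tendsto (fun j => polarVol fun i => shadow w '' U i j)
      atTop (𝓝 (polarVol fun i => shadow w '' K i)) := fun w =>
    tendsto_finsetSum _ fun S _ =>
      (Exhausts.sum S fun i => (hU i).image (shadow w)).tendsto_volume_real.const_mul _
  have hpot : ∀ i j, HasPotential (U i j) := by
    intro i j
    obtain ⟨s, hsfin, hsne, hUs⟩ := hs i j
    exact hUs ▸ hasPotential_convexHull hsfin hsne
  exact le_of_tendsto_of_tendsto' (hlim _) (((hlim u).const_mul a).add ((hlim v).const_mul b))
    fun j => polarVol_shadow_le_of_hasPotential (fun i => hpot i j) u v ha hb hab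

end

/-! ### Mixed volumes of linear images -/

section

variable {n : ℕ}

theorem measureReal_image_equiv {α β : Type*} [MeasurableSpace α] [MeasurableSpace β]
    {μ : Measure α} {ν : Measure β} (e : α ≃ᵐ β) (he : MeasurePreserving e μ ν) (A : Set α) :
    ν.real (e '' A) = μ.real A := by
  rw [Measure.real, Measure.real, ← he.measure_preimage_equiv, preimage_image_eq _ e.injective]

theorem mixedVolume_eq_polarVol (K : Fin n → Set (EuclideanSpace ℝ (Fin n))) :
    mixedVolume K = (n.factorial : ℝ)⁻¹ *
      polarVol fun i => EuclideanSpace.equiv (Fin n) ℝ '' K i := by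
  rw [mixedVolume, polarVol]
  congr 1
  refine Finset.sum_congr rfl fun S _ => ?_
  rw [← image_finsetSum, Fintype.card_fin]
  congr 1
  exact (measureReal_image_equiv (MeasurableEquiv.toLp 2 (Fin n → ℝ)).symm
    (EuclideanSpace.volume_preserving_symm_measurableEquiv_toLp (Fin n)) _).symm

theorem mixedVolume_isometry (g : EuclideanSpace ℝ (Fin n) ≃ₗᵢ[ℝ] EuclideanSpace ℝ (Fin n))
    (K : Fin n → Set (EuclideanSpace ℝ (Fin n))) :
    mixedVolume (fun i => g '' K i) = mixedVolume K := by
  rw [mixedVolume, mixedVolume]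
  congr 1
  refine Finset.sum_congr rfl fun S _ => ?_
  rw [← image_finsetSum]
  congr 1
  exact measureReal_image_equiv g.toMeasurableEquiv g.measurePreserving _

variable {κ : Type*} [Fintype κ]

theorem matImage_eq_image (X : κ → EuclideanSpace ℝ (Fin n)) (D : Set (κ → ℝ)) :
    matImage X D = Fintype.linearCombination ℝ X '' D := rfl

theorem matImage_map {p : ℕ} (T : EuclideanSpace ℝ (Fin n) →ₗ[ℝ] EuclideanSpace ℝ (Fin p))
    (X : κ → EuclideanSpace ℝ (Fin n)) (D : Set (κ → ℝ)) :
    matImage (fun k => T (X k)) D = T '' matImage X D := by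
  simp only [matImage, image_image, map_sum, map_smul]

theorem isClosed_graph_matImage {D : Set (κ → ℝ)} (hD : IsCompact D) :
    IsClosed {q : (κ → EuclideanSpace ℝ (Fin n)) × EuclideanSpace ℝ (Fin n) |
      q.2 ∈ matImage q.1 D} := by
  have := isCompact_iff_compactSpace.1 hD
  have hgraph : IsClosed {r : D × (κ → EuclideanSpace ℝ (Fin n)) × EuclideanSpace ℝ (Fin n) |
      ∑ k, (r.1 : κ → ℝ) k • r.2.1 k = r.2.2} :=
    isClosed_eq (continuous_finsetSum _ fun k _ =>
      ((continuous_apply k).comp (continuous_subtype_val.comp continuous_fst)).smul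
        ((continuous_apply k).comp (continuous_fst.comp continuous_snd))) (by fun_prop)
  -- The graph is the projection of `hgraph` along the compact factor `D`.
  convert isClosedMap_snd_of_compactSpace _ hgraph using 1
  ext ⟨X, p⟩
  simp [matImage]

theorem measurable_volume_real_matImage {D : Set (κ → ℝ)} (hD : IsCompact D) :
    Measurable fun X : κ → EuclideanSpace ℝ (Fin n) => volume.real (matImage X D) :=
  (measurable_measure_prodMk_left (isClosed_graph_matImage hD).measurableSet).ennreal_toReal

theorem measurable_mixedVolume_matImage {D : Fin n → Set (κ → ℝ)} (hD : ∀ i, IsCompact (D i)) :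
    Measurable fun X : κ → EuclideanSpace ℝ (Fin n) => mixedVolume fun i => matImage X (D i) := by
  refine (Finset.measurable_fun_sum _ fun S _ => ?_).const_mul _
  simp_rw [matImage_eq_image, ← image_finsetSum]
  exact (measurable_volume_real_matImage (isCompact_finsetSum S fun i _ => hD i)).const_mul _

/-- The lift to `ℝⁿ⁺¹` of the linear map with columns `Y k + s k • e`, with the coordinate
`c ↦ ∑ₖ c k * v k` in front, so that the matrices `Y k + (s k + r * v k) • e` are its shadows. -/
def lineLift (Y : κ → EuclideanSpace ℝ (Fin n)) (e : EuclideanSpace ℝ (Fin n)) (s v : κ → ℝ) :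
    (κ → ℝ) →ₗ[ℝ] (Fin (n + 1) → ℝ) :=
  LinearMap.pi (Fin.cons (Fintype.linearCombination ℝ v) fun i =>
    LinearMap.proj i ∘ₗ (EuclideanSpace.equiv (Fin n) ℝ).toLinearMap ∘ₗ
      Fintype.linearCombination ℝ fun k => Y k + s k • e)

theorem equiv_image_matImage_line (Y : κ → EuclideanSpace ℝ (Fin n))
    (e : EuclideanSpace ℝ (Fin n)) (s v : κ → ℝ) (r : ℝ) (D : Set (κ → ℝ)) :
    EuclideanSpace.equiv (Fin n) ℝ '' matImage (fun k => Y k + (s + r • v) k • e) D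
      = shadow (r • EuclideanSpace.equiv (Fin n) ℝ e) '' (lineLift Y e s v '' D) := by
  rw [matImage, image_image, image_image]
  refine image_congr fun c _ => ?_
  ext i
  rw [shadow_apply]
  simp only [lineLift, LinearMap.pi_apply, Fin.cons_succ, Fin.cons_zero, LinearMap.comp_apply,
    LinearMap.proj_apply, Fintype.linearCombination_apply, map_sum, Finset.sum_apply,
    Pi.smul_apply, smul_eq_mul, Finset.mul_sum, map_smul, map_add, Pi.add_apply,
    ContinuousLinearEquiv.coe_toLinearEquiv, LinearEquiv.coe_coe, ← Finset.sum_add_distrib]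
  exact Finset.sum_congr rfl fun k _ => by ring

theorem mixedVolume_line_le {D : Fin n → Set (κ → ℝ)} (hD : ∀ i, IsCompact (D i))
    (hDc : ∀ i, Convex ℝ (D i)) (hDne : ∀ i, (D i).Nonempty)
    (Y : κ → EuclideanSpace ℝ (Fin n)) (e : EuclideanSpace ℝ (Fin n))
    (s t : κ → ℝ) {a b : ℝ} (ha : 0 ≤ a) (hb : 0 ≤ b) (hab : a + b = 1) :
    mixedVolume (fun i => matImage (fun k => Y k + (a • s + b • t) k • e) (D i))
      ≤ a * mixedVolume (fun i => matImage (fun k => Y k + s k • e) (D i))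
        + b * mixedVolume (fun i => matImage (fun k => Y k + t k • e) (D i)) := by
  set T := lineLift Y e s (t - s)
  set w := EuclideanSpace.equiv (Fin n) ℝ e
  have hshadow : ∀ (u : κ → ℝ) (r : ℝ), u = s + r • (t - s) →
      mixedVolume (fun i => matImage (fun k => Y k + u k • e) (D i))
        = (n.factorial : ℝ)⁻¹ * polarVol fun i => shadow (r • w) '' (T '' D i) := by
    rintro _ r rfl
    simp only [mixedVolume_eq_polarVol, equiv_image_matImage_line, T, w]
  have hcomb : a • s + b • t = s + b • (t - s) := by
    rw [← eq_sub_iff_add_eq] at hab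
    rw [hab]
    module
  have hconv := polarVol_shadow_le (K := fun i => T '' D i)
    (fun i => (hD i).image T.continuous_of_finiteDimensional) (fun i => (hDc i).linear_image T)
    (fun i => (hDne i).image T) ((0 : ℝ) • w) ((1 : ℝ) • w) ha hb hab
  rw [smul_smul, smul_smul, ← add_smul, mul_zero, zero_add, mul_one] at hconv
  rw [hshadow _ b hcomb, hshadow s 0 (by simp), hshadow t 1 (by simp)]
  calc _ ≤ _ := mul_le_mul_of_nonneg_left hconv (by positivity)
    _ = _ := by ring

theorem isSteinerConvex_mixedVolume_le {d : ℕ} {D : Fin (d + 1) → Set (κ → ℝ)}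
    (hD : ∀ i, IsCompact (D i)) (hDc : ∀ i, Convex ℝ (D i)) (hDne : ∀ i, (D i).Nonempty) {c : ℝ}
    (hc : 0 ≤ c) :
    IsSteinerConvex {X : κ → EuclideanSpace ℝ (Fin (d + 1)) |
      c * mixedVolume (fun i => matImage X (D i)) ≤ 1} where
  measurableSet := measurableSet_le ((measurable_mixedVolume_matImage hD).const_mul c)
    measurable_const
  isometry_mem g X hX := by
    have himage : ∀ i, matImage (fun k => g (X k)) (D i) = g '' matImage X (D i) :=
      fun i => matImage_map g.toLinearMap X (D i)
    simpa only [mem_ofPred_eq, himage, mixedVolume_isometry] using hX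
  convex Y s hs t ht a b ha hb hab := by
    have hline := mul_le_mul_of_nonneg_left
      (mixedVolume_line_le hD hDc hDne Y (EuclideanSpace.single 0 1) s t ha hb hab) hc
    have hs' := mul_le_mul_of_nonneg_left hs ha
    have ht' := mul_le_mul_of_nonneg_left ht hb
    rw [mem_ofPred_eq, mem_ofPred_eq]
    linarith

end

/-! ### Mixed projection bodies of random sets -/

section

variable {σ : Type*} {d : ℕ}

/-- Extension of a vector of coefficients by `0` at `none`. -/
def extendZero (σ : Type*) : (σ → ℝ) →ₗ[ℝ] (Option σ → ℝ) where
  toFun c k := k.elim 0 c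
  map_add' c c' := by ext k; cases k <;> simp
  map_smul' r c := by ext k; cases k <;> simp

/-- The coefficient bodies whose images under the columns `(X, θ)`, with `θ` in position `none`, are
`X C₁, …, X C_d` and `[0, θ]`. -/
def coeffBody (C : Fin d → Set (σ → ℝ)) : Fin (d + 1) → Set (Option σ → ℝ) :=
  Fin.snoc (α := fun _ => Set (Option σ → ℝ)) (fun i => extendZero σ '' C i)
    (segment ℝ 0 fun k => k.elim 1 0)

theorem coeffBody_induction {p : Set (Option σ → ℝ) → Prop} {C : Fin d → Set (σ → ℝ)}
    (h : ∀ i, p (extendZero σ '' C i)) (h' : ∀ u, p (segment ℝ 0 u)) (i : Fin (d + 1)) :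
    p (coeffBody C i) := by
  refine Fin.lastCases ?_ (fun i => ?_) i
  · simpa [coeffBody] using h' _
  · simpa [coeffBody] using h i

variable [Fintype σ]

theorem matImage_coeffBody (C : Fin d → Set (σ → ℝ))
    (X : Option σ → EuclideanSpace ℝ (Fin (d + 1))) :
    (fun i => matImage X (coeffBody C i))
      = Fin.snoc (α := fun _ => Set (EuclideanSpace ℝ (Fin (d + 1))))
        (fun i => matImage (fun k => X (some k)) (C i)) (segment ℝ 0 (X none)) := by
  ext1 i
  refine Fin.lastCases ?_ (fun i => ?_) i
  · rw [coeffBody, Fin.snoc_last, Fin.snoc_last, matImage_eq_image, ← LinearMap.coe_toAffineMap,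
      image_segment]
    simp [Fintype.linearCombination_apply, Fintype.sum_option]
  · rw [coeffBody, Fin.snoc_castSucc, Fin.snoc_castSucc, matImage, matImage, image_image]
    refine image_congr fun c _ => ?_
    simp [Fintype.sum_option, extendZero]

theorem isSteinerConvex_mixedProjSupport_le {C : Fin d → Set (σ → ℝ)}
    (hC : ∀ i, IsCompact (C i)) (hCc : ∀ i, Convex ℝ (C i)) (hCne : ∀ i, (C i).Nonempty) :
    IsSteinerConvex {X : Option σ → EuclideanSpace ℝ (Fin (d + 1)) |
      mixedProjSupport (fun i => matImage (fun k => X (some k)) (C i)) (X none) ≤ 1} := by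
  have h := isSteinerConvex_mixedVolume_le (D := coeffBody C) (c := ((d + 1 : ℕ) : ℝ))
    (coeffBody_induction (fun i => (hC i).image (extendZero σ).continuous_of_finiteDimensional)
      fun u => isCompact_segment 0 u)
    (coeffBody_induction (fun i => (hCc i).linear_image _) fun u => convex_segment 0 u)
    (coeffBody_induction (fun i => (hCne i).image _) fun u => ⟨0, left_mem_segment ℝ 0 u⟩)
    (Nat.cast_nonneg _)
  simp only [matImage_coeffBody] at h
  exact h

theorem lintegral_fin_prod_eq_prod {n : ℕ} {α : Fin n → Type*} [∀ i, MeasurableSpace (α i)]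
    (μ : ∀ i, Measure (α i)) [∀ i, SigmaFinite (μ i)] {f : ∀ i, α i → ℝ≥0∞}
    (hf : ∀ i, Measurable (f i)) :
    ∫⁻ x, ∏ i, f i (x i) ∂Measure.pi μ = ∏ i, ∫⁻ x, f i x ∂μ i := by
  induction n with
  | zero => simp
  | succ n ih =>
    have hm : Measurable fun y : ∀ i : Fin n, α i.succ => ∏ i, f i.succ (y i) :=
      Finset.measurable_fun_prod _ fun i _ => (hf i.succ).comp (measurable_pi_apply i)
    rw [Fin.prod_univ_succ, ← ih (fun i => μ i.succ) fun i => hf i.succ,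
      ← lintegral_prod_mul (hf 0).aemeasurable hm.aemeasurable,
      ← (measurePreserving_piFinSuccAbove μ 0).symm.lintegral_comp_emb
        (MeasurableEquiv.measurableEmbedding _)]
    refine lintegral_congr fun x => ?_
    rw [Fin.prod_univ_succ]
    rfl

theorem lintegral_pi_prod_eq_prod {σ : Type*} [Fintype σ] {α : σ → Type*}
    [∀ i, MeasurableSpace (α i)] (μ : ∀ i, Measure (α i)) [∀ i, SigmaFinite (μ i)]
    {f : ∀ i, α i → ℝ≥0∞} (hf : ∀ i, Measurable (f i)) :
    ∫⁻ x, ∏ i, f i (x i) ∂Measure.pi μ = ∏ i, ∫⁻ x, f i x ∂μ i := by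
  let e := (Fintype.equivFin σ).symm
  rw [← (measurePreserving_piCongrLeft μ e).lintegral_comp_emb
    (MeasurableEquiv.measurableEmbedding _), ← e.prod_comp,
    ← lintegral_fin_prod_eq_prod (fun i => μ (e i)) fun i => hf (e i)]
  simp_rw [← e.prod_comp, MeasurableEquiv.piCongrLeft_apply_apply]

theorem indicator_univ_pi_prod {σ : Type*} [Fintype σ] {α : σ → Type*} (s : ∀ i, Set (α i))
    (f : ∀ i, α i → ℝ≥0∞) (x : ∀ i, α i) :
    (univ.pi s).indicator (fun x => ∏ i, f i (x i)) x = ∏ i, (s i).indicator (f i) (x i) := by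
  by_cases hx : ∀ i, x i ∈ s i
  · rw [indicator_of_mem (by simpa using hx)]
    exact Finset.prod_congr rfl fun i _ => (indicator_of_mem (hx i) _).symm
  · rw [indicator_of_notMem (by simpa using hx)]
    push Not at hx
    obtain ⟨i, hi⟩ := hx
    exact (Finset.prod_eq_zero (Finset.mem_univ i) (indicator_of_notMem hi _)).symm

theorem pi_withDensity {σ : Type*} [Fintype σ] {α : σ → Type*} [∀ i, MeasurableSpace (α i)]
    (μ : ∀ i, Measure (α i)) [∀ i, SigmaFinite (μ i)] {f : ∀ i, α i → ℝ≥0∞}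
    (hf : ∀ i, Measurable (f i)) [∀ i, SigmaFinite ((μ i).withDensity (f i))] :
    Measure.pi (fun i => (μ i).withDensity (f i))
      = (Measure.pi μ).withDensity fun x => ∏ i, f i (x i) := by
  refine Measure.pi_eq fun s hs => ?_
  rw [withDensity_apply _ (MeasurableSet.univ_pi hs),
    ← lintegral_indicator (MeasurableSet.univ_pi hs)]
  simp_rw [indicator_univ_pi_prod]
  rw [lintegral_pi_prod_eq_prod μ fun i => (hf i).indicator (hs i)]
  refine Finset.prod_congr rfl fun i _ => ?_
  rw [lintegral_indicator (hs i), withDensity_apply _ (hs i)]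

theorem map_pi_prod_withDensity {σ Ω : Type*} [Fintype σ] {α : σ → Type*}
    [∀ i, MeasurableSpace (α i)] [MeasurableSpace Ω] {P : Measure Ω} [IsProbabilityMeasure P]
    {μ : ∀ i, Measure (α i)} [∀ i, SigmaFinite (μ i)] {f : ∀ i, α i → ℝ≥0∞}
    (hf : ∀ i, Measurable (f i)) {X : ∀ i, Ω → α i} (hX : ∀ i, AEMeasurable (X i) P)
    (hind : iIndepFun X P) (hlaw : ∀ i, P.map (X i) = (μ i).withDensity (f i)) :
    P.map (fun ω i => X i ω) = (Measure.pi μ).withDensity fun x => ∏ i, f i (x i) := by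
  have hprob : ∀ i, IsProbabilityMeasure ((μ i).withDensity (f i)) :=
    fun i => hlaw i ▸ Measure.isProbabilityMeasure_map (hX i)
  rw [(iIndepFun_iff_map_fun_eq_pi_map hX).1 hind]
  simp_rw [hlaw]
  exact pi_withDensity μ hf

theorem lintegral_radialMeasure_section {n : ℕ} {σ : Type*} [Fintype σ]
    {f : σ → EuclideanSpace ℝ (Fin n) → ℝ≥0∞} (hf : ∀ k, Measurable (f k))
    {Ω : Type*} [MeasurableSpace Ω] {P : Measure Ω} [IsProbabilityMeasure P]
    {X : σ → Ω → EuclideanSpace ℝ (Fin n)} (hX : ∀ k, AEMeasurable (X k) P) (hind : iIndepFun X P)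
    (hlaw : ∀ k, P.map (X k) = volume.withDensity (f k)) {ρ : ℝ≥0 → ℝ≥0∞} (hρ : Measurable ρ)
    {G : Set (Option σ → EuclideanSpace ℝ (Fin n))} (hG : MeasurableSet G) :
    ∫⁻ ω, radialMeasure n ρ {θ | (fun k : Option σ => k.elim θ fun k => X k ω) ∈ G} ∂P
      = ∫⁻ Z in G, ρ ‖Z none‖₊ * ∏ k, f k (Z (some k)) := by
  let e := MeasurableEquiv.piOptionEquivProd (fun _ : Option σ => EuclideanSpace ℝ (Fin n))
  have he : ∀ x θ, e.symm (x, θ) = fun k : Option σ => k.elim θ x := by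
    intro x θ
    ext1 k
    cases k <;> rfl
  have hpres : MeasurePreserving e.symm (volume.prod volume) volume :=
    ⟨e.symm.measurable, Measure.pi_map_piOptionEquivProd fun _ => volume⟩
  have hG' : MeasurableSet (e.symm ⁻¹' G) := e.symm.measurable hG
  have hprod : Measurable fun x : σ → EuclideanSpace ℝ (Fin n) => ∏ k, f k (x k) :=
    Finset.measurable_fun_prod _ fun k _ => (hf k).comp (measurable_pi_apply k)
  have hweight : Measurable fun θ : EuclideanSpace ℝ (Fin n) => ρ ‖θ‖₊ := hρ.comp measurable_nnnorm
  have hν : SFinite (radialMeasure n ρ) := by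
    unfold radialMeasure
    infer_instance
  calc _ = ∫⁻ ω, radialMeasure n ρ (Prod.mk (fun k => X k ω) ⁻¹' (e.symm ⁻¹' G)) ∂P := by
        simp_rw [← he]
        rfl
    _ = ((P.map fun ω k => X k ω).prod (radialMeasure n ρ)) (e.symm ⁻¹' G) := by
        rw [Measure.prod_apply hG', lintegral_map' (measurable_measure_prodMk_left hG').aemeasurable
          (aemeasurable_pi_lambda _ hX)]
    _ = ∫⁻ q in e.symm ⁻¹' G, (∏ k, f k (q.1 k)) * ρ ‖q.2‖₊ ∂(volume.prod volume) := by
        rw [map_pi_prod_withDensity hf hX hind hlaw, radialMeasure,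
          prod_withDensity hprod hweight, withDensity_apply _ hG']
        rfl
    _ = ∫⁻ Z in G, ρ ‖Z none‖₊ * ∏ k, f k (Z (some k)) := by
        rw [← hpres.setLIntegral_comp_preimage_emb e.symm.measurableEmbedding]
        refine lintegral_congr fun q => ?_
        rw [mul_comm]
        rfl

theorem IsSteinerConvex.lintegral_radialMeasure_le {d : ℕ} {σ : Type*} [Finite σ]
    {G : Set (Option σ → EuclideanSpace ℝ (Fin (d + 1)))} (hG : IsSteinerConvex G)
    {f : σ → EuclideanSpace ℝ (Fin (d + 1)) → ℝ≥0∞} (hf : ∀ k, Measurable (f k))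
    {Ω Ω' : Type*} [MeasurableSpace Ω] [MeasurableSpace Ω'] {P : Measure Ω}
    [IsProbabilityMeasure P] {P' : Measure Ω'} [IsProbabilityMeasure P']
    {X : σ → Ω → EuclideanSpace ℝ (Fin (d + 1))} (hX : ∀ k, AEMeasurable (X k) P)
    (hXind : iIndepFun X P) (hXlaw : ∀ k, P.map (X k) = volume.withDensity (f k))
    {Y : σ → Ω' → EuclideanSpace ℝ (Fin (d + 1))} (hY : ∀ k, AEMeasurable (Y k) P')
    (hYind : iIndepFun Y P')
    (hYlaw : ∀ k, P'.map (Y k) = volume.withDensity (symmDecrRearrangement (f k)))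
    {ρ : ℝ≥0 → ℝ≥0∞} (hρ : Antitone ρ) :
    ∫⁻ ω, radialMeasure (d + 1) ρ {θ | (fun k : Option σ => k.elim θ fun k => X k ω) ∈ G} ∂P
      ≤ ∫⁻ ω, radialMeasure (d + 1) ρ
          {θ | (fun k : Option σ => k.elim θ fun k => Y k ω) ∈ G} ∂P' := by
  have := Fintype.ofFinite σ
  have hfin : ∀ k, ∫⁻ x, f k x ≠ ∞ := by
    intro k
    have := Measure.isProbabilityMeasure_map (hX k)
    rw [← setLIntegral_univ, ← withDensity_apply _ MeasurableSet.univ, ← hXlaw, measure_univ]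
    exact ENNReal.one_ne_top
  rw [lintegral_radialMeasure_section hf hX hXind hXlaw hρ.measurable hG.measurableSet,
    lintegral_radialMeasure_section (fun k => measurable_symmDecrRearrangement (f k)) hY hYind
      hYlaw hρ.measurable hG.measurableSet]
  exact hG.lintegral_prod_mul_le hf hfin hρ

end

end

end Petty

theorem theorem1p1 {d : ℕ} (m : Fin d → ℕ)
    (C : Fin d → Set ((Σ i : Fin d, Fin (m i)) → ℝ))
    (hCne : ∀ i, (C i).Nonempty) (hCcomp : ∀ i, IsCompact (C i))
    (hCconv : ∀ i, Convex ℝ (C i))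
    (f : (i : Fin d) → Fin (m i) → EuclideanSpace ℝ (Fin (d + 1)) → ℝ≥0∞)
    (hf : ∀ i j, Measurable (f i j))
    {Ω Ω' : Type*} [MeasurableSpace Ω] [MeasurableSpace Ω']
    (P : Measure Ω) [IsProbabilityMeasure P] (P' : Measure Ω') [IsProbabilityMeasure P']
    (X : (i : Fin d) → Fin (m i) → Ω → EuclideanSpace ℝ (Fin (d + 1)))
    (hXmeas : ∀ i j, AEMeasurable (X i j) P)
    (hXindep : iIndepFun (fun k : Σ i : Fin d, Fin (m i) => X k.1 k.2) P)
    (hXlaw : ∀ i j, P.map (X i j) = volume.withDensity (f i j))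
    (Y : (i : Fin d) → Fin (m i) → Ω' → EuclideanSpace ℝ (Fin (d + 1)))
    (hYmeas : ∀ i j, AEMeasurable (Y i j) P')
    (hYindep : iIndepFun (fun k : Σ i : Fin d, Fin (m i) => Y k.1 k.2) P')
    (hYlaw : ∀ i j, P'.map (Y i j) =
      volume.withDensity (Petty.symmDecrRearrangement (f i j)))
    (ρ : ℝ≥0 → ℝ≥0∞) (hρ : Antitone ρ) :
    ∫⁻ ω, Petty.radialMeasure (d + 1) ρ (Petty.polarMixedProj fun i =>
        Petty.matImage (fun k : Σ i : Fin d, Fin (m i) => X k.1 k.2 ω) (C i)) ∂P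
      ≤ ∫⁻ ω, Petty.radialMeasure (d + 1) ρ (Petty.polarMixedProj fun i =>
        Petty.matImage (fun k : Σ i : Fin d, Fin (m i) => Y k.1 k.2 ω) (C i)) ∂P' :=
  (Petty.isSteinerConvex_mixedProjSupport_le hCcomp hCconv hCne).lintegral_radialMeasure_le
    (fun k => hf k.1 k.2) (fun k => hXmeas k.1 k.2) hXindep (fun k => hXlaw k.1 k.2)
    (fun k => hYmeas k.1 k.2) hYindep (fun k => hYlaw k.1 k.2) hρ
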